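/- Let $(M^n,g)$ be a compact smooth Riemannian manifold without boundary, with Levi-Civita connection $\nabla$ and curvature tensor $R(x,y)=[\nabla_x,\nabla_y]-\nabla_{[x,y]}$. Let $D_1$ and $D_2=D_1^\perp$ be smooth complementary orthogonal distributions of ranks $p_1,p_2\ge 2$, $p_1+p_2=n$. Let $(e_i)_{i\le p_1}$, $(e_\alpha)_{\alpha>p_1}$ denote local orthonormal frames of $D_1$ and $D_2$. Let $K_{1,2}=\sum_{i,\alpha}g(R(e_i,e_\alpha)e_\alpha,e_i)$ be the mixed scalar curvature and $I_K=\int_M K_{1,2}\,d\mathrm{vol}$. Let $C_1^\alpha:D_1\to D_1$, $x\mapsto(\nabla_x e_\alpha)^{D_1}$, and $C_2^i:D_2\to D_2$, $x\mapsto(\nabla_x e_i)^{D_2}$, be the co-nullity operators, where the superscript denotes the orthogonal projection, and let $\sigma_2$ be the second elementary symmetric function of the eigenvalues of an operator. Let $\tilde D_1=e_1\wedge\dots\wedge e_{p_1}$, determined locally up to sign, let $|\nabla\tilde D_1|^2=\sum_{a=1}^n|\nabla_{e_a}\tilde D_1|^2$ with the norm induced by $g$ on $\bigwedge^{p_1}TM$,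 and let the total bending be $\mathcal B(D_1)=c_n\int_M|\nabla\tilde D_1|^2\,d\mathrm{vol}$, where $c_n\ge 0$ is a constant. Then all integrands below are integrable, and $$\mathcal B(D_1)\ \ge\ c_n\int_M\Big(\frac{2}{p_1-1}\sum_\alpha\sigma_2(C_1^\alpha)+\frac{2}{p_2-1}\sum_i\sigma_2(C_2^i)\Big)\,d\mathrm{vol}.$$ If $p_1=p_2=p$, then the right-hand side equals $\frac{c_n}{p-1}I_K$, so that $\mathcal B(D_1)\ge\frac{c_n}{p-1}I_K$. -/

import Mathlib

open scoped Manifold ContDiff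
open Bundle
open MeasureTheory

noncomputable section

section Coordinates

variable {n : ℕ} {M : Type*} [TopologicalSpace M] [ChartedSpace (EuclideanSpace ℝ (Fin n)) M]
  [IsManifold (𝓡 n) ∞ M]

/-- The coordinate vector field `∂ᵢ` of the chart at `c`, evaluated at a point `q` of that chart. -/
def coordVec (c : M) (i : Fin n) (q : M) : TangentSpace (𝓡 n) q :=
  (trivializationAt (EuclideanSpace ℝ (Fin n)) (TangentSpace (𝓡 n)) c).symm q
    (EuclideanSpace.single i 1)

/-- The components `(Y¹, …, Yⁿ)` at `q` of a vector field `Y` in the chart at `c`. -/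
def coordComp (c : M) (Y : Π q : M, TangentSpace (𝓡 n) q) (q : M) : EuclideanSpace ℝ (Fin n) :=
  (trivializationAt (EuclideanSpace ℝ (Fin n)) (TangentSpace (𝓡 n)) c ⟨q, Y q⟩).2

variable [RiemannianBundle (fun x : M ↦ TangentSpace (𝓡 n) x)]

/-- The matrix `gᵢⱼ = g(∂ᵢ, ∂ⱼ)` of the Riemannian metric in the chart at `c`, at the point `q`. -/
def gramMatrix (c q : M) : Matrix (Fin n) (Fin n) ℝ :=
  Matrix.of fun i j ↦ inner ℝ (coordVec c i q) (coordVec c j q)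

/-- The partial derivative `∂ₖ gᵢⱼ` in the chart at `c`, at the point `q`. -/
def gramDeriv (c q : M) (k i j : Fin n) : ℝ :=
  mvfderiv (𝓡 n) (fun r : M ↦ gramMatrix c r i j) q (coordVec c k q)

/-- The Christoffel symbol
`Γᵏᵢⱼ = ½ ∑ₗ gᵏˡ (∂ᵢ gⱼₗ + ∂ⱼ gᵢₗ - ∂ₗ gᵢⱼ)` in the chart at `c`, at the point `q`. -/
def christoffel (c q : M) (k i j : Fin n) : ℝ :=
  (1 / 2 : ℝ) * ∑ l, (gramMatrix c q)⁻¹ k l *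
    (gramDeriv c q i j l + gramDeriv c q j i l - gramDeriv c q l i j)

/-- The covariant derivative `u ↦ ∇_u Y` at `x` for the Levi-Civita connection. The components of
`∇_u Y` in the chart at `x` are
`(∇_u Y)ᵏ = dYᵏ(u) + ∑ᵢⱼ Γᵏᵢⱼ uⁱ Yʲ`. -/
def leviCivita (Y : Π q : M, TangentSpace (𝓡 n) q) (x : M) :
    TangentSpace (𝓡 n) x →L[ℝ] TangentSpace (𝓡 n) x :=
  (trivializationAt (EuclideanSpace ℝ (Fin n)) (TangentSpace (𝓡 n)) x).symmL ℝ x ∘L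
    (mvfderiv (𝓡 n) (coordComp x Y) x +
      (Matrix.toEuclideanCLM (𝕜 := ℝ)
        (Matrix.of fun k i ↦ ∑ j, christoffel x x k i j * coordComp x Y x j)) ∘L
        (trivializationAt (EuclideanSpace ℝ (Fin n)) (TangentSpace (𝓡 n)) x).continuousLinearMapAt
          ℝ x)

end Coordinates

section LinearAlgebra

/-- The second elementary symmetric function `σ₂` of the eigenvalues of a square matrix, i.e. the
coefficient of `t²` in `det (1 + t A)`, as the sum of the principal minors of order two. -/
def sigmaTwo {k : ℕ} (A : Matrix (Fin k) (Fin k) ℝ) : ℝ :=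
  ∑ i, ∑ j ∈ Finset.univ.filter (fun j ↦ i < j), (A i i * A j j - A i j * A j i)

/-- The inner product on `⋀ᵏ V` induced by the inner product of `V`; it satisfies
`⟨v₁ ∧ ⋯ ∧ vₖ, w₁ ∧ ⋯ ∧ wₖ⟩ = det ⟨vᵢ, wⱼ⟩`. -/
def wedgeInner {V : Type*} [NormedAddCommGroup V] [InnerProductSpace ℝ V] {k : ℕ}
    (a b : ⋀[ℝ]^k V) : ℝ :=
  exteriorPower.pairingDual ℝ V k (exteriorPower.map k (innerₗ V) a) b

end LinearAlgebra

section Distributions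

variable {n : ℕ} {M : Type*} [TopologicalSpace M] [ChartedSpace (EuclideanSpace ℝ (Fin n)) M]
  [IsManifold (𝓡 n) ∞ M]

instance tangentSpace_finiteDimensional (x : M) : FiniteDimensional ℝ (TangentSpace (𝓡 n) x) :=
  inferInstanceAs (FiniteDimensional ℝ (EuclideanSpace ℝ (Fin n)))

/-- `D` is a smooth distribution of rank `p`: a smooth subbundle of the tangent bundle, i.e.
locally spanned by `p` smooth pointwise linearly independent vector fields. -/
def IsSmoothDistribution (p : ℕ) (D : Π x : M, Submodule ℝ (TangentSpace (𝓡 n) x)) : Prop :=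
  ∀ x : M, ∃ U : Set M, IsOpen U ∧ x ∈ U ∧ ∃ X : Fin p → Π q : M, TangentSpace (𝓡 n) q,
    (∀ i, ContMDiffOn (𝓡 n) ((𝓡 n).prod 𝓘(ℝ, EuclideanSpace ℝ (Fin n))) ∞
      (fun q ↦ (⟨q, X i q⟩ : TangentBundle (𝓡 n) M)) U) ∧
    ∀ q ∈ U, LinearIndependent ℝ (fun i ↦ X i q) ∧
      Submodule.span ℝ (Set.range fun i ↦ X i q) = D q

variable [RiemannianBundle (fun x : M ↦ TangentSpace (𝓡 n) x)]

/-- The curvature operator `R(u, v)w = ∇_U ∇_V W - ∇_V ∇_U W - ∇_[U, V] W` at `x`, where `U, V, W`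
are the extensions of `u, v, w` with constant components in the chart at `x`. -/
def curvature (x : M) (u v w : TangentSpace (𝓡 n) x) : TangentSpace (𝓡 n) x :=
  let U := FiberBundle.extend (E := TangentSpace (𝓡 n)) (EuclideanSpace ℝ (Fin n)) u
  let V := FiberBundle.extend (E := TangentSpace (𝓡 n)) (EuclideanSpace ℝ (Fin n)) v
  let W := FiberBundle.extend (E := TangentSpace (𝓡 n)) (EuclideanSpace ℝ (Fin n)) w
  leviCivita (fun q ↦ leviCivita W q (V q)) x u - leviCivita (fun q ↦ leviCivita W q (U q)) x v
    - leviCivita W x (VectorField.mlieBracket (𝓡 n) U V x)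

/-- An orthonormal basis of the subspace `D x` of the tangent space at `x`. -/
def onb (D : Π x : M, Submodule ℝ (TangentSpace (𝓡 n) x)) (x : M)
    (i : Fin (Module.finrank ℝ (D x))) : TangentSpace (𝓡 n) x :=
  (stdOrthonormalBasis ℝ (D x) i : TangentSpace (𝓡 n) x)

/-- The mixed scalar curvature `K₁₂ = ∑ g(R(eᵢ, e_α)e_α, eᵢ)` at `x`, where `(eᵢ)` and `(e_α)` are
orthonormal bases of `D₁ x` and of `D₂ x`. -/
def mixedScalarCurvature (D₁ D₂ : Π x : M, Submodule ℝ (TangentSpace (𝓡 n) x)) (x : M) : ℝ :=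
  ∑ i, ∑ α, inner ℝ (curvature x (onb D₁ x i) (onb D₂ x α) (onb D₂ x α)) (onb D₁ x i)

/-- A local section of the distribution `D` with value `v` at `x`, if `v ∈ D x`: the orthogonal
projection to `D` of the extension of `v` with constant components in the chart at `x`. -/
def sectionThrough (D : Π x : M, Submodule ℝ (TangentSpace (𝓡 n) x)) {x : M}
    (v : TangentSpace (𝓡 n) x) (q : M) : TangentSpace (𝓡 n) q :=
  (D q).starProjection (FiberBundle.extend (EuclideanSpace ℝ (Fin n)) v q)

/-- The co-nullity tensor `C(ξ, u)` of the distribution `D` with orthogonal complement `N` (for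
`ξ ∈ N x`, `u ∈ D x`): the component tangent to `D` of `∇_u ξ`, where `ξ` is extended to a local
section of `N`. -/
def conullity (D N : Π x : M, Submodule ℝ (TangentSpace (𝓡 n) x)) (x : M)
    (ξ u : TangentSpace (𝓡 n) x) : TangentSpace (𝓡 n) x :=
  (D x).starProjection (leviCivita (sectionThrough N ξ) x u)

/-- The matrix `g(C(ξ, eᵢ), eⱼ)` of the co-nullity operator `C(ξ, ·) : D x → D x` in an orthonormal
basis `(eᵢ)` of `D x`. -/
def conullityMatrix (D N : Π x : M, Submodule ℝ (TangentSpace (𝓡 n) x)) (x : M)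
    (ξ : TangentSpace (𝓡 n) x) :
    Matrix (Fin (Module.finrank ℝ (D x))) (Fin (Module.finrank ℝ (D x))) ℝ :=
  Matrix.of fun i j ↦ inner ℝ (conullity D N x ξ (onb D x i)) (onb D x j)

/-- The sum `∑_α σ₂(C^α)` at `x`, where `C^α = C(e_α, ·)` is the co-nullity operator of `D` and
`(e_α)` is an orthonormal basis of the orthogonal complement `N x` of `D x`. -/
def sumSigmaTwo (D N : Π x : M, Submodule ℝ (TangentSpace (𝓡 n) x)) (x : M) : ℝ :=
  ∑ α, sigmaTwo (conullityMatrix D N x (onb N x α))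

/-- A local orthonormal frame of the distribution `D` around `x` that extends the orthonormal basis
`onb D x`, obtained by the Gram-Schmidt process from local sections of `D`. -/
def orthonormalFrame (D : Π x : M, Submodule ℝ (TangentSpace (𝓡 n) x)) (x : M)
    (i : Fin (Module.finrank ℝ (D x))) (q : M) : TangentSpace (𝓡 n) q :=
  InnerProductSpace.gramSchmidtNormed ℝ (fun j ↦ sectionThrough D (onb D x j) q) i

/-- The covariant derivative at `x` of the field of `k`-vectors `s₁ ∧ ⋯ ∧ sₖ`:
`∇_u (s₁ ∧ ⋯ ∧ sₖ) = ∑ᵢ s₁ ∧ ⋯ ∧ ∇_u sᵢ ∧ ⋯ ∧ sₖ`. -/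
def nablaWedge {k : ℕ} (s : Fin k → Π q : M, TangentSpace (𝓡 n) q) (x : M)
    (u : TangentSpace (𝓡 n) x) : ⋀[ℝ]^k (TangentSpace (𝓡 n) x) :=
  ∑ i, exteriorPower.ιMulti ℝ k (Function.update (fun j ↦ s j x) i (leviCivita (s i) x u))

/-- The squared norm `|∇ D̃|² = ∑ₐ |∇_{e_a} D̃|²` at `x`, where `D̃ = e₁ ∧ ⋯ ∧ eₚ` for a local
orthonormal frame `(eᵢ)` of `D`, and `(e_a)` is an orthonormal basis of the tangent space. -/
def bendingDensity (D : Π x : M, Submodule ℝ (TangentSpace (𝓡 n) x)) (x : M) : ℝ :=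
  ∑ a, wedgeInner
    (nablaWedge (orthonormalFrame D x) x (stdOrthonormalBasis ℝ (TangentSpace (𝓡 n) x) a))
    (nablaWedge (orthonormalFrame D x) x (stdOrthonormalBasis ℝ (TangentSpace (𝓡 n) x) a))

end Distributions

section Volume

variable (n : ℕ) (M : Type*) [TopologicalSpace M] [ChartedSpace (EuclideanSpace ℝ (Fin n)) M]
  [IsManifold (𝓡 n) ∞ M] [RiemannianBundle (fun x : M ↦ TangentSpace (𝓡 n) x)]
  [MeasurableSpace M] [BorelSpace M]

variable {M} in
/-- The Riemannian volume of the domain of the chart at `c` (extended by zero): the image under the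
inverse of the chart of the measure with density `√(det gᵢⱼ)` with respect to Lebesgue measure. -/
def chartVolume (c : M) : Measure M :=
  Measure.map (chartAt (EuclideanSpace ℝ (Fin n)) c).symm
    ((volume.restrict (chartAt (EuclideanSpace ℝ (Fin n)) c).target).withDensity fun y ↦
      ENNReal.ofReal √(gramMatrix (n := n) c ((chartAt (EuclideanSpace ℝ (Fin n)) c).symm y)).det)

/-- The Riemannian volume measure of `M`. Its restriction to the domain of each chart is the measure
`chartVolume` of that chart; as these measures agree on overlaps, it is their supremum. -/
def riemannianVolume : Measure M :=
  ⨆ c : M, chartVolume n c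

variable {n M}

/-- The total bending `c ∫_M |∇ D̃|² dvol` of the distribution `D`, with normalizing constant `c`. -/
def totalBending (c : ℝ) (D : Π x : M, Submodule ℝ (TangentSpace (𝓡 n) x)) : ℝ :=
  c * ∫ x, bendingDensity D x ∂(riemannianVolume n M)

/-- The total mixed scalar curvature `I_K = ∫_M K₁₂ dvol`. -/
def totalMixedScalarCurvature (D₁ D₂ : Π x : M, Submodule ℝ (TangentSpace (𝓡 n) x)) : ℝ :=
  ∫ x, mixedScalarCurvature D₁ D₂ x ∂(riemannianVolume n M)

end Volume

end

/-! The inequality is pointwise. For an orthonormal frame of `D₁`, the tangential parts of the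
derivatives contribute nothing to `∇(e₁ ∧ ⋯ ∧ eₚ)`, and the wedges obtained by replacing one `eᵢ` by
a normal vector are mutually orthogonal. Hence `|∇D̃₁|² = ∑ |(∇_{e_a} eᵢ)^{D₂}|²`. Splitting `e_a`
into a frame of `D₁` and one of `D₂`, and differentiating `g(eᵢ, e_α) = 0`, turns this into the sum
of the squared entries of all the matrices of `C₁^α` and `C₂^i` (`bendingDensity_eq_sum_sq`). For a
`p × p` matrix, `2σ₂(C) = (tr C)² - tr C² ≤ (p - 1)|C|²` (`two_div_mul_sigmaTwo_le`), and
integration gives the bound.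

The equality for `p₁ = p₂` is Walczak's integral formula: the sum of the mean curvature vectors of
`D₁` and `D₂` has divergence `K₁₂ - 2 ∑ σ₂(C₁^α) - 2 ∑ σ₂(C₂^i)` (`fieldDiv_mixedField`), whose
integral vanishes (`integral_fieldDiv`).

Local computations use the field `P` of orthogonal projections to `D₁`. Its covariant derivatives
`A_k = ∇_k P` are self-adjoint, and `P² = P` gives `A = AP + PA`, so `A` interchanges `D₁` and `D₂`
and encodes both co-nullity tensors. The pointwise orthonormal bases need not vary continuously, but
they enter through `∑ eᵢ ⊗ eᵢ`, whose matrix `P g⁻¹` is smooth. The divergence formula becomes the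
matrix identity `divergence_mixedMat`, which rests on the Ricci identity for `P` and the
skew-symmetry of the curvature operators.

Since the connection is defined at each point in the chart centred there, its formula must first be
proved in every chart (`toChart_leviCivita`). Similarly the volume is a supremum of chart measures,
which must be shown to agree on overlaps (`riemannianVolume_restrict`). Integrability is continuity
on a compact space of finite volume. -/

/-! ### Entrywise calculus of matrix-valued functions. -/

section MatrixCalculus

open Matrix

variable {n a b d : ℕ}

/-- A matrix-valued function all of whose entries are smooth at `y`. -/
def MatSmoothAt (F : EuclideanSpace ℝ (Fin n) → Matrix (Fin a) (Fin b) ℝ)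
    (y : EuclideanSpace ℝ (Fin n)) : Prop :=
  ∀ i j, ContDiffAt ℝ ∞ (fun z ↦ F z i j) y

/-- The entrywise partial derivative of a matrix-valued function. -/
noncomputable def matDeriv (k : Fin n) (F : EuclideanSpace ℝ (Fin n) → Matrix (Fin a) (Fin b) ℝ)
    (y : EuclideanSpace ℝ (Fin n)) : Matrix (Fin a) (Fin b) ℝ :=
  Matrix.of fun i j ↦ fderiv ℝ (fun z ↦ F z i j) y (EuclideanSpace.single k 1)

namespace MatSmoothAt

variable {F F' : EuclideanSpace ℝ (Fin n) → Matrix (Fin a) (Fin b) ℝ}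
  {H : EuclideanSpace ℝ (Fin n) → Matrix (Fin b) (Fin d) ℝ} {y : EuclideanSpace ℝ (Fin n)}

lemma diff (hF : MatSmoothAt F y) (i : Fin a) (j : Fin b) :
    DifferentiableAt ℝ (fun z ↦ F z i j) y :=
  (hF i j).differentiableAt (by simp)

lemma const (C : Matrix (Fin a) (Fin b) ℝ) : MatSmoothAt (fun _ ↦ C) y :=
  fun _ _ ↦ contDiffAt_const

lemma congr (hF : MatSmoothAt F y) (h : F' =ᶠ[nhds y] F) : MatSmoothAt F' y :=
  fun i j ↦ (hF i j).congr_of_eventuallyEq (h.mono fun z hz ↦ by simp [hz])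

lemma mul (hF : MatSmoothAt F y) (hH : MatSmoothAt H y) : MatSmoothAt (fun z ↦ F z * H z) y := by
  intro i j
  simp only [Matrix.mul_apply]
  exact ContDiffAt.sum fun l _ ↦ (hF i l).mul (hH l j)

lemma add (hF : MatSmoothAt F y) (hF' : MatSmoothAt F' y) : MatSmoothAt (fun z ↦ F z + F' z) y :=
  fun i j ↦ (hF i j).add (hF' i j)

lemma sub (hF : MatSmoothAt F y) (hF' : MatSmoothAt F' y) : MatSmoothAt (fun z ↦ F z - F' z) y :=
  fun i j ↦ (hF i j).sub (hF' i j)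

lemma neg (hF : MatSmoothAt F y) : MatSmoothAt (fun z ↦ -F z) y :=
  fun i j ↦ (hF i j).neg

lemma transpose (hF : MatSmoothAt F y) : MatSmoothAt (fun z ↦ (F z)ᵀ) y :=
  fun i j ↦ hF j i

lemma smul {f : EuclideanSpace ℝ (Fin n) → ℝ} (hf : ContDiffAt ℝ ∞ f y) (hF : MatSmoothAt F y) :
    MatSmoothAt (fun z ↦ f z • F z) y :=
  fun i j ↦ hf.mul (hF i j)

lemma deriv (hF : MatSmoothAt F y) (k : Fin n) : MatSmoothAt (matDeriv k F) y :=
  fun i j ↦ ((hF i j).fderiv_right (m := ∞) (by simp)).clm_apply contDiffAt_const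

lemma det {F : EuclideanSpace ℝ (Fin n) → Matrix (Fin a) (Fin a) ℝ} (hF : MatSmoothAt F y) :
    ContDiffAt ℝ ∞ (fun z ↦ (F z).det) y := by
  simp only [Matrix.det_apply]
  refine ContDiffAt.sum fun σ _ ↦ ?_
  exact ContDiffAt.const_smul _ (contDiffAt_prod fun i _ ↦ hF _ _)

/-- Cramer's rule: the adjugate is polynomial in the entries, and the determinant does not vanish at
`y`. -/
lemma inv {F : EuclideanSpace ℝ (Fin n) → Matrix (Fin a) (Fin a) ℝ} (hF : MatSmoothAt F y)
    (hdet : (F y).det ≠ 0) : MatSmoothAt (fun z ↦ (F z)⁻¹) y := by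
  have hadj : MatSmoothAt (fun z ↦ (F z).adjugate) y := by
    intro i j
    simp only [Matrix.adjugate_apply]
    refine MatSmoothAt.det fun i' j' ↦ ?_
    by_cases h : i' = j
    · subst h; simpa using contDiffAt_const
    · simpa [Matrix.updateRow_apply, h] using hF i' j'
  simp only [Matrix.inv_def, Ring.inverse_eq_inv']
  exact MatSmoothAt.smul (hF.det.inv hdet) hadj

end MatSmoothAt

section Deriv

variable {F F' : EuclideanSpace ℝ (Fin n) → Matrix (Fin a) (Fin b) ℝ}
  {H : EuclideanSpace ℝ (Fin n) → Matrix (Fin b) (Fin d) ℝ} {y : EuclideanSpace ℝ (Fin n)}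
  (k : Fin n)

lemma matDeriv_congr (h : F' =ᶠ[nhds y] F) : matDeriv k F' y = matDeriv k F y := by
  ext i j
  simp only [matDeriv, Matrix.of_apply]
  rw [Filter.EventuallyEq.fderiv_eq (f := fun z ↦ F z i j) (h.mono fun z hz ↦ by simp [hz])]

lemma matDeriv_const (C : Matrix (Fin a) (Fin b) ℝ) : matDeriv k (fun _ ↦ C) y = 0 := by
  ext i j; simp [matDeriv]

lemma matDeriv_add (hF : MatSmoothAt F y) (hF' : MatSmoothAt F' y) :
    matDeriv k (fun z ↦ F z + F' z) y = matDeriv k F y + matDeriv k F' y := by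
  ext i j
  simp [matDeriv, fderiv_fun_add (hF.diff i j) (hF'.diff i j)]

lemma matDeriv_sub (hF : MatSmoothAt F y) (hF' : MatSmoothAt F' y) :
    matDeriv k (fun z ↦ F z - F' z) y = matDeriv k F y - matDeriv k F' y := by
  ext i j
  simp [matDeriv, fderiv_fun_sub (hF.diff i j) (hF'.diff i j)]

lemma matDeriv_neg : matDeriv k (fun z ↦ -F z) y = -matDeriv k F y := by
  ext i j
  simp [matDeriv]

lemma matDeriv_transpose : matDeriv k (fun z ↦ (F z)ᵀ) y = (matDeriv k F y)ᵀ := rfl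

lemma matDeriv_mul (hF : MatSmoothAt F y) (hH : MatSmoothAt H y) :
    matDeriv k (fun z ↦ F z * H z) y = matDeriv k F y * H y + F y * matDeriv k H y := by
  ext i j
  simp only [matDeriv, Matrix.mul_apply, Matrix.of_apply, Matrix.add_apply]
  rw [fderiv_fun_sum (A := fun l z ↦ F z i l * H z l j)
    fun l _ ↦ (hF.diff i l).fun_mul (hH.diff l j)]
  simp only [_root_.sum_apply, ← Finset.sum_add_distrib]
  refine Finset.sum_congr rfl fun l _ ↦ ?_
  rw [fderiv_fun_mul (hF.diff i l) (hH.diff l j)]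
  simp [mul_comm, add_comm]

lemma matDeriv_comm (hF : MatSmoothAt F y) (k l : Fin n) :
    matDeriv k (matDeriv l F) y = matDeriv l (matDeriv k F) y := by
  ext i j
  have h2 : DifferentiableAt ℝ (fderiv ℝ fun z ↦ F z i j) y :=
    ((hF i j).fderiv_right (m := ∞) (by simp)).differentiableAt (by simp)
  simp only [matDeriv, Matrix.of_apply]
  rw [fderiv_clm_apply h2 (by fun_prop), fderiv_clm_apply h2 (by fun_prop)]
  simpa using ((hF i j).isSymmSndFDerivAt
    (by simpa using ENat.LEInfty.out)).eq _ _

end Deriv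

section SigmaSum

/-- The contraction `∑ₖₘ (Fₖₘ)ₖₘ` of a family of square matrices. -/
def diagSum (F : Fin n → Fin n → Matrix (Fin n) (Fin n) ℝ) : ℝ := ∑ k, ∑ m, F k m k m

/-- Renaming the summation indices is a transposition. Self-adjointness therefore lets factors be
reversed under the contraction at the price of exchanging `k` and `m`. -/
lemma diagSum_swap (F : Fin n → Fin n → Matrix (Fin n) (Fin n) ℝ) :
    diagSum F = diagSum fun k m ↦ (F m k)ᵀ := by
  rw [diagSum, Finset.sum_comm]; rfl

lemma diagSum_add (F F' : Fin n → Fin n → Matrix (Fin n) (Fin n) ℝ) :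
    (diagSum fun k m ↦ F k m + F' k m) = diagSum F + diagSum F' := by
  simp [diagSum, Finset.sum_add_distrib]

lemma diagSum_sub (F F' : Fin n → Fin n → Matrix (Fin n) (Fin n) ℝ) :
    (diagSum fun k m ↦ F k m - F' k m) = diagSum F - diagSum F' := by
  simp [diagSum, Finset.sum_sub_distrib]

lemma diagSum_smul (c : ℝ) (F : Fin n → Fin n → Matrix (Fin n) (Fin n) ℝ) :
    (diagSum fun k m ↦ c • F k m) = c * diagSum F := by
  simp [diagSum, Finset.mul_sum]

end SigmaSum

end MatrixCalculus

/-! ### Levi-Civita connection and curvature of a metric on an open subset of `ℝⁿ`. -/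

section Walczak

open Matrix

variable {n : ℕ}

/-- The matrices `(Γₖ)ˡⱼ = Γˡₖⱼ` of the Christoffel symbols of a metric on an open subset of `ℝⁿ`. -/
noncomputable def chrisMat (G : EuclideanSpace ℝ (Fin n) → Matrix (Fin n) (Fin n) ℝ) (k : Fin n)
    (y : EuclideanSpace ℝ (Fin n)) : Matrix (Fin n) (Fin n) ℝ :=
  Matrix.of fun l j ↦ (1 / 2 : ℝ) * ∑ r, (G y)⁻¹ l r *
    (matDeriv k G y j r + matDeriv j G y k r - matDeriv r G y k j)

/-- The covariant derivative of a field of endomorphisms. -/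
noncomputable def covMat (G : EuclideanSpace ℝ (Fin n) → Matrix (Fin n) (Fin n) ℝ) (k : Fin n)
    (F : EuclideanSpace ℝ (Fin n) → Matrix (Fin n) (Fin n) ℝ) (y : EuclideanSpace ℝ (Fin n)) :
    Matrix (Fin n) (Fin n) ℝ :=
  matDeriv k F y + chrisMat G k y * F y - F y * chrisMat G k y

/-- The curvature operators `R(∂ₖ, ∂ₘ)` of a metric on an open subset of `ℝⁿ`. -/
noncomputable def curvMat (G : EuclideanSpace ℝ (Fin n) → Matrix (Fin n) (Fin n) ℝ) (k m : Fin n)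
    (y : EuclideanSpace ℝ (Fin n)) : Matrix (Fin n) (Fin n) ℝ :=
  matDeriv k (chrisMat G m) y - matDeriv m (chrisMat G k) y
    + (chrisMat G k y * chrisMat G m y - chrisMat G m y * chrisMat G k y)

/-- A smooth Riemannian metric on an open subset of `ℝⁿ`, given by its Gram matrix. -/
structure IsMetricOn (G : EuclideanSpace ℝ (Fin n) → Matrix (Fin n) (Fin n) ℝ)
    (U : Set (EuclideanSpace ℝ (Fin n))) : Prop where
  isOpen : IsOpen U
  smooth : ∀ y ∈ U, MatSmoothAt G y
  symm : ∀ y ∈ U, (G y)ᵀ = G y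
  posDet : ∀ y ∈ U, 0 < (G y).det

namespace IsMetricOn

variable {G : EuclideanSpace ℝ (Fin n) → Matrix (Fin n) (Fin n) ℝ}
  {U : Set (EuclideanSpace ℝ (Fin n))} {y : EuclideanSpace ℝ (Fin n)}

lemma isUnit_det (hG : IsMetricOn G U) (hy : y ∈ U) : IsUnit (G y).det :=
  (hG.posDet y hy).ne'.isUnit

lemma eventuallyEq (hG : IsMetricOn G U) (hy : y ∈ U) {α : Type*}
    {f f' : EuclideanSpace ℝ (Fin n) → α} (h : ∀ z ∈ U, f z = f' z) : f =ᶠ[nhds y] f' :=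
  Filter.eventuallyEq_of_mem (hG.isOpen.mem_nhds hy) h

lemma smooth_inv (hG : IsMetricOn G U) (hy : y ∈ U) : MatSmoothAt (fun z ↦ (G z)⁻¹) y :=
  (hG.smooth y hy).inv (hG.posDet y hy).ne'

lemma inv_symm (hG : IsMetricOn G U) (hy : y ∈ U) : ((G y)⁻¹)ᵀ = (G y)⁻¹ := by
  rw [Matrix.transpose_nonsing_inv, hG.symm y hy]

lemma smooth_chrisMat (hG : IsMetricOn G U) (hy : y ∈ U) (k : Fin n) :
    MatSmoothAt (chrisMat G k) y := by
  intro l j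
  simp only [chrisMat, Matrix.of_apply]
  refine contDiffAt_const.mul (ContDiffAt.sum fun r _ ↦ (hG.smooth_inv hy l r).mul ?_)
  have h := fun k ↦ (hG.smooth y hy).deriv k
  exact ((h k j r).add (h j k r)).sub (h r k j)

lemma matDeriv_symm (hG : IsMetricOn G U) (hy : y ∈ U) (k : Fin n) :
    (matDeriv k G y)ᵀ = matDeriv k G y :=
  (matDeriv_transpose (F := G) k).symm.trans
    (matDeriv_congr k (hG.eventuallyEq hy hG.symm))

lemma matDeriv_apply_comm (hG : IsMetricOn G U) (hy : y ∈ U) (k i j : Fin n) :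
    matDeriv k G y i j = matDeriv k G y j i :=
  congr_fun₂ (hG.matDeriv_symm hy k) j i

/-- Vanishing of the torsion. -/
lemma chrisMat_comm (hG : IsMetricOn G U) (hy : y ∈ U) (k l m : Fin n) :
    chrisMat G k y l m = chrisMat G m y l k := by
  simp only [chrisMat, Matrix.of_apply]
  congr 1
  refine Finset.sum_congr rfl fun r _ ↦ ?_
  rw [hG.matDeriv_apply_comm hy r k m]; ring

lemma mul_chrisMat_apply (hG : IsMetricOn G U) (hy : y ∈ U) (k i j : Fin n) :
    (G y * chrisMat G k y) i j =
      1 / 2 * (matDeriv k G y j i + matDeriv j G y k i - matDeriv i G y k j) := by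
  have h : chrisMat G k y = (G y)⁻¹ * Matrix.of fun r j ↦ (1 / 2 : ℝ) *
      (matDeriv k G y j r + matDeriv j G y k r - matDeriv r G y k j) := by
    ext l j
    simp only [chrisMat, Matrix.of_apply, Matrix.mul_apply, Finset.mul_sum]
    exact Finset.sum_congr rfl fun r _ ↦ by ring
  rw [h, Matrix.mul_nonsing_inv_cancel_left _ _ (hG.isUnit_det hy)]
  rfl

/-- The metric is parallel: in the sum of the two lowered Christoffel symbols all terms cancel
except `∂ₖ G`. -/
lemma matDeriv_metric (hG : IsMetricOn G U) (hy : y ∈ U) (k : Fin n) :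
    matDeriv k G y = (chrisMat G k y)ᵀ * G y + G y * chrisMat G k y := by
  have h : (chrisMat G k y)ᵀ * G y = (G y * chrisMat G k y)ᵀ := by
    rw [Matrix.transpose_mul, hG.symm y hy]
  ext i j
  rw [h, Matrix.add_apply, Matrix.transpose_apply, hG.mul_chrisMat_apply hy,
    hG.mul_chrisMat_apply hy, hG.matDeriv_apply_comm hy k j i]
  ring

/-- Obtained by differentiating `G G⁻¹ = 1` and inserting the formula for `∂ₖ G`. -/
lemma matDeriv_inv (hG : IsMetricOn G U) (hy : y ∈ U) (k : Fin n) :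
    matDeriv k (fun z ↦ (G z)⁻¹) y
      = -(chrisMat G k y * (G y)⁻¹) - (G y)⁻¹ * (chrisMat G k y)ᵀ := by
  have h0 : matDeriv k (fun z ↦ G z * (G z)⁻¹) y = 0 := by
    rw [← matDeriv_const k (1 : Matrix (Fin n) (Fin n) ℝ)]
    exact matDeriv_congr k (hG.eventuallyEq hy fun z hz ↦
      Matrix.mul_nonsing_inv _ (hG.isUnit_det hz))
  rw [matDeriv_mul k (hG.smooth y hy) (hG.smooth_inv hy), hG.matDeriv_metric hy] at h0
  have h1 := congr_arg ((G y)⁻¹ * ·) h0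
  simp only [Matrix.mul_zero, Matrix.mul_add] at h1
  rw [Matrix.nonsing_inv_mul_cancel_left _ _ (hG.isUnit_det hy), Matrix.add_mul, Matrix.mul_assoc _ (G y),
    Matrix.mul_nonsing_inv _ (hG.isUnit_det hy), Matrix.mul_one, Matrix.mul_assoc (G y), Matrix.mul_add,
    Matrix.nonsing_inv_mul_cancel_left _ _ (hG.isUnit_det hy)] at h1
  linear_combination (norm := noncomm_ring) h1

lemma smooth_covMat (hG : IsMetricOn G U) (hy : y ∈ U) (k : Fin n)
    {F : EuclideanSpace ℝ (Fin n) → Matrix (Fin n) (Fin n) ℝ} (hF : MatSmoothAt F y) :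
    MatSmoothAt (covMat G k F) y :=
  ((hF.deriv k).add ((hG.smooth_chrisMat hy k).mul hF)).sub (hF.mul (hG.smooth_chrisMat hy k))

lemma covMat_congr (hG : IsMetricOn G U) (hy : y ∈ U) (k : Fin n)
    {F F' : EuclideanSpace ℝ (Fin n) → Matrix (Fin n) (Fin n) ℝ} (h : ∀ z ∈ U, F z = F' z) :
    covMat G k F y = covMat G k F' y := by
  rw [covMat, covMat, matDeriv_congr k (hG.eventuallyEq hy h), h y hy]

/-- Both `∂ₖ` and the commutator with `Γₖ` are derivations of the matrix algebra. -/
lemma covMat_mul (G : EuclideanSpace ℝ (Fin n) → Matrix (Fin n) (Fin n) ℝ) (k : Fin n)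
    {F H : EuclideanSpace ℝ (Fin n) → Matrix (Fin n) (Fin n) ℝ} (hF : MatSmoothAt F y)
    (hH : MatSmoothAt H y) :
    covMat G k (fun z ↦ F z * H z) y = covMat G k F y * H y + F y * covMat G k H y := by
  simp only [covMat, matDeriv_mul k hF hH]
  noncomm_ring

lemma covMat_add (G : EuclideanSpace ℝ (Fin n) → Matrix (Fin n) (Fin n) ℝ) (k : Fin n)
    {F H : EuclideanSpace ℝ (Fin n) → Matrix (Fin n) (Fin n) ℝ} (hF : MatSmoothAt F y)
    (hH : MatSmoothAt H y) :
    covMat G k (fun z ↦ F z + H z) y = covMat G k F y + covMat G k H y := by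
  simp only [covMat, matDeriv_add k hF hH]
  noncomm_ring

/-- Self-adjointness for `G` is the symmetry of `F G⁻¹`; it survives covariant differentiation
because the metric is parallel. -/
lemma covMat_adjoint (hG : IsMetricOn G U) (hy : y ∈ U) (k : Fin n)
    {F : EuclideanSpace ℝ (Fin n) → Matrix (Fin n) (Fin n) ℝ} (hF : MatSmoothAt F y)
    (h : ∀ z ∈ U, (G z)⁻¹ * (F z)ᵀ = F z * (G z)⁻¹) :
    (G y)⁻¹ * (covMat G k F y)ᵀ = covMat G k F y * (G y)⁻¹ := by
  have h1 := matDeriv_congr k (hG.eventuallyEq hy h)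
  rw [matDeriv_mul k (hG.smooth_inv hy) hF.transpose, matDeriv_mul k hF (hG.smooth_inv hy),
    hG.matDeriv_inv hy, matDeriv_transpose] at h1
  have h2 := h y hy
  simp only [covMat, Matrix.transpose_add, Matrix.transpose_sub, Matrix.transpose_mul]
  linear_combination (norm := noncomm_ring) h1 + chrisMat G k y * h2 + h2 * (chrisMat G k y)ᵀ

/-- The Ricci identity. The iterated `covMat` omits the Christoffel correction for the index `m`,
but that correction is symmetric in `k` and `m` and would cancel here. -/
lemma covMat_comm (hG : IsMetricOn G U) (hy : y ∈ U) (k m : Fin n)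
    {F : EuclideanSpace ℝ (Fin n) → Matrix (Fin n) (Fin n) ℝ} (hF : MatSmoothAt F y) :
    covMat G k (covMat G m F) y - covMat G m (covMat G k F) y
      = curvMat G k m y * F y - F y * curvMat G k m y := by
  have key : ∀ k m, covMat G k (covMat G m F) y = matDeriv k (matDeriv m F) y
      + (matDeriv k (chrisMat G m) y * F y + chrisMat G m y * matDeriv k F y)
      - (matDeriv k F y * chrisMat G m y + F y * matDeriv k (chrisMat G m) y)
      + chrisMat G k y * covMat G m F y - covMat G m F y * chrisMat G k y := by
    intro k m
    have h1 := hG.smooth_chrisMat hy m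
    rw [covMat, show covMat G m F = fun z ↦ matDeriv m F z + chrisMat G m z * F z -
      F z * chrisMat G m z from rfl, matDeriv_sub k ((hF.deriv m).add (h1.mul hF)) (hF.mul h1),
      matDeriv_add k (hF.deriv m) (h1.mul hF), matDeriv_mul k h1 hF, matDeriv_mul k hF h1]
  rw [key, key, matDeriv_comm hF k m, covMat, covMat, curvMat]
  noncomm_ring

/-- Skew-adjointness of the curvature operators is the equality of the mixed second derivatives of
`G⁻¹`, each computed from `matDeriv_inv`. -/
lemma curvMat_adjoint (hG : IsMetricOn G U) (hy : y ∈ U) (k m : Fin n) :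
    (G y)⁻¹ * (curvMat G k m y)ᵀ = -(curvMat G k m y * (G y)⁻¹) := by
  have key : ∀ k m, matDeriv k (matDeriv m fun z ↦ (G z)⁻¹) y =
      -(matDeriv k (chrisMat G m) y * (G y)⁻¹ + chrisMat G m y * matDeriv k (fun z ↦ (G z)⁻¹) y)
      - (matDeriv k (fun z ↦ (G z)⁻¹) y * (chrisMat G m y)ᵀ
        + (G y)⁻¹ * (matDeriv k (chrisMat G m) y)ᵀ) := by
    intro k m
    have h1 := hG.smooth_chrisMat hy m
    have h2 := hG.smooth_inv hy
    rw [matDeriv_congr k (hG.eventuallyEq hy fun z hz ↦ hG.matDeriv_inv hz m),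
      matDeriv_sub k (h1.mul h2).neg (h2.mul h1.transpose), matDeriv_neg, matDeriv_mul k h1 h2,
      matDeriv_mul k h2 h1.transpose, matDeriv_transpose]
  have h := matDeriv_comm (hG.smooth_inv hy) k m
  rw [key, key, hG.matDeriv_inv hy, hG.matDeriv_inv hy] at h
  simp only [curvMat, Matrix.transpose_add, Matrix.transpose_sub, Matrix.transpose_mul]
  linear_combination (norm := noncomm_ring) -h

end IsMetricOn

lemma curvMat_antisymm (G : EuclideanSpace ℝ (Fin n) → Matrix (Fin n) (Fin n) ℝ) (k m : Fin n)
    (y : EuclideanSpace ℝ (Fin n)) : curvMat G m k y = -curvMat G k m y := by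
  simp only [curvMat]; noncomm_ring

end Walczak

/-! ### The divergence identity for a field of orthogonal projections. -/

section WalczakFormula

open Matrix

variable {n : ℕ}

/-- A smooth field of orthogonal projections on an open subset of `ℝⁿ` with a Riemannian metric. -/
structure IsProjOn (G P : EuclideanSpace ℝ (Fin n) → Matrix (Fin n) (Fin n) ℝ)
    (U : Set (EuclideanSpace ℝ (Fin n))) : Prop where
  smooth : ∀ y ∈ U, MatSmoothAt P y
  idem : ∀ y ∈ U, P y * P y = P y
  adj : ∀ y ∈ U, G y * P y = (P y)ᵀ * G y

/-- The columns of these matrices sum up to the vector field whose divergence is computed by the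
integral formula for a distribution with field of projections `P`. -/
noncomputable def mixedMat (G P : EuclideanSpace ℝ (Fin n) → Matrix (Fin n) (Fin n) ℝ) (m : Fin n)
    (y : EuclideanSpace ℝ (Fin n)) : Matrix (Fin n) (Fin n) ℝ :=
  (1 - (P y + P y)) * covMat G m P y * (G y)⁻¹

namespace IsProjOn

variable {G P : EuclideanSpace ℝ (Fin n) → Matrix (Fin n) (Fin n) ℝ}
  {U : Set (EuclideanSpace ℝ (Fin n))} {y : EuclideanSpace ℝ (Fin n)}

lemma inv_adj (hG : IsMetricOn G U) (hP : IsProjOn G P U) (hy : y ∈ U) :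
    (G y)⁻¹ * (P y)ᵀ = P y * (G y)⁻¹ := by
  have h := congr_arg (fun X ↦ (G y)⁻¹ * X * (G y)⁻¹) (hP.adj y hy)
  simp only [← Matrix.mul_assoc, Matrix.nonsing_inv_mul _ (hG.isUnit_det hy), Matrix.one_mul] at h
  rw [h, Matrix.mul_nonsing_inv_cancel_right _ _ (hG.isUnit_det hy)]

lemma covMat_adj (hG : IsMetricOn G U) (hP : IsProjOn G P U) (hy : y ∈ U) (k : Fin n) :
    (G y)⁻¹ * (covMat G k P y)ᵀ = covMat G k P y * (G y)⁻¹ :=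
  hG.covMat_adjoint hy k (hP.smooth y hy) fun _ hz ↦ hP.inv_adj hG hz

/-- The Leibniz rule applied to `P² = P`. It makes the blocks `PAP` and `(1 - P)A(1 - P)` vanish. -/
lemma covMat_idem (hG : IsMetricOn G U) (hP : IsProjOn G P U) (hy : y ∈ U) (k : Fin n) :
    covMat G k P y = covMat G k P y * P y + P y * covMat G k P y := by
  rw [← IsMetricOn.covMat_mul G k (hP.smooth y hy) (hP.smooth y hy)]
  exact hG.covMat_congr hy k fun z hz ↦ (hP.idem z hz).symm

lemma covMat_covMat_idem (hG : IsMetricOn G U) (hP : IsProjOn G P U) (hy : y ∈ U) (k m : Fin n) :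
    covMat G k (covMat G m P) y = covMat G k (covMat G m P) y * P y
      + covMat G m P y * covMat G k P y
      + (covMat G k P y * covMat G m P y + P y * covMat G k (covMat G m P) y) := by
  have h1 := hP.smooth y hy
  have h2 := hG.smooth_covMat hy m h1
  rw [← IsMetricOn.covMat_mul G k h2 h1, ← IsMetricOn.covMat_mul G k h1 h2]
  refine (hG.covMat_congr hy k fun z hz ↦ hP.covMat_idem hG hz m).trans ?_
  exact IsMetricOn.covMat_add G k (h2.mul h1) (h1.mul h2)

lemma smooth_mixedMat (hG : IsMetricOn G U) (hP : IsProjOn G P U) (hy : y ∈ U) (m : Fin n) :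
    MatSmoothAt (mixedMat G P m) y :=
  (((MatSmoothAt.const 1).sub ((hP.smooth y hy).add (hP.smooth y hy))).mul
    (hG.smooth_covMat hy m (hP.smooth y hy))).mul (hG.smooth_inv hy)

/-- The Leibniz rule with `∇(1 - 2P) = -2A` and `∇G⁻¹ = 0`. Only the row index of the matrix is
differentiated covariantly on the left, so a term with `Γₖᵀ` acting on the column index is left
over. -/
lemma deriv_mixedMat (hG : IsMetricOn G U) (hP : IsProjOn G P U) (hy : y ∈ U) (k m : Fin n) :
    matDeriv k (mixedMat G P m) y + chrisMat G k y * mixedMat G P m y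
      = -((2 : ℝ) • (covMat G k P y * covMat G m P y * (G y)⁻¹))
        + (1 - (P y + P y)) * covMat G k (covMat G m P) y * (G y)⁻¹
        - mixedMat G P m y * (chrisMat G k y)ᵀ := by
  have h1 := hP.smooth y hy
  have h2 := hG.smooth_covMat hy m h1
  have hQ : MatSmoothAt (fun y ↦ 1 - (P y + P y)) y := (MatSmoothAt.const 1).sub (h1.add h1)
  have e1 : matDeriv k (mixedMat G P m) y = _ :=
    (matDeriv_mul k (hQ.mul h2) (hG.smooth_inv hy)).trans
      (congr_arg (· * (G y)⁻¹ + _) (matDeriv_mul k hQ h2))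
  rw [e1, hG.matDeriv_inv hy, matDeriv_sub k (.const 1) (h1.add h1), matDeriv_add k h1 h1,
    matDeriv_const, mixedMat]
  have e2 : covMat G k (covMat G m P) y = matDeriv k (covMat G m P) y
      + chrisMat G k y * covMat G m P y - covMat G m P y * chrisMat G k y := rfl
  have e3 : covMat G k P y = matDeriv k P y + chrisMat G k y * P y - P y * chrisMat G k y := rfl
  rw [e2, e3]
  simp only [two_smul]
  noncomm_ring

/-- Under the contraction, the leftover term on the column index becomes the correction on the lower
index that turns the iterated `covMat` into a second covariant derivative. -/
lemma diagSum_chrisMat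
    (A : Fin n → Matrix (Fin n) (Fin n) ℝ) :
    (diagSum fun k m ↦ A m * (chrisMat G k y)ᵀ)
      = diagSum fun k m ↦ ∑ l, chrisMat G k y l m • A l := by
  simp only [diagSum, Matrix.mul_apply, Matrix.transpose_apply, Matrix.sum_apply, Matrix.smul_apply,
    smul_eq_mul]
  refine Finset.sum_congr rfl fun k _ ↦ ?_
  rw [Finset.sum_comm]
  exact Finset.sum_congr rfl fun j _ ↦ Finset.sum_congr rfl fun m _ ↦ by ring

/-- The integral formula of Walczak in local coordinates, before integration. -/
theorem divergence_mixedMat (hG : IsMetricOn G U) (hP : IsProjOn G P U) (hy : y ∈ U) :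
    (diagSum fun k m ↦ matDeriv k (mixedMat G P m) y + chrisMat G k y * mixedMat G P m y)
      = (diagSum fun k m ↦ P y * curvMat G k m y * (1 - P y) * (G y)⁻¹)
        - (diagSum fun k m ↦ covMat G k P y * covMat G m P y * (G y)⁻¹)
        + diagSum fun k m ↦ covMat G m P y * covMat G k P y * (G y)⁻¹ := by
  set h := (G y)⁻¹ with hh
  set p := P y
  set A := fun k ↦ covMat G k P y with hA
  set R := fun k m ↦ curvMat G k m y
  -- `N k m` is the full second covariant derivative of `P`, including the correction for the lower
  -- index `m`.
  set N := fun k m ↦ covMat G k (covMat G m P) y - ∑ l, chrisMat G k y l m • A l with hN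
  have pp : p * p = p := hP.idem y hy
  have hsymm : hᵀ = h := hG.inv_symm hy
  have hp : h * pᵀ = p * h := hP.inv_adj hG hy
  have hAa : ∀ k, h * (A k)ᵀ = A k * h := hP.covMat_adj hG hy
  have hRa : ∀ k m, h * (R k m)ᵀ = -(R k m * h) := hG.curvMat_adjoint hy
  have hNa : ∀ k m, h * (N k m)ᵀ = N k m * h := by
    intro k m
    have h1 := hG.covMat_adjoint hy k (hG.smooth_covMat hy m (hP.smooth y hy))
      fun z hz ↦ hP.covMat_adj hG hz m
    simp only [hN, Matrix.transpose_sub, Matrix.mul_sub, Matrix.sub_mul, Matrix.transpose_sum,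
      Matrix.transpose_smul, Finset.mul_sum, Finset.sum_mul, Matrix.mul_smul, Matrix.smul_mul, hAa]
    rw [hh, h1]
  have hAp : ∀ k, A k = A k * p + p * A k := hP.covMat_idem hG hy
  -- The equation `P² = P` differentiated twice. The correction terms in `N` obey the same rule as
  -- `A` itself, hence can be subtracted.
  have hNp : ∀ k m, N k m = N k m * p + p * N k m + A m * A k + A k * A m := by
    intro k m
    have h1 := hP.covMat_covMat_idem hG hy k m
    have h2 : ∑ l, chrisMat G k y l m • A l
        = (∑ l, chrisMat G k y l m • A l) * p + p * ∑ l, chrisMat G k y l m • A l := by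
      simp only [Finset.mul_sum, Finset.sum_mul, Matrix.mul_smul, Matrix.smul_mul,
        ← Finset.sum_add_distrib, ← smul_add, ← hAp]
    simp only [hN, hA] at h2 ⊢
    linear_combination (norm := noncomm_ring) h1 - h2
  have hNc : ∀ k m, N k m - N m k = R k m * p - p * R k m := by
    intro k m
    have h1 := hG.covMat_comm hy k m (hP.smooth y hy)
    have h2 : ∑ l, chrisMat G k y l m • A l = ∑ l, chrisMat G m y l k • A l :=
      Finset.sum_congr rfl fun l _ ↦ by rw [hG.chrisMat_comm hy]
    simp only [hN, h2]
    rw [sub_sub_sub_cancel_right]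
    exact h1
  have hRs : ∀ k m, R m k = -R k m := fun k m ↦ curvMat_antisymm G k m y
  have hLHS : (diagSum fun k m ↦ matDeriv k (mixedMat G P m) y + chrisMat G k y * mixedMat G P m y)
      = -(2 * diagSum fun k m ↦ A k * A m * h)
        + diagSum fun k m ↦ (1 - (p + p)) * N k m * h := by
    simp only [hP.deriv_mixedMat hG hy]
    rw [diagSum_sub, diagSum_add, diagSum_chrisMat, ← neg_mul, ← diagSum_smul, add_sub_assoc,
      ← diagSum_sub]
    congr 2
    · ext k m : 2; rw [neg_smul]
    · ext k m : 2
      simp only [hN, mixedMat, Matrix.mul_sub, Matrix.sub_mul, Finset.mul_sum, Finset.sum_mul,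
        Matrix.mul_smul, Matrix.smul_mul]
      rfl
  -- Transposition under the contraction: if `Y k m` is the adjoint of `X m k`, the contractions of
  -- `X` and `Y` agree.
  have hT : ∀ X Y Z : Fin n → Fin n → Matrix (Fin n) (Fin n) ℝ,
      (∀ k m, h * (X m k)ᵀ = Y k m * h) → (∀ k m, (Y k m * h) = Z k m) →
      (diagSum fun k m ↦ X k m * h) = diagSum fun k m ↦ Z k m := by
    intro X Y Z h1 h2
    rw [diagSum_swap]
    congr 1; ext k m : 2
    rw [Matrix.transpose_mul, hsymm, h1, h2]
  have hQ : h * (1 - (p + p))ᵀ = (1 - (p + p)) * h := by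
    simp only [Matrix.transpose_sub, Matrix.transpose_add, Matrix.transpose_one, Matrix.mul_sub,
      Matrix.mul_add, hp, Matrix.sub_mul, Matrix.add_mul, Matrix.mul_one, Matrix.one_mul]
  have hS1 : (diagSum fun k m ↦ (N k m * (1 - (p + p))) * h)
      = diagSum fun k m ↦ (1 - (p + p)) * N m k * h := by
    refine hT _ (fun k m ↦ (1 - (p + p)) * N m k) _ (fun k m ↦ ?_) fun _ _ ↦ rfl
    rw [Matrix.transpose_mul, ← Matrix.mul_assoc, hQ, Matrix.mul_assoc, hNa, Matrix.mul_assoc]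
  -- The two curvature blocks have equal contractions: the sign from skew-adjointness cancels the
  -- one from `R m k = -R k m`.
  have hS2 : (diagSum fun k m ↦ ((1 - p) * R k m * p) * h)
      = diagSum fun k m ↦ p * R k m * (1 - p) * h := by
    refine hT _ (fun k m ↦ p * R k m * (1 - p)) _ (fun k m ↦ ?_) fun _ _ ↦ rfl
    simp only [Matrix.transpose_mul, Matrix.transpose_sub, Matrix.transpose_one]
    rw [← Matrix.mul_assoc, hp, Matrix.mul_assoc, ← Matrix.mul_assoc h, hRa, hRs k m, Matrix.mul_sub]
    linear_combination (norm := noncomm_ring) - p * R k m * hp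
  -- Here `hNp` is read as the anticommutator of `N k m` with `1 - 2p`.
  have e1 : (diagSum fun k m ↦ (1 - (p + p)) * N k m * h)
      = 2 * (diagSum fun k m ↦ A k * A m * h) + 2 * (diagSum fun k m ↦ A m * A k * h)
        - diagSum fun k m ↦ (N k m * (1 - (p + p))) * h := by
    rw [← diagSum_smul, ← diagSum_smul, ← diagSum_add, ← diagSum_sub]
    congr 1; ext k m : 2
    simp only [two_smul]
    linear_combination (norm := noncomm_ring) 2 * hNp k m * h
  -- The Ricci identity, together with `(1 - 2p)(Rp - pR) = (1 - p)Rp + pR(1 - p)`.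
  have e2 : (diagSum fun k m ↦ (1 - (p + p)) * N m k * h)
      = (diagSum fun k m ↦ (1 - (p + p)) * N k m * h)
        - ((diagSum fun k m ↦ ((1 - p) * R k m * p) * h)
          + diagSum fun k m ↦ p * R k m * (1 - p) * h) := by
    rw [← diagSum_add, ← diagSum_sub]
    congr 1; ext k m : 2
    linear_combination (norm := noncomm_ring) - (1 - (p + p)) * hNc k m * h - 2 * pp * R k m * h
  -- Let `S`, `T`, `T'` and `K` be the contractions of `(1 - 2p)N k m`, `A k * A m`, `A m * A k` and
  -- `pR(1 - p)`, each multiplied by `h`. The relations give `S = 2T + 2T' - (S - 2K)`, so `S = T +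
  -- T' + K`, and the left-hand side is `-2T + S = K - T + T'`.
  rw [hLHS]
  rw [hS1, e2, hS2] at e1
  linarith

end IsProjOn

end WalczakFormula

/-! ### Covariance of the connection under isometric changes of coordinates. -/

section ChartChange

open Matrix

variable {n : ℕ}

/-- The bilinear form with Gram matrix `A`. -/
def gramForm (A : Matrix (Fin n) (Fin n) ℝ) (u v : EuclideanSpace ℝ (Fin n)) : ℝ :=
  ∑ i, ∑ j, A i j * (u i * v j)

lemma gramForm_add_left (A : Matrix (Fin n) (Fin n) ℝ) (u u' v : EuclideanSpace ℝ (Fin n)) :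
    gramForm A (u + u') v = gramForm A u v + gramForm A u' v := by
  simp only [gramForm, PiLp.add_apply, ← Finset.sum_add_distrib]
  exact Finset.sum_congr rfl fun i _ ↦ Finset.sum_congr rfl fun j _ ↦ by ring

lemma gramForm_comm {A : Matrix (Fin n) (Fin n) ℝ} (hA : Aᵀ = A)
    (u v : EuclideanSpace ℝ (Fin n)) : gramForm A u v = gramForm A v u := by
  simp only [gramForm]
  rw [Finset.sum_comm]
  refine Finset.sum_congr rfl fun i _ ↦ Finset.sum_congr rfl fun j _ ↦ ?_
  rw [show A j i = A i j from congr_fun₂ hA i j]; ring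

lemma gramForm_eq_dotProduct (A : Matrix (Fin n) (Fin n) ℝ) (u v : EuclideanSpace ℝ (Fin n)) :
    gramForm A u v = ⇑u ⬝ᵥ (A *ᵥ ⇑v) := by
  simp only [gramForm, dotProduct, mulVec, Finset.mul_sum]
  exact Finset.sum_congr rfl fun i _ ↦ Finset.sum_congr rfl fun j _ ↦ by ring

lemma eq_of_gramForm_eq {A : Matrix (Fin n) (Fin n) ℝ} (hA : IsUnit A.det)
    {u v : EuclideanSpace ℝ (Fin n)} (h : ∀ w, gramForm A u w = gramForm A v w) : u = v := by
  have h1 : ⇑u ᵥ* A = ⇑v ᵥ* A := by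
    ext j
    have := h (EuclideanSpace.single j 1)
    simp only [gramForm_eq_dotProduct, PiLp.ofLp_single, mulVec_single_one] at this
    exact this
  have h2 := congr_arg (· ᵥ* A⁻¹) h1
  simp only [vecMul_vecMul, Matrix.mul_nonsing_inv _ hA, vecMul_one] at h2
  exact PiLp.ext fun i ↦ congr_fun h2 i

/-- The bilinear map `(u, w) ↦ ∑ Γᵏᵢⱼ uⁱ wʲ ∂ₖ` given by the Christoffel symbols of a metric. -/
noncomputable def chrisBil (G : EuclideanSpace ℝ (Fin n) → Matrix (Fin n) (Fin n) ℝ)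
    (y u w : EuclideanSpace ℝ (Fin n)) : EuclideanSpace ℝ (Fin n) :=
  WithLp.toLp 2 fun k ↦ ∑ i, u i * (chrisMat G i y *ᵥ ⇑w) k

/-- The derivative of the Gram matrix in the direction of `u`. -/
noncomputable def matDirDeriv (G : EuclideanSpace ℝ (Fin n) → Matrix (Fin n) (Fin n) ℝ)
    (y u : EuclideanSpace ℝ (Fin n)) : Matrix (Fin n) (Fin n) ℝ :=
  ∑ k, u k • matDeriv k G y

lemma fderiv_eq_sum {F : Type*} [NormedAddCommGroup F] [NormedSpace ℝ F]
    (L : EuclideanSpace ℝ (Fin n) →L[ℝ] F) (u : EuclideanSpace ℝ (Fin n)) :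
    L u = ∑ k, u k • L (EuclideanSpace.single k 1) := by
  conv_lhs => rw [← (EuclideanSpace.basisFun (Fin n) ℝ).sum_repr u]
  simp

lemma matDirDeriv_apply (G : EuclideanSpace ℝ (Fin n) → Matrix (Fin n) (Fin n) ℝ)
    (y u : EuclideanSpace ℝ (Fin n)) (i j : Fin n) :
    matDirDeriv G y u i j = fderiv ℝ (fun z ↦ G z i j) y u := by
  rw [fderiv_eq_sum]
  simp [matDirDeriv, Matrix.sum_apply, matDeriv]

lemma gramForm_matDirDeriv (G : EuclideanSpace ℝ (Fin n) → Matrix (Fin n) (Fin n) ℝ)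
    (y u v w : EuclideanSpace ℝ (Fin n)) :
    gramForm (matDirDeriv G y u) v w = ∑ k, ∑ i, ∑ j, matDeriv k G y i j * (u k * v i * w j) := by
  simp only [gramForm, matDirDeriv, Matrix.sum_apply, Matrix.smul_apply, Finset.sum_mul, smul_eq_mul]
  rw [Finset.sum_congr rfl fun i _ ↦ Finset.sum_comm, Finset.sum_comm]
  refine Finset.sum_congr rfl fun k _ ↦ Finset.sum_congr rfl fun i _ ↦
    Finset.sum_congr rfl fun j _ ↦ by ring

/-- The Koszul formula for constant vector fields. Together with nondegeneracy it characterises the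
Christoffel symbols without indices. -/
lemma IsMetricOn.gramForm_chrisBil {G : EuclideanSpace ℝ (Fin n) → Matrix (Fin n) (Fin n) ℝ}
    {U : Set (EuclideanSpace ℝ (Fin n))} (hG : IsMetricOn G U) {y : EuclideanSpace ℝ (Fin n)}
    (hy : y ∈ U) (u w v : EuclideanSpace ℝ (Fin n)) :
    2 * gramForm (G y) (chrisBil G y u w) v = gramForm (matDirDeriv G y u) w v
      + gramForm (matDirDeriv G y w) u v - gramForm (matDirDeriv G y v) u w := by
  have h1 : gramForm (G y) (chrisBil G y u w) v
      = ∑ k, ∑ i, ∑ j, (u k * w i * v j) * (G y * chrisMat G k y) j i := by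
    rw [gramForm_comm (hG.symm y hy), gramForm_eq_dotProduct]
    have : (⇑(chrisBil G y u w) : Fin n → ℝ) = ∑ k, u k • (chrisMat G k y *ᵥ ⇑w) := by
      ext l; simp [chrisBil]
    rw [this, Matrix.mulVec_sum, dotProduct_sum]
    refine Finset.sum_congr rfl fun k _ ↦ ?_
    rw [Matrix.mulVec_smul, Matrix.mulVec_mulVec, dotProduct_smul]
    simp only [dotProduct, mulVec, Finset.mul_sum, smul_eq_mul]
    rw [Finset.sum_comm]
    refine Finset.sum_congr rfl fun i _ ↦ Finset.sum_congr rfl fun j _ ↦ by ring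
  have h2 : gramForm (matDirDeriv G y w) u v
      = ∑ k, ∑ i, ∑ j, matDeriv i G y k j * (u k * w i * v j) := by
    rw [gramForm_matDirDeriv, Finset.sum_comm]
    refine Finset.sum_congr rfl fun k _ ↦ Finset.sum_congr rfl fun i _ ↦
      Finset.sum_congr rfl fun j _ ↦ by ring
  have h3 : gramForm (matDirDeriv G y v) u w
      = ∑ k, ∑ i, ∑ j, matDeriv j G y k i * (u k * w i * v j) := by
    rw [gramForm_matDirDeriv, Finset.sum_comm]
    refine Finset.sum_congr rfl fun k _ ↦ ?_
    rw [Finset.sum_comm]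
    refine Finset.sum_congr rfl fun i _ ↦ Finset.sum_congr rfl fun j _ ↦ by ring
  rw [h1, gramForm_matDirDeriv, h2, h3]
  simp only [Finset.mul_sum, ← Finset.sum_add_distrib, ← Finset.sum_sub_distrib]
  refine Finset.sum_congr rfl fun k _ ↦ Finset.sum_congr rfl fun i _ ↦
    Finset.sum_congr rfl fun j _ ↦ ?_
  rw [hG.mul_chrisMat_apply hy]; ring

lemma fderiv_gramForm_comp {G : EuclideanSpace ℝ (Fin n) → Matrix (Fin n) (Fin n) ℝ}
    {ψ a b : EuclideanSpace ℝ (Fin n) → EuclideanSpace ℝ (Fin n)} {y : EuclideanSpace ℝ (Fin n)}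
    (hG : MatSmoothAt G (ψ y)) (hψ : DifferentiableAt ℝ ψ y) (ha : DifferentiableAt ℝ a y)
    (hb : DifferentiableAt ℝ b y) (v : EuclideanSpace ℝ (Fin n)) :
    fderiv ℝ (fun z ↦ gramForm (G (ψ z)) (a z) (b z)) y v =
      gramForm (matDirDeriv G (ψ y) (fderiv ℝ ψ y v)) (a y) (b y)
        + gramForm (G (ψ y)) (fderiv ℝ a y v) (b y) + gramForm (G (ψ y)) (a y) (fderiv ℝ b y v) := by
  have hc : ∀ {a : EuclideanSpace ℝ (Fin n) → EuclideanSpace ℝ (Fin n)},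
      DifferentiableAt ℝ a y → ∀ i, HasFDerivAt (fun z ↦ a z i)
        ((EuclideanSpace.proj i).comp (fderiv ℝ a y)) y :=
    fun ha i ↦ (EuclideanSpace.proj (𝕜 := ℝ) i).hasFDerivAt.comp y ha.hasFDerivAt
  have hg : ∀ i j, HasFDerivAt (fun z ↦ G (ψ z) i j)
      ((fderiv ℝ (fun z ↦ G z i j) (ψ y)).comp (fderiv ℝ ψ y)) y :=
    fun i j ↦ (hG.diff i j).hasFDerivAt.comp y hψ.hasFDerivAt
  have h : HasFDerivAt (fun z ↦ gramForm (G (ψ z)) (a z) (b z)) _ y :=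
    HasFDerivAt.fun_sum fun i _ ↦ HasFDerivAt.fun_sum fun j _ ↦
      (hg i j).fun_mul ((hc ha i).fun_mul (hc hb j))
  rw [h.fderiv]
  simp only [gramForm, matDirDeriv_apply, _root_.sum_apply, ← Finset.sum_add_distrib]
  refine Finset.sum_congr rfl fun i _ ↦ Finset.sum_congr rfl fun j _ ↦ ?_
  simp
  ring

variable {G G' : EuclideanSpace ℝ (Fin n) → Matrix (Fin n) (Fin n) ℝ}
  {U U' : Set (EuclideanSpace ℝ (Fin n))}
  {ψ : EuclideanSpace ℝ (Fin n) → EuclideanSpace ℝ (Fin n)} {y : EuclideanSpace ℝ (Fin n)}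

/-- The transformation rule of the Christoffel symbols under an isometric change of coordinates. -/
lemma chrisBil_map (hG : IsMetricOn G U) (hG' : IsMetricOn G' U') (hy : y ∈ U') (hψy : ψ y ∈ U)
    (hψ : ContDiffAt ℝ ∞ ψ y)
    (h : ∀ᶠ z in nhds y, ∀ u w, gramForm (G' z) u w
      = gramForm (G (ψ z)) (fderiv ℝ ψ z u) (fderiv ℝ ψ z w))
    (hJ : Function.Surjective (fderiv ℝ ψ y)) (u w : EuclideanSpace ℝ (Fin n)) :
    fderiv ℝ ψ y (chrisBil G' y u w) = fderiv ℝ (fderiv ℝ ψ) y u w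
      + chrisBil G (ψ y) (fderiv ℝ ψ y u) (fderiv ℝ ψ y w) := by
  have h2 : DifferentiableAt ℝ (fderiv ℝ ψ) y :=
    (hψ.fderiv_right (m := ∞) (by simp)).differentiableAt (by simp)
  have hs := fun a b ↦ (hψ.isSymmSndFDerivAt (by simpa using ENat.LEInfty.out)).eq a b
  -- Derivative of the isometry relation between `G'` and `G`: besides the derivative of `G` it
  -- produces two terms with the Hessian of `ψ`.
  have hd : ∀ u v w, gramForm (matDirDeriv G' y v) u w =
      gramForm (matDirDeriv G (ψ y) (fderiv ℝ ψ y v)) (fderiv ℝ ψ y u) (fderiv ℝ ψ y w)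
        + gramForm (G (ψ y)) (fderiv ℝ (fderiv ℝ ψ) y v u) (fderiv ℝ ψ y w)
        + gramForm (G (ψ y)) (fderiv ℝ ψ y u) (fderiv ℝ (fderiv ℝ ψ) y v w) := by
    intro u v w
    have e1 : gramForm (matDirDeriv G' y v) u w = fderiv ℝ (fun z ↦ gramForm (G' z) u w) y v := by
      have := fderiv_gramForm_comp (ψ := id) (a := fun _ ↦ u) (b := fun _ ↦ w) (y := y)
        (hG'.smooth y hy) (by fun_prop) (by fun_prop) (by fun_prop) v
      simp only [id_eq, fderiv_id] at this
      rw [this]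
      simp [gramForm]
    rw [e1, Filter.EventuallyEq.fderiv_eq (h.mono fun z hz ↦ hz u w),
      fderiv_gramForm_comp (hG.smooth _ hψy) (hψ.differentiableAt (by simp))
      (h2.clm_apply (by fun_prop)) (h2.clm_apply (by fun_prop))]
    rw [fderiv_clm_apply h2 (by fun_prop), fderiv_clm_apply h2 (by fun_prop)]
    simp
  refine eq_of_gramForm_eq (hG.isUnit_det hψy) fun v' ↦ ?_
  obtain ⟨v, rfl⟩ := hJ v'
  have k1 := hG'.gramForm_chrisBil hy u w v
  have k2 := hG.gramForm_chrisBil hψy (fderiv ℝ ψ y u) (fderiv ℝ ψ y w) (fderiv ℝ ψ y v)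
  -- In the Koszul combination the Hessian of `ψ` is symmetric, so four of the six Hessian terms
  -- cancel and the other two give twice the inhomogeneous term.
  rw [h.self_of_nhds, hd, hd, hd, hs w u, hs v w, hs v u] at k1
  rw [gramForm_add_left]
  have c1 := gramForm_comm (hG.symm _ hψy) (fderiv ℝ ψ y w) (fderiv ℝ (fderiv ℝ ψ) y u v)
  have c2 := gramForm_comm (hG.symm _ hψy) (fderiv ℝ ψ y u) (fderiv ℝ (fderiv ℝ ψ) y w v)
  linarith

/-- The covariant derivative of a vector field on an open subset of `ℝⁿ` with a metric. -/
noncomputable def covVec (G : EuclideanSpace ℝ (Fin n) → Matrix (Fin n) (Fin n) ℝ)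
    (W : EuclideanSpace ℝ (Fin n) → EuclideanSpace ℝ (Fin n)) (y u : EuclideanSpace ℝ (Fin n)) :
    EuclideanSpace ℝ (Fin n) :=
  fderiv ℝ W y u + chrisBil G y u (W y)

/-- Differentiating `W ∘ ψ = dψ(W')` yields a Hessian of `ψ`, which is exactly the inhomogeneous
term in the transformation of the Christoffel symbols. -/
lemma covVec_map (hG : IsMetricOn G U) (hG' : IsMetricOn G' U') (hy : y ∈ U') (hψy : ψ y ∈ U)
    (hψ : ContDiffAt ℝ ∞ ψ y)
    (h : ∀ᶠ z in nhds y, ∀ u w, gramForm (G' z) u w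
      = gramForm (G (ψ z)) (fderiv ℝ ψ z u) (fderiv ℝ ψ z w))
    (hJ : Function.Surjective (fderiv ℝ ψ y))
    {W W' : EuclideanSpace ℝ (Fin n) → EuclideanSpace ℝ (Fin n)}
    (hW : DifferentiableAt ℝ W (ψ y)) (hW' : DifferentiableAt ℝ W' y)
    (hWW' : ∀ᶠ z in nhds y, W (ψ z) = fderiv ℝ ψ z (W' z)) (u : EuclideanSpace ℝ (Fin n)) :
    fderiv ℝ ψ y (covVec G' W' y u) = covVec G W (ψ y) (fderiv ℝ ψ y u) := by
  have h2 : DifferentiableAt ℝ (fderiv ℝ ψ) y :=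
    (hψ.fderiv_right (m := ∞) (by simp)).differentiableAt (by simp)
  have e := DFunLike.congr_fun (Filter.EventuallyEq.fderiv_eq (𝕜 := ℝ) hWW') u
  have e1 : fderiv ℝ (fun z ↦ W (ψ z)) y = _ := fderiv_comp y hW (hψ.differentiableAt (by simp))
  rw [e1, fderiv_clm_apply h2 hW'] at e
  simp only [ContinuousLinearMap.comp_apply, _root_.add_apply,
    ContinuousLinearMap.flip_apply] at e
  rw [covVec, covVec, map_add, chrisBil_map hG hG' hy hψy hψ h hJ, e, hWW'.self_of_nhds]
  abel

end ChartChange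

/-! ### Vector fields, metric and Levi-Civita connection of the manifold in charts. -/

noncomputable section ManifoldCharts

variable {n : ℕ} {M : Type*} [TopologicalSpace M] [ChartedSpace (EuclideanSpace ℝ (Fin n)) M]

local notation "𝔼" => EuclideanSpace ℝ (Fin n)
local notation "𝕏" => chartAt (EuclideanSpace ℝ (Fin n))

variable [IsManifold (𝓡 n) ∞ M]

/-- The components of a tangent vector in the chart at `c`. -/
def toChart (c q : M) : TangentSpace (𝓡 n) q →L[ℝ] 𝔼 :=
  (trivializationAt 𝔼 (TangentSpace (𝓡 n)) c).continuousLinearMapAt ℝ q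

/-- The tangent vector with given components in the chart at `c`. -/
def ofChart (c q : M) : 𝔼 →L[ℝ] TangentSpace (𝓡 n) q :=
  (trivializationAt 𝔼 (TangentSpace (𝓡 n)) c).symmL ℝ q

/-- The coordinate expression of a vector field in the chart at `c`. -/
def fieldIn (c : M) (Y : Π q : M, TangentSpace (𝓡 n) q) (y : 𝔼) : 𝔼 :=
  toChart c ((𝕏 c).symm y) (Y ((𝕏 c).symm y))

/-- A vector field is smooth at a point. -/
def FieldSmoothAt (Y : Π q : M, TangentSpace (𝓡 n) q) (x : M) : Prop :=
  ContMDiffAt (𝓡 n) ((𝓡 n).prod 𝓘(ℝ, 𝔼)) ∞ (fun q ↦ (⟨q, Y q⟩ : TangentBundle (𝓡 n) M)) x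

variable {c q : M}

lemma toChart_apply (hq : q ∈ (𝕏 c).source) (u : TangentSpace (𝓡 n) q) :
    toChart c q u = (trivializationAt 𝔼 (TangentSpace (𝓡 n)) c ⟨q, u⟩).2 := by
  have : q ∈ (trivializationAt 𝔼 (TangentSpace (𝓡 n)) c).baseSet := hq
  rw [toChart, Trivialization.continuousLinearMapAt_apply, Trivialization.coe_linearMapAt_of_mem _ this]

@[simp] lemma toChart_ofChart (hq : q ∈ (𝕏 c).source) (v : 𝔼) :
    toChart c q (ofChart c q v) = v :=
  Trivialization.continuousLinearMapAt_symmL _ hq v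

@[simp] lemma ofChart_toChart (hq : q ∈ (𝕏 c).source) (v : TangentSpace (𝓡 n) q) :
    ofChart c q (toChart c q v) = v :=
  Trivialization.symmL_continuousLinearMapAt _ hq v

lemma toChart_injective (hq : q ∈ (𝕏 c).source) :
    Function.Injective (toChart (n := n) c q) := fun u v h ↦ by
  rw [← ofChart_toChart hq u, h, ofChart_toChart hq]

lemma ofChart_single (hq : q ∈ (𝕏 c).source) (i : Fin n) :
    ofChart c q (EuclideanSpace.single i 1) = coordVec c i q :=
  Trivialization.symmL_apply (R := ℝ) (trivializationAt 𝔼 (TangentSpace (𝓡 n)) c)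
    (show q ∈ (trivializationAt 𝔼 (TangentSpace (𝓡 n)) c).baseSet from hq) _

lemma toChart_coordVec (hq : q ∈ (𝕏 c).source) (i : Fin n) :
    toChart c q (coordVec c i q) = EuclideanSpace.single i 1 := by
  rw [← ofChart_single hq, toChart_ofChart hq]

lemma coordComp_eq (Y : Π q : M, TangentSpace (𝓡 n) q) (hq : q ∈ (𝕏 c).source) :
    coordComp c Y q = toChart c q (Y q) := (toChart_apply hq _).symm

lemma contMDiffAt_iff_comp_chart_symm {F : Type*} [NormedAddCommGroup F] [NormedSpace ℝ F]
    {f : M → F} (hq : q ∈ (𝕏 c).source) :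
    ContMDiffAt (𝓡 n) 𝓘(ℝ, F) ∞ f q ↔ ContDiffAt ℝ ∞ (f ∘ (𝕏 c).symm) (𝕏 c q) := by
  constructor
  · intro h
    have h2 : ContMDiffAt (𝓡 n) (𝓡 n) ∞ (𝕏 c).symm (𝕏 c q) :=
      (contMDiffOn_chart_symm (x := c)).contMDiffAt
        ((𝕏 c).open_target.mem_nhds ((𝕏 c).map_source hq))
    have h3 := ContMDiffAt.comp (𝕏 c q) (I' := 𝓡 n) (g := f) (by rwa [(𝕏 c).left_inv hq]) h2
    exact h3.contDiffAt
  · intro h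
    have h2 : ContMDiffAt (𝓡 n) 𝓘(ℝ, 𝔼) ∞ (𝕏 c) q := contMDiffAt_extChartAt' (x := c) hq
    have h3 := ContMDiffAt.comp q (g := f ∘ (𝕏 c).symm) (h.contMDiffAt) h2
    refine h3.congr_of_eventuallyEq ?_
    filter_upwards [(𝕏 c).open_source.mem_nhds hq] with z hz
    simp [(𝕏 c).left_inv hz]

lemma mdifferentiableAt_iff_comp_chart_symm {F : Type*} [NormedAddCommGroup F] [NormedSpace ℝ F]
    {f : M → F} (hq : q ∈ (𝕏 c).source) :
    MDifferentiableAt (𝓡 n) 𝓘(ℝ, F) f q ↔ DifferentiableAt ℝ (f ∘ (𝕏 c).symm) (𝕏 c q) := by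
  constructor
  · intro h
    have h2 : MDifferentiableAt (𝓡 n) (𝓡 n) (𝕏 c).symm (𝕏 c q) :=
      ((contMDiffOn_chart_symm (n := 1) (x := c)).contMDiffAt
        ((𝕏 c).open_target.mem_nhds ((𝕏 c).map_source hq))).mdifferentiableAt (by simp)
    have h3 := MDifferentiableAt.comp (𝕏 c q) (I' := 𝓡 n) (g := f) (by rwa [(𝕏 c).left_inv hq]) h2
    exact h3.differentiableAt
  · intro h
    have h2 : MDifferentiableAt (𝓡 n) 𝓘(ℝ, 𝔼) (𝕏 c) q :=
      (contMDiffAt_extChartAt' (n := 1) (x := c) hq).mdifferentiableAt (by simp)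
    have h3 := MDifferentiableAt.comp q (g := f ∘ (𝕏 c).symm) (h.mdifferentiableAt) h2
    refine h3.congr_of_eventuallyEq ?_
    filter_upwards [(𝕏 c).open_source.mem_nhds hq] with z hz
    simp [(𝕏 c).left_inv hz]

lemma mvfderiv_chart (hq : q ∈ (𝕏 c).source) (u : TangentSpace (𝓡 n) q) :
    mvfderiv (𝓡 n) (𝕏 c) q u = toChart c q u := by
  rw [toChart, TangentBundle.continuousLinearMapAt_trivializationAt hq]
  rfl

lemma mvfderiv_eq_fderiv {F : Type*} [NormedAddCommGroup F] [NormedSpace ℝ F]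
    {f : M → F} (hq : q ∈ (𝕏 c).source) (hf : MDifferentiableAt (𝓡 n) 𝓘(ℝ, F) f q)
    (u : TangentSpace (𝓡 n) q) :
    mvfderiv (𝓡 n) f q u = fderiv ℝ (f ∘ (𝕏 c).symm) (𝕏 c q) (toChart c q u) := by
  have h2 : MDifferentiableAt (𝓡 n) 𝓘(ℝ, 𝔼) (𝕏 c) q :=
    (contMDiffAt_extChartAt' (n := 1) (x := c) hq).mdifferentiableAt (by simp)
  have h1 : DifferentiableAt ℝ (f ∘ (𝕏 c).symm) (𝕏 c q) :=
    (mdifferentiableAt_iff_comp_chart_symm hq).1 hf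
  have h3 : mvfderiv (𝓡 n) f q = mvfderiv (𝓡 n) ((f ∘ (𝕏 c).symm) ∘ 𝕏 c) q := by
    have : f =ᶠ[nhds q] (f ∘ (𝕏 c).symm) ∘ 𝕏 c := by
      filter_upwards [(𝕏 c).open_source.mem_nhds hq] with z hz
      simp [(𝕏 c).left_inv hz]
    ext v
    simp only [mvfderiv, this.mfderiv_eq, ContinuousLinearMap.comp_apply]
    rfl
  have h4 := mfderiv_comp_apply (I' := 𝓘(ℝ, 𝔼)) q h1.mdifferentiableAt h2 u
  rw [mfderiv_eq_fderiv] at h4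
  rw [h3, ← mvfderiv_chart hq]
  exact h4

variable {c' : M}

/-- The change of coordinates between the charts at `c'` and at `c`. -/
def chartChange (c c' : M) : 𝔼 → 𝔼 := 𝕏 c ∘ (𝕏 c').symm

lemma contDiffAt_chartChange (hq : q ∈ (𝕏 c).source) (hq' : q ∈ (𝕏 c').source) :
    ContDiffAt ℝ ∞ (chartChange c c' : 𝔼 → 𝔼) (𝕏 c' q) :=
  (contMDiffAt_iff_comp_chart_symm hq').1 (contMDiffAt_extChartAt' (x := c) hq)

lemma toChart_eq_fderiv (hq : q ∈ (𝕏 c).source) (hq' : q ∈ (𝕏 c').source)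
    (u : TangentSpace (𝓡 n) q) :
    toChart c q u = fderiv ℝ (chartChange c c') (𝕏 c' q) (toChart c' q u) := by
  have h2 : MDifferentiableAt (𝓡 n) 𝓘(ℝ, 𝔼) (𝕏 c) q :=
    (contMDiffAt_extChartAt' (n := 1) (x := c) hq).mdifferentiableAt (by simp)
  rw [← mvfderiv_chart hq, mvfderiv_eq_fderiv hq' h2]
  rfl

lemma fieldIn_chart (Y : Π q : M, TangentSpace (𝓡 n) q) (hq : q ∈ (𝕏 c).source) :
    fieldIn c Y (𝕏 c q) = toChart c q (Y q) := by
  rw [fieldIn, (𝕏 c).left_inv hq]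

lemma fieldSmoothAt_iff {Y : Π q : M, TangentSpace (𝓡 n) q} (hq : q ∈ (𝕏 c).source) :
    FieldSmoothAt Y q ↔ ContDiffAt ℝ ∞ (fieldIn c Y) (𝕏 c q) := by
  rw [FieldSmoothAt, Trivialization.contMDiffAt_section_iff
    (trivializationAt 𝔼 (TangentSpace (𝓡 n)) c) hq, contMDiffAt_iff_comp_chart_symm hq]
  have e : fieldIn c Y =ᶠ[nhds (𝕏 c q)]
      (fun q ↦ (trivializationAt 𝔼 (TangentSpace (𝓡 n)) c ⟨q, Y q⟩).2) ∘ (𝕏 c).symm := by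
    filter_upwards [(𝕏 c).open_target.mem_nhds ((𝕏 c).map_source hq)] with y hy
    exact toChart_apply ((𝕏 c).map_target hy) _
  exact ⟨fun h ↦ h.congr_of_eventuallyEq e, fun h ↦ h.congr_of_eventuallyEq e.symm⟩

lemma mdifferentiableAt_field_iff {Y : Π q : M, TangentSpace (𝓡 n) q} (hq : q ∈ (𝕏 c).source) :
    MDifferentiableAt (𝓡 n) ((𝓡 n).prod 𝓘(ℝ, 𝔼)) (fun q ↦ (⟨q, Y q⟩ : TangentBundle (𝓡 n) M)) q
      ↔ DifferentiableAt ℝ (fieldIn c Y) (𝕏 c q) := by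
  rw [Trivialization.mdifferentiableAt_section_iff (𝓡 n)
    (trivializationAt 𝔼 (TangentSpace (𝓡 n)) c) Y hq, mdifferentiableAt_iff_comp_chart_symm hq]
  refine Filter.EventuallyEq.differentiableAt_iff ?_
  filter_upwards [(𝕏 c).open_target.mem_nhds ((𝕏 c).map_source hq)] with y hy
  exact (toChart_apply ((𝕏 c).map_target hy) _).symm

/-- The extension has constant components throughout its chart, which makes its coordinate
derivatives vanish. -/
lemma fieldIn_extend (v : TangentSpace (𝓡 n) q) {y : 𝔼} (hy : y ∈ (𝕏 q).target) :
    fieldIn q (FiberBundle.extend 𝔼 v) y = toChart q q v := by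
  have h := toChart_ofChart ((𝕏 q).map_target hy) (toChart q q v)
  rw [toChart_apply (mem_chart_source _ _)] at h ⊢
  rw [← h]
  exact congr_arg (toChart q ((𝕏 q).symm y)) (Trivialization.symmL_apply (R := ℝ)
    (trivializationAt 𝔼 (TangentSpace (𝓡 n)) q) ((𝕏 q).map_target hy) _).symm

lemma fieldSmoothAt_extend {p : M} (v : TangentSpace (𝓡 n) q) (hp : p ∈ (𝕏 q).source) :
    FieldSmoothAt (FiberBundle.extend 𝔼 v) p := by
  rw [fieldSmoothAt_iff hp]
  refine (contDiffAt_const (c := toChart q q v)).congr_of_eventuallyEq ?_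
  filter_upwards [(𝕏 q).open_target.mem_nhds ((𝕏 q).map_source hp)] with y hy
  exact fieldIn_extend v hy

lemma contMDiffAt_coordVec (hq : q ∈ (𝕏 c).source) (i : Fin n) : FieldSmoothAt (coordVec c i) q := by
  rw [fieldSmoothAt_iff hq]
  refine (contDiffAt_const (c := EuclideanSpace.single i (1 : ℝ))).congr_of_eventuallyEq ?_
  filter_upwards [(𝕏 c).open_target.mem_nhds ((𝕏 c).map_source hq)] with y hy
  exact toChart_coordVec ((𝕏 c).map_target hy) i

section Metric

variable [RiemannianBundle (fun x : M ↦ TangentSpace (𝓡 n) x)]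

/-- The Gram matrix of the metric as a function on the chart at `c`. -/
def metricIn (c : M) (y : 𝔼) : Matrix (Fin n) (Fin n) ℝ := gramMatrix c ((𝕏 c).symm y)

lemma metricIn_chart (hq : q ∈ (𝕏 c).source) : metricIn c (𝕏 c q) = gramMatrix c q := by
  rw [metricIn, (𝕏 c).left_inv hq]

lemma sum_smul_coordVec (hq : q ∈ (𝕏 c).source) (u : TangentSpace (𝓡 n) q) :
    u = ∑ i, toChart c q u i • coordVec c i q := by
  conv_lhs => rw [← ofChart_toChart hq u, fderiv_eq_sum (ofChart c q) (toChart c q u)]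
  simp only [ofChart_single hq]

lemma inner_eq_gramForm (hq : q ∈ (𝕏 c).source) (u v : TangentSpace (𝓡 n) q) :
    inner ℝ u v = gramForm (gramMatrix c q) (toChart c q u) (toChart c q v) := by
  conv_lhs => rw [sum_smul_coordVec hq u, sum_smul_coordVec hq v]
  simp only [sum_inner, inner_sum, inner_smul_left, inner_smul_right, gramForm, gramMatrix,
    Matrix.of_apply]
  simp only [Finset.mul_sum]
  rw [Finset.sum_comm]
  refine Finset.sum_congr rfl fun i _ ↦ Finset.sum_congr rfl fun j _ ↦ ?_
  simp; ring

lemma gramMatrix_symm (c q : M) : (gramMatrix (n := n) c q).transpose = gramMatrix c q := by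
  ext i j
  exact real_inner_comm (coordVec c i q) (coordVec c j q)

lemma gramMatrix_posDef (hq : q ∈ (𝕏 c).source) : (gramMatrix (n := n) c q).PosDef := by
  refine Matrix.PosDef.of_dotProduct_mulVec_pos ?_ fun v hv ↦ ?_
  · rw [Matrix.IsHermitian, Matrix.conjTranspose_eq_transpose_of_trivial, gramMatrix_symm]
  · have h := inner_eq_gramForm hq (ofChart c q (WithLp.toLp 2 v)) (ofChart c q (WithLp.toLp 2 v))
    rw [toChart_ofChart hq, gramForm_eq_dotProduct] at h
    have h2 : ofChart c q (WithLp.toLp 2 v) ≠ 0 := by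
      intro h0
      have := congr_arg (toChart c q) h0
      rw [toChart_ofChart hq, map_zero] at this
      exact hv (by simpa using this)
    simp only [star_trivial, ← h]
    exact real_inner_self_pos.2 h2

variable [IsContMDiffRiemannianBundle (𝓡 n) ∞ (EuclideanSpace ℝ (Fin n))
  (fun x : M ↦ TangentSpace (𝓡 n) x)]

lemma contMDiffAt_gramMatrix (hq : q ∈ (𝕏 c).source) (i j : Fin n) :
    ContMDiffAt (𝓡 n) 𝓘(ℝ, ℝ) ∞ (fun r : M ↦ gramMatrix (n := n) c r i j) q :=
  ContMDiffAt.inner_bundle (contMDiffAt_coordVec hq i) (contMDiffAt_coordVec hq j)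

lemma isMetricOn_metricIn (c : M) : IsMetricOn (metricIn (n := n) c) (𝕏 c).target where
  isOpen := (𝕏 c).open_target
  smooth y hy i j := by
    have h := (contMDiffAt_iff_comp_chart_symm ((𝕏 c).map_target hy)).1
      (contMDiffAt_gramMatrix ((𝕏 c).map_target hy) i j)
    rwa [(𝕏 c).right_inv hy] at h
  symm y _ := gramMatrix_symm _ _
  posDet y hy := (gramMatrix_posDef ((𝕏 c).map_target hy)).det_pos

lemma christoffel_eq (hq : q ∈ (𝕏 c).source) (k i j : Fin n) :
    christoffel (n := n) c q k i j = chrisMat (metricIn c) i (𝕏 c q) k j := by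
  have h : ∀ k i j, gramDeriv (n := n) c q k i j = matDeriv k (metricIn c) (𝕏 c q) i j := by
    intro k i j
    rw [gramDeriv, mvfderiv_eq_fderiv hq
      ((contMDiffAt_gramMatrix hq i j).mdifferentiableAt (by simp)), toChart_coordVec hq]
    rfl
  simp only [christoffel, chrisMat, Matrix.of_apply, h, metricIn_chart hq]

/-- In the chart centred at the point, the coordinate formula is the definition of the connection.
-/
lemma toChart_leviCivita_self {Y : Π q : M, TangentSpace (𝓡 n) q}
    (hY : DifferentiableAt ℝ (fieldIn q Y) (𝕏 q q)) (u : TangentSpace (𝓡 n) q) :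
    toChart q q (leviCivita Y q u)
      = covVec (metricIn q) (fieldIn q Y) (𝕏 q q) (toChart q q u) := by
  have hq : q ∈ (𝕏 q).source := mem_chart_source _ q
  have e : coordComp q Y ∘ (𝕏 q).symm =ᶠ[nhds (𝕏 q q)] fieldIn q Y := by
    filter_upwards [(𝕏 q).open_target.mem_nhds ((𝕏 q).map_source hq)] with y hy
    exact coordComp_eq Y ((𝕏 q).map_target hy)
  have hd : MDifferentiableAt (𝓡 n) 𝓘(ℝ, 𝔼) (coordComp q Y) q :=
    (mdifferentiableAt_iff_comp_chart_symm hq).2 (e.differentiableAt_iff.2 hY)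
  refine (toChart_ofChart hq _).trans ?_
  refine (_root_.add_apply (mvfderiv (𝓡 n) (coordComp q Y) q) _ u).trans ?_
  rw [mvfderiv_eq_fderiv hq hd, e.fderiv_eq, covVec]
  congr 1
  ext k
  simp only [ContinuousLinearMap.comp_apply, chrisBil, fieldIn_chart Y hq, coordComp_eq Y hq,
    christoffel_eq hq]
  change ∑ i, (∑ j, chrisMat (metricIn q) i (𝕏 q q) k j * toChart q q (Y q) j) * toChart q q u i = _
  refine Finset.sum_congr rfl fun i _ ↦ ?_
  rw [mul_comm]; rfl

/-- The coordinate formula of the Levi-Civita connection, in an arbitrary chart. -/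
theorem toChart_leviCivita {Y : Π q : M, TangentSpace (𝓡 n) q} (hq : q ∈ (𝕏 c).source)
    (hY : DifferentiableAt ℝ (fieldIn c Y) (𝕏 c q)) (u : TangentSpace (𝓡 n) q) :
    toChart c q (leviCivita Y q u)
      = covVec (metricIn c) (fieldIn c Y) (𝕏 c q) (toChart c q u) := by
  have hqq : q ∈ (𝕏 q).source := mem_chart_source _ q
  have hYq : DifferentiableAt ℝ (fieldIn q Y) (𝕏 q q) := by
    rwa [← mdifferentiableAt_field_iff hqq, mdifferentiableAt_field_iff hq]
  have hψ : chartChange c q (𝕏 q q) = 𝕏 c q := by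
    simp only [chartChange, Function.comp_apply, (𝕏 q).left_inv hqq]
  have hev : ∀ᶠ z in nhds (𝕏 q q), z ∈ (𝕏 q).target ∧ (𝕏 q).symm z ∈ (𝕏 c).source := by
    have h1 := (𝕏 q).open_target.mem_nhds ((𝕏 q).map_source hqq)
    refine Filter.Eventually.and h1 ?_
    refine ((𝕏 q).continuousAt_symm ((𝕏 q).map_source hqq)).eventually_mem ?_
    rw [(𝕏 q).left_inv hqq]
    exact (𝕏 c).open_source.mem_nhds hq
  have hJ := fun {p : M} (hp : p ∈ (𝕏 c).source) (hp' : p ∈ (𝕏 q).source) ↦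
    toChart_eq_fderiv hp hp'
  -- The transition map from the chart at `q` to the chart at `c` is an isometry of the two
  -- coordinate metrics and intertwines the two expressions of `Y`.
  have key := covVec_map (ψ := chartChange c q) (W := fieldIn c Y) (W' := fieldIn q Y)
    (isMetricOn_metricIn c) (isMetricOn_metricIn q) ((𝕏 q).map_source hqq)
    (by rw [hψ]; exact (𝕏 c).map_source hq) (contDiffAt_chartChange hq hqq) ?_ ?_
    (by rwa [hψ]) hYq ?_ (toChart q q u)
  · rw [hJ hq hqq, toChart_leviCivita_self hYq, key, ← hJ hq hqq, hψ]
  · filter_upwards [hev] with z hz u w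
    have h1 := (inner_eq_gramForm ((𝕏 q).map_target hz.1) (ofChart q _ u) (ofChart q _ w)).symm.trans
      (inner_eq_gramForm hz.2 _ _)
    rw [hJ hz.2 ((𝕏 q).map_target hz.1), hJ hz.2 ((𝕏 q).map_target hz.1),
      toChart_ofChart ((𝕏 q).map_target hz.1), toChart_ofChart ((𝕏 q).map_target hz.1),
      (𝕏 q).right_inv hz.1] at h1
    rw [metricIn, h1, chartChange, Function.comp_apply, metricIn_chart hz.2]
  · intro v
    exact ⟨toChart q q (ofChart c q v), by rw [← hJ hq hqq, toChart_ofChart hq]⟩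
  · filter_upwards [hev] with z hz
    have h1 := hJ hz.2 ((𝕏 q).map_target hz.1) (Y ((𝕏 q).symm z))
    rw [(𝕏 q).right_inv hz.1] at h1
    rw [chartChange, Function.comp_apply, fieldIn_chart Y hz.2, h1]
    rfl

end Metric

end ManifoldCharts

/-! ### Matrices acting on vector fields, and sections of the range of a projection. -/

section MatAct

open Matrix

variable {n : ℕ}

/-- The action of a square matrix on a vector of Euclidean space. -/
def matAct (A : Matrix (Fin n) (Fin n) ℝ) (v : EuclideanSpace ℝ (Fin n)) :
    EuclideanSpace ℝ (Fin n) := WithLp.toLp 2 (A *ᵥ ⇑v)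

lemma matAct_apply (A : Matrix (Fin n) (Fin n) ℝ) (v : EuclideanSpace ℝ (Fin n)) (i : Fin n) :
    matAct A v i = (A *ᵥ ⇑v) i := rfl

lemma ofLp_matAct (A : Matrix (Fin n) (Fin n) ℝ) (v : EuclideanSpace ℝ (Fin n)) :
    (⇑(matAct A v) : Fin n → ℝ) = A *ᵥ ⇑v := rfl

lemma matAct_matAct (A B : Matrix (Fin n) (Fin n) ℝ) (v : EuclideanSpace ℝ (Fin n)) :
    matAct A (matAct B v) = matAct (A * B) v := by
  simp [matAct, Matrix.mulVec_mulVec]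

lemma matAct_one (v : EuclideanSpace ℝ (Fin n)) : matAct 1 v = v := by simp [matAct]

lemma matAct_add (A : Matrix (Fin n) (Fin n) ℝ) (v w : EuclideanSpace ℝ (Fin n)) :
    matAct A (v + w) = matAct A v + matAct A w := by simp [matAct, Matrix.mulVec_add]

lemma matAct_sub_left (A B : Matrix (Fin n) (Fin n) ℝ) (v : EuclideanSpace ℝ (Fin n)) :
    matAct (A - B) v = matAct A v - matAct B v := by simp [matAct, Matrix.sub_mulVec]

lemma matAct_add_left (A B : Matrix (Fin n) (Fin n) ℝ) (v : EuclideanSpace ℝ (Fin n)) :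
    matAct (A + B) v = matAct A v + matAct B v := by simp [matAct, Matrix.add_mulVec]

lemma matAct_smul (A : Matrix (Fin n) (Fin n) ℝ) (r : ℝ) (v : EuclideanSpace ℝ (Fin n)) :
    matAct A (r • v) = r • matAct A v := by simp [matAct, Matrix.mulVec_smul]

lemma matAct_sum {ι : Type*} (s : Finset ι) (A : Matrix (Fin n) (Fin n) ℝ)
    (v : ι → EuclideanSpace ℝ (Fin n)) :
    matAct A (∑ i ∈ s, v i) = ∑ i ∈ s, matAct A (v i) := by
  ext k
  simp [matAct, Matrix.mulVec_sum]

lemma ContDiffAt.matAct {A : EuclideanSpace ℝ (Fin n) → Matrix (Fin n) (Fin n) ℝ}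
    {W : EuclideanSpace ℝ (Fin n) → EuclideanSpace ℝ (Fin n)} {y : EuclideanSpace ℝ (Fin n)}
    (hA : MatSmoothAt A y) (hW : ContDiffAt ℝ ∞ W y) :
    ContDiffAt ℝ ∞ (fun z ↦ matAct (A z) (W z)) y := by
  rw [contDiffAt_euclidean] at hW ⊢
  intro i
  simp only [matAct_apply, Matrix.mulVec, dotProduct]
  exact ContDiffAt.sum fun j _ ↦ (hA i j).mul (hW j)

lemma fderiv_matAct {A : EuclideanSpace ℝ (Fin n) → Matrix (Fin n) (Fin n) ℝ}
    {W : EuclideanSpace ℝ (Fin n) → EuclideanSpace ℝ (Fin n)} {y : EuclideanSpace ℝ (Fin n)}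
    (hA : MatSmoothAt A y) (hW : DifferentiableAt ℝ W y) (u : EuclideanSpace ℝ (Fin n)) :
    fderiv ℝ (fun z ↦ matAct (A z) (W z)) y u
      = (∑ k, u k • matAct (matDeriv k A y) (W y)) + matAct (A y) (fderiv ℝ W y u) := by
  have hc : ∀ i, HasFDerivAt (fun z ↦ W z i) ((EuclideanSpace.proj i).comp (fderiv ℝ W y)) y :=
    fun i ↦ (EuclideanSpace.proj (𝕜 := ℝ) i).hasFDerivAt.comp y hW.hasFDerivAt
  have h : HasFDerivAt (fun z ↦ matAct (A z) (W z)) ((EuclideanSpace.equiv (Fin n) ℝ).symm.toContinuousLinearMap.comp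
      (ContinuousLinearMap.pi fun i ↦ ∑ j, (A y i j • ((EuclideanSpace.proj j).comp (fderiv ℝ W y))
        + W y j • fderiv ℝ (fun z ↦ A z i j) y))) y := by
    rw [← hasFDerivWithinAt_univ, hasFDerivWithinAt_euclidean]
    intro i
    rw [hasFDerivWithinAt_univ]
    have h' : HasFDerivAt (fun z ↦ ∑ j, A z i j * W z j) _ y :=
      HasFDerivAt.fun_sum fun j _ ↦ (hA.diff i j).hasFDerivAt.fun_mul (hc j)
    refine h'.congr_fderiv ?_
    ext v
    simp
  rw [h.fderiv]
  have e : ∑ k, u k • matAct (matDeriv k A y) (W y) = matAct (matDirDeriv A y u) (W y) := by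
    ext i
    simp [matAct, matDirDeriv, Matrix.sum_mulVec, Matrix.smul_mulVec]
  rw [e]
  ext i
  simp only [PiLp.add_apply, matAct_apply, Matrix.mulVec, dotProduct, matDirDeriv_apply,
    ← Finset.sum_add_distrib]
  simp
  refine Finset.sum_congr rfl fun j _ ↦ by ring

lemma chrisBil_eq_sum (G : EuclideanSpace ℝ (Fin n) → Matrix (Fin n) (Fin n) ℝ)
    (y u w : EuclideanSpace ℝ (Fin n)) :
    chrisBil G y u w = ∑ k, u k • matAct (chrisMat G k y) w := by
  ext i; simp [chrisBil, matAct]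

/-- The derivative of a section of a subbundle, modulo this subbundle. -/
lemma covVec_of_section {G P : EuclideanSpace ℝ (Fin n) → Matrix (Fin n) (Fin n) ℝ}
    {U : Set (EuclideanSpace ℝ (Fin n))} (hG : IsMetricOn G U) (hP : IsProjOn G P U)
    {y : EuclideanSpace ℝ (Fin n)} (hy : y ∈ U)
    {W : EuclideanSpace ℝ (Fin n) → EuclideanSpace ℝ (Fin n)} (hW : DifferentiableAt ℝ W y)
    (h : ∀ᶠ z in nhds y, W z = matAct (P z) (W z)) (u : EuclideanSpace ℝ (Fin n)) :
    matAct (1 - P y) (covVec G W y u) = ∑ k, u k • matAct (covMat G k P y) (W y) := by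
  have h0 := h.self_of_nhds
  -- Differentiating `W = P W` gives `∂W = (∂P) W + P ∂W`, and `1 - P` kills the last term. What
  -- remains is matched with `A W = A P W = (1 - P) A W`.
  have h1 := DFunLike.congr_fun (Filter.EventuallyEq.fderiv_eq (𝕜 := ℝ) h) u
  rw [fderiv_matAct (hP.smooth y hy) hW] at h1
  have h2 : (1 - P y) * P y = 0 := by
    rw [Matrix.sub_mul, hP.idem y hy, Matrix.one_mul, sub_self]
  rw [covVec, matAct_add, h1, matAct_add, matAct_matAct, h2,
    chrisBil_eq_sum, matAct_sum, matAct_sum]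
  have h3 : matAct (0 : Matrix (Fin n) (Fin n) ℝ) (fderiv ℝ W y u) = 0 := by simp [matAct]
  rw [h3, add_zero, ← Finset.sum_add_distrib]
  refine Finset.sum_congr rfl fun k _ ↦ ?_
  rw [matAct_smul, matAct_smul, ← smul_add]
  congr 1
  have e1 : covMat G k P y * P y = (1 - P y) * covMat G k P y := by
    have := hP.covMat_idem hG hy k
    linear_combination (norm := noncomm_ring) -this
  have e2 : (1 - P y) * covMat G k P y
      = (1 - P y) * matDeriv k P y + (1 - P y) * (chrisMat G k y * P y) := by
    simp only [covMat]
    linear_combination (norm := noncomm_ring) -h2 * chrisMat G k y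
  conv_rhs => rw [h0, matAct_matAct, e1, e2, matAct_add_left]
  rw [matAct_matAct]
  congr 1
  conv_lhs => rw [h0]
  rw [matAct_matAct, matAct_matAct, Matrix.mul_assoc]

end MatAct

/-! ### The orthogonal projection to a distribution in a chart. -/

noncomputable section Projections

open Matrix

variable {n : ℕ} {M : Type*} [TopologicalSpace M] [ChartedSpace (EuclideanSpace ℝ (Fin n)) M]
  [IsManifold (𝓡 n) ∞ M] [RiemannianBundle (fun x : M ↦ TangentSpace (𝓡 n) x)]

local notation "𝔼" => EuclideanSpace ℝ (Fin n)
local notation "𝕏" => chartAt (EuclideanSpace ℝ (Fin n))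

variable {c q : M}

omit [RiemannianBundle (fun x : M ↦ TangentSpace (𝓡 n) x)] in
lemma matAct_ext {A B : Matrix (Fin n) (Fin n) ℝ} (hq : q ∈ (𝕏 c).source)
    (h : ∀ v : TangentSpace (𝓡 n) q, matAct A (toChart c q v) = matAct B (toChart c q v)) :
    A = B := by
  ext i j
  have h1 := h (coordVec c j q)
  rw [toChart_coordVec hq] at h1
  simpa [matAct] using congr_arg (· i) h1

/-- The matrix, in the chart at `c`, of the orthogonal projection to a distribution. -/
def projIn (c : M) (D : Π x : M, Submodule ℝ (TangentSpace (𝓡 n) x)) (y : 𝔼) :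
    Matrix (Fin n) (Fin n) ℝ :=
  Matrix.of fun i j ↦ toChart c ((𝕏 c).symm y)
    ((D ((𝕏 c).symm y)).starProjection (coordVec c j ((𝕏 c).symm y))) i

variable {D N : Π x : M, Submodule ℝ (TangentSpace (𝓡 n) x)}

lemma toChart_starProjection (hq : q ∈ (𝕏 c).source) (v : TangentSpace (𝓡 n) q) :
    toChart c q ((D q).starProjection v) = matAct (projIn c D (𝕏 c q)) (toChart c q v) := by
  obtain ⟨y, hy, rfl⟩ : ∃ y ∈ (𝕏 c).target, (𝕏 c).symm y = q :=
    ⟨𝕏 c q, (𝕏 c).map_source hq, (𝕏 c).left_inv hq⟩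
  rw [(𝕏 c).right_inv hy]
  ext i
  conv_lhs => rw [sum_smul_coordVec hq v]
  simp only [matAct_apply, mulVec, dotProduct, projIn, Matrix.of_apply]
  simp [map_sum, mul_comm]

lemma projIn_idem {y : 𝔼} (hy : y ∈ (𝕏 c).target) :
    projIn c D y * projIn c D y = projIn c D y := by
  have hq := (𝕏 c).map_target hy
  rw [← (𝕏 c).right_inv hy]
  refine matAct_ext hq fun v ↦ ?_
  rw [← matAct_matAct, ← toChart_starProjection hq, ← toChart_starProjection hq]
  congr 1
  exact Submodule.starProjection_eq_self_iff.2 (by simp)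

lemma projIn_adj {y : 𝔼} (hy : y ∈ (𝕏 c).target) :
    metricIn c y * projIn c D y = (projIn c D y)ᵀ * metricIn c y := by
  have hq := (𝕏 c).map_target hy
  have hs : (metricIn c y)ᵀ = metricIn c y := gramMatrix_symm _ _
  rw [← (𝕏 c).right_inv hy] at hs ⊢
  ext i j
  have h1 := Submodule.inner_starProjection_left_eq_right (D ((𝕏 c).symm y))
    (coordVec c i ((𝕏 c).symm y)) (coordVec c j ((𝕏 c).symm y))
  rw [inner_eq_gramForm hq, inner_eq_gramForm hq, toChart_starProjection hq,
    toChart_starProjection hq, toChart_coordVec hq, toChart_coordVec hq, gramForm_eq_dotProduct,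
    gramForm_eq_dotProduct, ← metricIn_chart hq, ofLp_matAct, ofLp_matAct, mulVec_mulVec] at h1
  simp only [PiLp.ofLp_single, mulVec_single_one, single_one_dotProduct] at h1
  exact h1.symm

lemma projIn_compl (hDN : ∀ x, N x = (D x)ᗮ) {y : 𝔼} (hy : y ∈ (𝕏 c).target) :
    projIn c N y = 1 - projIn c D y := by
  have hq := (𝕏 c).map_target hy
  rw [← (𝕏 c).right_inv hy]
  refine matAct_ext hq fun v ↦ ?_
  rw [matAct_sub_left, matAct_one, ← toChart_starProjection hq, ← toChart_starProjection hq,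
    ← map_sub, hDN, Submodule.starProjection_orthogonal_val]

variable [IsContMDiffRiemannianBundle (𝓡 n) ∞ (EuclideanSpace ℝ (Fin n))
  (fun x : M ↦ TangentSpace (𝓡 n) x)]

/-- If the columns of `F` are the components of a local smooth frame of `D`, the projection has
matrix `F (Fᵀ G F)⁻¹ Fᵀ G`. The matrix `Fᵀ G F` is the Gram matrix of the frame, invertible by
linear independence. -/
lemma matSmoothAt_projIn {p : ℕ} (hD : IsSmoothDistribution p D) {y : 𝔼}
    (hy : y ∈ (𝕏 c).target) : MatSmoothAt (projIn c D) y := by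
  obtain ⟨U, hU, hxU, X, hX, hXD⟩ := hD ((𝕏 c).symm y)
  set F : 𝔼 → Matrix (Fin n) (Fin p) ℝ := fun z ↦ Matrix.of fun i j ↦ fieldIn c (X j) z i with hF
  have hFs : MatSmoothAt F y := by
    intro i j
    have h1 := (hX j).contMDiffAt (hU.mem_nhds hxU)
    have h2 := (fieldSmoothAt_iff ((𝕏 c).map_target hy)).1 h1
    rw [(𝕏 c).right_inv hy] at h2
    exact contDiffAt_euclidean.1 h2 i
  have hG := (isMetricOn_metricIn c).smooth y hy
  have hgram : ∀ z ∈ (𝕏 c).target, (F z)ᵀ * metricIn c z * F z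
      = Matrix.gram ℝ fun i ↦ X i ((𝕏 c).symm z) := by
    intro z hz
    ext i j
    rw [Matrix.gram_apply, inner_eq_gramForm ((𝕏 c).map_target hz), gramForm_eq_dotProduct,
      Matrix.mul_assoc]
    simp only [Matrix.mul_apply, dotProduct, mulVec]
    rfl
  have hdet : ∀ z ∈ (𝕏 c).target, (𝕏 c).symm z ∈ U →
      ((F z)ᵀ * metricIn c z * F z).det ≠ 0 := by
    intro z hz hzU
    rw [hgram z hz]
    exact Matrix.det_gram_ne_zero_iff_linearIndependent.2 (hXD _ hzU).1
  have hev : ∀ᶠ z in nhds y, z ∈ (𝕏 c).target ∧ (𝕏 c).symm z ∈ U :=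
    Filter.Eventually.and ((𝕏 c).open_target.mem_nhds hy)
      (((𝕏 c).continuousAt_symm hy).eventually_mem (hU.mem_nhds hxU))
  have hS := (hFs.transpose.mul hG).mul hFs
  refine MatSmoothAt.congr ((hFs.mul (hS.inv (hdet y hy hxU))).mul (hFs.transpose.mul hG)) ?_
  filter_upwards [hev] with z ⟨hz, hzU⟩
  have hq := (𝕏 c).map_target hz
  have key : ∀ v : TangentSpace (𝓡 n) ((𝕏 c).symm z), toChart c _ ((D _).starProjection v)
      = matAct (F z * ((F z)ᵀ * metricIn c z * F z)⁻¹ * ((F z)ᵀ * metricIn c z))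
        (toChart c _ v) := by
    intro v
    set a : Fin p → ℝ := ((F z)ᵀ * metricIn c z * F z)⁻¹ *ᵥ
      (((F z)ᵀ * metricIn c z) *ᵥ ⇑(toChart c _ v))
    set w : TangentSpace (𝓡 n) ((𝕏 c).symm z) := ∑ i, a i • X i ((𝕏 c).symm z) with hw
    have hwc : toChart c _ w = WithLp.toLp 2 (F z *ᵥ a) := by
      ext i
      simp only [hw, map_sum, map_smul, mulVec, dotProduct, hF, Matrix.of_apply, fieldIn]
      simp [mul_comm]
    -- The vector `w` lies in the span of the frame, and the choice of `a` makes `v - w` orthogonal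
    -- to every frame vector.
    have hpw : (D ((𝕏 c).symm z)).starProjection v = w := by
      refine Submodule.eq_starProjection_of_mem_of_inner_eq_zero ?_ ?_
      · rw [← (hXD _ hzU).2]
        exact Submodule.sum_mem _ fun i _ ↦ Submodule.smul_mem _ _ (Submodule.subset_span ⟨i, rfl⟩)
      · intro u hu
        rw [← (hXD _ hzU).2] at hu
        induction hu using Submodule.span_induction with
        | mem u hu =>
          obtain ⟨i, rfl⟩ := hu
          have e1 : ∀ b, inner ℝ (X i ((𝕏 c).symm z)) b
              = (((F z)ᵀ * metricIn c z) *ᵥ ⇑(toChart c _ b)) i := by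
            intro b
            rw [inner_eq_gramForm hq, gramForm_eq_dotProduct, ← mulVec_mulVec]
            rfl
          rw [real_inner_comm, inner_sub_right, e1, e1, hwc, mulVec_mulVec, mulVec_mulVec,
            Matrix.mul_nonsing_inv _ (hdet z hz hzU).isUnit, one_mulVec, sub_self]
        | zero => simp
        | add a b _ _ ha hb => rw [inner_add_right, ha, hb, add_zero]
        | smul r a _ ha => rw [inner_smul_right, ha, mul_zero]
    rw [hpw, hwc]
    simp only [a, mulVec_mulVec, matAct, Matrix.mul_assoc]
  conv_lhs => rw [← (𝕏 c).right_inv hz]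
  refine matAct_ext hq fun v ↦ ?_
  rw [← key, ← toChart_starProjection hq]

lemma isProjOn_projIn {p : ℕ} (hD : IsSmoothDistribution p D) (c : M) :
    IsProjOn (metricIn c) (projIn c D) (𝕏 c).target where
  smooth _ hy := matSmoothAt_projIn hD hy
  idem _ hy := projIn_idem hy
  adj _ hy := projIn_adj hy

end Projections

/-! ### The second symmetric function as a difference of traces. -/

section SigmaTwo

open Matrix

lemma two_mul_sigmaTwo {k : ℕ} (A : Matrix (Fin k) (Fin k) ℝ) :
    2 * sigmaTwo A = A.trace ^ 2 - (A * A).trace := by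
  have h : ∀ i, ∑ j ∈ Finset.univ.filter (fun j ↦ i < j), (A i i * A j j - A i j * A j i)
      = ∑ j, if i < j then (A i i * A j j - A i j * A j i) else 0 := fun i ↦
    Finset.sum_filter _ _
  -- The minors are symmetric in `i` and `j`, so summing over `j < i` gives `σ₂` again. Adding both
  -- halves gives the sum over all pairs, the diagonal minors being zero.
  have h2 : sigmaTwo A = ∑ i, ∑ j, if j < i then (A i i * A j j - A i j * A j i) else 0 := by
    rw [sigmaTwo, Finset.sum_congr rfl fun i _ ↦ h i, Finset.sum_comm]
    refine Finset.sum_congr rfl fun i _ ↦ Finset.sum_congr rfl fun j _ ↦ ?_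
    split_ifs <;> ring
  have h1 : sigmaTwo A = ∑ i, ∑ j, if i < j then (A i i * A j j - A i j * A j i) else 0 :=
    Finset.sum_congr rfl fun i _ ↦ h i
  rw [two_mul]
  conv_lhs => enter [1]; rw [h1]
  rw [h2, ← Finset.sum_add_distrib, sq]
  simp only [Matrix.trace, Matrix.diag, Matrix.mul_apply, Finset.sum_mul_sum]
  rw [← Finset.sum_sub_distrib]
  refine Finset.sum_congr rfl fun i _ ↦ ?_
  rw [← Finset.sum_add_distrib, ← Finset.sum_sub_distrib]
  refine Finset.sum_congr rfl fun j _ ↦ ?_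
  rcases lt_trichotomy i j with h | h | h
  · simp [h, h.not_gt]
  · subst h; simp
  · simp [h, h.not_gt]

end SigmaTwo

/-! ### The co-nullity tensor as the covariant derivative of a projection. -/

noncomputable section Conullity

open Matrix

variable {n : ℕ} {M : Type*} [TopologicalSpace M] [ChartedSpace (EuclideanSpace ℝ (Fin n)) M]
  [IsManifold (𝓡 n) ∞ M] [RiemannianBundle (fun x : M ↦ TangentSpace (𝓡 n) x)]
  [IsContMDiffRiemannianBundle (𝓡 n) ∞ (EuclideanSpace ℝ (Fin n))
    (fun x : M ↦ TangentSpace (𝓡 n) x)]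

local notation "𝔼" => EuclideanSpace ℝ (Fin n)
local notation "𝕏" => chartAt (EuclideanSpace ℝ (Fin n))

variable {c q : M} {D N : Π x : M, Submodule ℝ (TangentSpace (𝓡 n) x)} {p : ℕ}

/-- The covariant derivative `∇ₖ P` of the field of projections to a distribution, in a chart. -/
def nablaProj (c : M) (D : Π x : M, Submodule ℝ (TangentSpace (𝓡 n) x)) (k : Fin n) (q : M) :
    Matrix (Fin n) (Fin n) ℝ :=
  covMat (metricIn c) k (projIn c D) (𝕏 c q)

lemma fieldSmoothAt_starProjection (hD : IsSmoothDistribution p D)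
    {Y : Π q : M, TangentSpace (𝓡 n) q} (hY : FieldSmoothAt Y q) :
    FieldSmoothAt (fun r ↦ (D r).starProjection (Y r)) q := by
  have hq : q ∈ (𝕏 q).source := mem_chart_source _ q
  rw [fieldSmoothAt_iff hq] at hY ⊢
  refine (ContDiffAt.matAct (matSmoothAt_projIn hD ((𝕏 q).map_source hq)) hY).congr_of_eventuallyEq ?_
  filter_upwards [(𝕏 q).open_target.mem_nhds ((𝕏 q).map_source hq)] with z hz
  rw [fieldIn, toChart_starProjection ((𝕏 q).map_target hz), (𝕏 q).right_inv hz]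
  rfl

lemma fieldSmoothAt_sectionThrough (hD : IsSmoothDistribution p D) (v : TangentSpace (𝓡 n) q) :
    FieldSmoothAt (sectionThrough D v) q :=
  fieldSmoothAt_starProjection hD (fieldSmoothAt_extend v (mem_chart_source _ q))

omit [IsContMDiffRiemannianBundle (𝓡 n) ∞ (EuclideanSpace ℝ (Fin n))
    (fun x : M ↦ TangentSpace (𝓡 n) x)] in
lemma sectionThrough_self {v : TangentSpace (𝓡 n) q} (hv : v ∈ D q) : sectionThrough D v q = v := by
  rw [sectionThrough, FiberBundle.extend_apply_self, Submodule.starProjection_eq_self_iff.2 hv]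

/-- The component of the derivative of a section of a distribution normal to the distribution. -/
lemma toChart_normal_leviCivita (hD : IsSmoothDistribution p D) (hDN : ∀ x, N x = (D x)ᗮ)
    (hq : q ∈ (𝕏 c).source) {s : Π r : M, TangentSpace (𝓡 n) r}
    (hs : DifferentiableAt ℝ (fieldIn c s) (𝕏 c q)) (hsD : ∀ r, s r ∈ D r)
    (u : TangentSpace (𝓡 n) q) :
    toChart c q ((N q).starProjection (leviCivita s q u))
      = ∑ k, toChart c q u k • matAct (nablaProj c D k q) (toChart c q (s q)) := by
  rw [toChart_starProjection hq, toChart_leviCivita hq hs, projIn_compl hDN ((𝕏 c).map_source hq),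
    covVec_of_section (isMetricOn_metricIn c) (isProjOn_projIn hD c) ((𝕏 c).map_source hq) hs _ _,
    fieldIn_chart s hq]
  · rfl
  · filter_upwards [(𝕏 c).open_target.mem_nhds ((𝕏 c).map_source hq)] with z hz
    have h := toChart_starProjection (D := D) ((𝕏 c).map_target hz) (s ((𝕏 c).symm z))
    rw [Submodule.starProjection_eq_self_iff.2 (hsD _), (𝕏 c).right_inv hz] at h
    exact h

/-- Tensoriality: the derivatives of the chosen extension of `ξ` drop out, and only `∇P` applied to
the value of `ξ` at `q` remains. -/
lemma toChart_conullity (hN : IsSmoothDistribution p N) (hDN : ∀ x, D x = (N x)ᗮ)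
    (hq : q ∈ (𝕏 c).source) {ξ : TangentSpace (𝓡 n) q} (hξ : ξ ∈ N q)
    (u : TangentSpace (𝓡 n) q) :
    toChart c q (conullity D N q ξ u)
      = ∑ k, toChart c q u k • matAct (nablaProj c N k q) (toChart c q ξ) := by
  have hs := (fieldSmoothAt_iff hq).1 (fieldSmoothAt_sectionThrough hN ξ)
  rw [conullity, toChart_normal_leviCivita hN hDN hq (hs.differentiableAt (by simp))
    (fun r ↦ by simp [sectionThrough]), sectionThrough_self hξ]

/-- The matrix whose columns are the components of an orthonormal basis of a distribution. -/
def onbMat (c : M) (D : Π x : M, Submodule ℝ (TangentSpace (𝓡 n) x)) (q : M) :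
    Matrix (Fin n) (Fin (Module.finrank ℝ (D q))) ℝ :=
  Matrix.of fun i a ↦ toChart c q (onb D q a) i

omit [IsContMDiffRiemannianBundle (𝓡 n) ∞ (EuclideanSpace ℝ (Fin n))
    (fun x : M ↦ TangentSpace (𝓡 n) x)]

omit [IsManifold (𝓡 n) ∞ M] in
lemma onb_mem (a : Fin (Module.finrank ℝ (D q))) : onb D q a ∈ D q :=
  (stdOrthonormalBasis ℝ (D q) a).2

/-- The expansion of the projection as `∑ ⟨e_a, ·⟩ e_a`. The arbitrary choice of orthonormal basis
disappears from contracted expressions in this way. -/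
lemma onbMat_mul_transpose_mul_metric (hq : q ∈ (𝕏 c).source) :
    onbMat c D q * (onbMat c D q)ᵀ * metricIn c (𝕏 c q) = projIn c D (𝕏 c q) := by
  refine matAct_ext hq fun v ↦ ?_
  rw [← toChart_starProjection hq, (stdOrthonormalBasis ℝ (D q)).starProjection_eq_sum_rankOne]
  have h : ∀ a, inner ℝ (onb D q a) v
      = (((onbMat c D q)ᵀ * metricIn c (𝕏 c q)) *ᵥ ⇑(toChart c q v)) a := by
    intro a
    rw [inner_eq_gramForm hq, gramForm_eq_dotProduct, ← mulVec_mulVec, metricIn_chart hq]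
    rfl
  ext i
  rw [matAct_apply, Matrix.mul_assoc, ← mulVec_mulVec]
  simp only [_root_.sum_apply, map_sum, InnerProductSpace.rankOne_apply, map_smul]
  symm
  change (∑ a, inner ℝ (onb D q a) v • toChart c q (onb D q a)) i = _
  simp only [h, mulVec, dotProduct, onbMat]
  simp [mul_comm]

lemma isUnit_det_metricIn (hq : q ∈ (𝕏 c).source) : IsUnit (metricIn (n := n) c (𝕏 c q)).det := by
  rw [metricIn_chart hq]; exact (gramMatrix_posDef hq).det_pos.ne'.isUnit

lemma onbMat_mul_transpose (hq : q ∈ (𝕏 c).source) :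
    onbMat c D q * (onbMat c D q)ᵀ = projIn c D (𝕏 c q) * (metricIn c (𝕏 c q))⁻¹ := by
  rw [← onbMat_mul_transpose_mul_metric hq,
    Matrix.mul_nonsing_inv_cancel_right _ _ (isUnit_det_metricIn hq)]

end Conullity

/-! ### Contractions behind the sums of second symmetric functions. -/

section SigmaTwoSum

open Matrix

variable {n d r : ℕ}

/-- Writing `2σ₂` as `(tr C)² - tr C²` and summing over `α` lets the frame matrices be multiplied
together, leaving contractions over coordinate indices only. -/
lemma two_mul_sum_sigmaTwo (C : Fin r → Matrix (Fin d) (Fin d) ℝ) (F : Matrix (Fin n) (Fin d) ℝ)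
    (X : Fin n → Matrix (Fin d) (Fin r) ℝ)
    (h : ∀ α i j, C α i j = ∑ k, F k i * X k j α) :
    2 * ∑ α, sigmaTwo (C α) = (diagSum fun k m ↦ F * X k * (F * X m)ᵀ)
      - diagSum fun k m ↦ F * X m * (F * X k)ᵀ := by
  have htr : ∀ α, (C α).trace = ∑ k, (F * X k) k α := by
    intro α
    simp only [Matrix.trace, Matrix.diag, h, Matrix.mul_apply]
    rw [Finset.sum_comm]
  have htr2 : ∀ α, (C α * C α).trace = ∑ k, ∑ m, (F * X m) k α * (F * X k) m α := by
    intro α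
    simp only [Matrix.trace, Matrix.diag, Matrix.mul_apply, h, Finset.sum_mul_sum]
    rw [Finset.sum_congr rfl fun i _ ↦ Finset.sum_comm, Finset.sum_comm]
    refine Finset.sum_congr rfl fun k _ ↦ ?_
    rw [Finset.sum_congr rfl fun i _ ↦ Finset.sum_comm, Finset.sum_comm]
    refine Finset.sum_congr rfl fun m _ ↦ Finset.sum_congr rfl fun i _ ↦
      Finset.sum_congr rfl fun j _ ↦ by ring
  rw [Finset.mul_sum, Finset.sum_congr rfl fun α _ ↦ two_mul_sigmaTwo _, Finset.sum_sub_distrib]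
  simp only [htr, htr2]
  congr 1
  · simp only [diagSum, Matrix.mul_apply (N := (F * X _)ᵀ), Matrix.transpose_apply, sq,
      Finset.sum_mul_sum]
    rw [Finset.sum_comm]
    exact Finset.sum_congr rfl fun k _ ↦ Finset.sum_comm
  · simp only [diagSum, Matrix.mul_apply (N := (F * X _)ᵀ), Matrix.transpose_apply]
    rw [Finset.sum_comm]
    exact Finset.sum_congr rfl fun k _ ↦ Finset.sum_comm

/-- Since `PAP = 0`, the middle factor `F Fᵀ = (1 - P)h` inserts a projection that `P A k` already
absorbs, and the outer `Pᵀ` is absorbed similarly. -/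
lemma proj_mul_mul_transpose {P h : Matrix (Fin n) (Fin n) ℝ} {A : Fin n → Matrix (Fin n) (Fin n) ℝ}
    {F : Matrix (Fin n) (Fin r) ℝ} (hPP : P * P = P) (hPA : ∀ k, A k = A k * P + P * A k)
    (hadj : ∀ k, h * (A k)ᵀ = A k * h) (hPadj : h * Pᵀ = P * h) (hF : F * Fᵀ = (1 - P) * h)
    (k m : Fin n) : P * A k * F * (P * A m * F)ᵀ = P * A k * A m * h := by
  have e1 : P * A k * F * (P * A m * F)ᵀ = P * A k * (F * Fᵀ) * (A m)ᵀ * Pᵀ := by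
    simp only [transpose_mul, Matrix.mul_assoc]
  have e2 : P * A k * ((1 - P) * h) * (A m)ᵀ * Pᵀ = P * A k * (1 - P) * A m * P * h := by
    linear_combination (norm := noncomm_ring) P * A k * (1 - P) * hadj m * Pᵀ
      + P * A k * (1 - P) * A m * hPadj
  have e3 : P * A k * (1 - P) = P * A k := by
    linear_combination (norm := noncomm_ring) P * hPA k + hPP * A k
  have e4 : A m * P = (1 - P) * A m := by
    linear_combination (norm := noncomm_ring) -hPA m
  rw [e1, hF, e2, e3, Matrix.mul_assoc (P * A k), e4, ← Matrix.mul_assoc, e3]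

end SigmaTwoSum

/-! ### The sums of `σ₂` in coordinates. -/

noncomputable section PointwiseFormulas

open Matrix

variable {n : ℕ} {M : Type*} [TopologicalSpace M] [ChartedSpace (EuclideanSpace ℝ (Fin n)) M]
  [IsManifold (𝓡 n) ∞ M] [RiemannianBundle (fun x : M ↦ TangentSpace (𝓡 n) x)]
  [IsContMDiffRiemannianBundle (𝓡 n) ∞ (EuclideanSpace ℝ (Fin n))
    (fun x : M ↦ TangentSpace (𝓡 n) x)]

local notation "𝔼" => EuclideanSpace ℝ (Fin n)
local notation "𝕏" => chartAt (EuclideanSpace ℝ (Fin n))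

variable {c q : M} {D N : Π x : M, Submodule ℝ (TangentSpace (𝓡 n) x)} {p : ℕ}

omit [IsManifold (𝓡 n) ∞ M] [IsContMDiffRiemannianBundle (𝓡 n) ∞ (EuclideanSpace ℝ (Fin n))
    (fun x : M ↦ TangentSpace (𝓡 n) x)] in
lemma eq_orthogonal_of_eq_orthogonal (h : ∀ x, N x = (D x)ᗮ) (x : M) : D x = (N x)ᗮ := by
  rw [h, Submodule.orthogonal_orthogonal]

lemma conullityMatrix_apply (hN : IsSmoothDistribution p N) (hDN : ∀ x, D x = (N x)ᗮ)
    (hq : q ∈ (𝕏 c).source) (α : Fin (Module.finrank ℝ (N q)))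
    (i j : Fin (Module.finrank ℝ (D q))) :
    conullityMatrix D N q (onb N q α) i j = ∑ k, onbMat c D q k i *
      ((onbMat c D q)ᵀ * metricIn c (𝕏 c q) * nablaProj c N k q * onbMat c N q) j α := by
  rw [conullityMatrix, Matrix.of_apply, real_inner_comm, inner_eq_gramForm hq,
    toChart_conullity hN hDN hq (onb_mem α), gramForm_eq_dotProduct, ← metricIn_chart hq]
  have e : (⇑(∑ k, toChart c q (onb D q i) k • matAct (nablaProj c N k q) (toChart c q (onb N q α))) :
      Fin n → ℝ) = ∑ k, onbMat c D q k i • (nablaProj c N k q *ᵥ (onbMat c N q)ᵀ α) := by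
    ext l
    simp only [WithLp.ofLp_sum, Finset.sum_apply, WithLp.ofLp_smul, Pi.smul_apply, ofLp_matAct]
    rfl
  rw [e, Matrix.mulVec_sum, dotProduct_sum]
  refine Finset.sum_congr rfl fun k _ ↦ ?_
  rw [mulVec_smul, dotProduct_smul, smul_eq_mul, mulVec_mulVec, Matrix.mul_assoc, Matrix.mul_assoc,
    ← Matrix.mul_assoc (metricIn c _)]
  rfl

/-- The coordinate expression of the sum of the second symmetric functions of the co-nullity
operators. -/
theorem sumSigmaTwo_eq (hN : IsSmoothDistribution p N) (hDN : ∀ x, D x = (N x)ᗮ)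
    (hq : q ∈ (𝕏 c).source) :
    2 * sumSigmaTwo D N q =
      (diagSum fun k m ↦ projIn c D (𝕏 c q) * nablaProj c N k q * nablaProj c N m q
        * (metricIn c (𝕏 c q))⁻¹)
      - diagSum fun k m ↦ projIn c D (𝕏 c q) * nablaProj c N m q * nablaProj c N k q
        * (metricIn c (𝕏 c q))⁻¹ := by
  have hy := (𝕏 c).map_source hq
  have hP' : projIn c N (𝕏 c q) = 1 - projIn c D (𝕏 c q) := by
    rw [projIn_compl hDN hy]; abel
  -- The bases of both distributions are eliminated: `D` through its projection, and `N` through the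
  -- product of its basis matrix with its transpose.
  have hWW : ∀ k m,
      onbMat c D q * ((onbMat c D q)ᵀ * metricIn c (𝕏 c q) * nablaProj c N k q * onbMat c N q)
        * (onbMat c D q * ((onbMat c D q)ᵀ * metricIn c (𝕏 c q) * nablaProj c N m q * onbMat c N q))ᵀ
      = projIn c D (𝕏 c q) * nablaProj c N k q * nablaProj c N m q * (metricIn c (𝕏 c q))⁻¹ := by
    intro k m
    have hW : ∀ k, onbMat c D q * ((onbMat c D q)ᵀ * metricIn c (𝕏 c q) * nablaProj c N k q
        * onbMat c N q) = projIn c D (𝕏 c q) * nablaProj c N k q * onbMat c N q := by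
      intro k
      rw [← onbMat_mul_transpose_mul_metric hq]
      simp only [Matrix.mul_assoc]
    have h := (isProjOn_projIn hN c).covMat_idem (isMetricOn_metricIn c) hy
    have hadj := (isProjOn_projIn hN c).covMat_adj (isMetricOn_metricIn c) hy
    have hPadj := (isProjOn_projIn hN c).inv_adj (isMetricOn_metricIn c) hy
    rw [hP'] at h hPadj
    rw [hW, hW]
    refine proj_mul_mul_transpose (projIn_idem hy) (fun k ↦ ?_) hadj ?_ ?_ k m
    · have := h k
      change nablaProj c N k q = _ at this
      change nablaProj c N k q = _ at this
      linear_combination (norm := (simp only [nablaProj]; noncomm_ring)) -this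
    · simp only [transpose_sub, transpose_one] at hPadj
      linear_combination (norm := noncomm_ring) -hPadj
    · rw [onbMat_mul_transpose hq, hP']
  rw [sumSigmaTwo, two_mul_sum_sigmaTwo _ (onbMat c D q)
    (fun k ↦ (onbMat c D q)ᵀ * metricIn c (𝕏 c q) * nablaProj c N k q * onbMat c N q)
    fun α i j ↦ conullityMatrix_apply hN hDN hq α i j]
  simp only [hWW]

end PointwiseFormulas

/-! ### Curvature and mixed scalar curvature in coordinates. -/

noncomputable section MixedCurvature

open Matrix

variable {n : ℕ} {M : Type*} [TopologicalSpace M] [ChartedSpace (EuclideanSpace ℝ (Fin n)) M]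
  [IsManifold (𝓡 n) ∞ M]

local notation "𝔼" => EuclideanSpace ℝ (Fin n)
local notation "𝕏" => chartAt (EuclideanSpace ℝ (Fin n))

lemma lieBracketWithin_eq_zero_of_eventuallyEq_const {E : Type*} [NormedAddCommGroup E]
    [NormedSpace ℝ E] {f g : E → E} {a b y : E} (hf : f =ᶠ[nhds y] fun _ ↦ a)
    (hg : g =ᶠ[nhds y] fun _ ↦ b) (s : Set E) : VectorField.lieBracketWithin ℝ f g s y = 0 := by
  rw [VectorField.lieBracketWithin, hf.fderivWithin_eq_of_nhds, hg.fderivWithin_eq_of_nhds]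
  simp

/-- Both fields have constant components in the chart at `q`, hence commute. This removes the
bracket term from the curvature. -/
lemma mlieBracket_extend_extend {q : M} (u v : TangentSpace (𝓡 n) q) :
    VectorField.mlieBracket (𝓡 n) (FiberBundle.extend 𝔼 u) (FiberBundle.extend 𝔼 v) q = 0 := by
  have key : ∀ w : TangentSpace (𝓡 n) q, ∀ y ∈ (𝕏 q).target,
      VectorField.mpullbackWithin 𝓘(ℝ, 𝔼) (𝓡 n) (extChartAt (𝓡 n) q).symm
        (FiberBundle.extend 𝔼 w) (Set.range (𝓡 n)) y = toChart q q w := by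
    intro w y hy
    have hy' : y ∈ (extChartAt (𝓡 n) q).target := by simpa using hy
    have hq := (𝕏 q).map_target hy
    refine ((isInvertible_mfderivWithin_extChartAt_symm hy').inverse_apply_eq).2 ?_
    have h1 := TangentBundle.symmL_trivializationAt (I := 𝓡 n) hq
    have h2 := fieldIn_extend w hy
    have h3 : FiberBundle.extend 𝔼 w ((𝕏 q).symm y) = ofChart q _ (toChart q q w) := by
      rw [← h2, fieldIn, ofChart_toChart hq]
    have h4 : extChartAt (𝓡 n) q ((𝕏 q).symm y) = y := (𝕏 q).right_inv hy
    rw [h4] at h1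
    refine h3.trans ?_
    rw [ofChart, h1]
    rfl
  have hev : ∀ w : TangentSpace (𝓡 n) q,
      VectorField.mpullbackWithin 𝓘(ℝ, 𝔼) (𝓡 n) (extChartAt (𝓡 n) q).symm
        (FiberBundle.extend 𝔼 w) (Set.range (𝓡 n))
      =ᶠ[nhds (extChartAt (𝓡 n) q q)] fun _ ↦ toChart q q w := fun w ↦ by
    filter_upwards [(𝕏 q).open_target.mem_nhds ((𝕏 q).map_source (mem_chart_source _ q))]
      with y hy using key w y hy
  exact (congr_arg _ (lieBracketWithin_eq_zero_of_eventuallyEq_const (hev u) (hev v) _)).trans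
    (map_zero _)

variable [RiemannianBundle (fun x : M ↦ TangentSpace (𝓡 n) x)]
  [IsContMDiffRiemannianBundle (𝓡 n) ∞ (EuclideanSpace ℝ (Fin n))
    (fun x : M ↦ TangentSpace (𝓡 n) x)]

/-- For constant components, the inner derivative is `∑ vˡ Γ_l w` near `q`; a second derivative
gives `∂ₖΓ_l + Γₖ Γ_l`. -/
lemma toChart_leviCivita_leviCivita_extend {q : M} (u v w : TangentSpace (𝓡 n) q) :
    toChart q q (leviCivita (fun r ↦ leviCivita (FiberBundle.extend 𝔼 w) r
        (FiberBundle.extend 𝔼 v r)) q u)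
      = ∑ k, ∑ l, (toChart q q u k * toChart q q v l) •
        matAct (matDeriv k (chrisMat (metricIn q) l) (𝕏 q q)
          + chrisMat (metricIn q) k (𝕏 q q) * chrisMat (metricIn q) l (𝕏 q q)) (toChart q q w) := by
  have hq := mem_chart_source 𝔼 q
  have hev : fieldIn q (fun r ↦ leviCivita (FiberBundle.extend 𝔼 w) r (FiberBundle.extend 𝔼 v r))
      =ᶠ[nhds (𝕏 q q)] fun y ↦
        ∑ l, toChart q q v l • matAct (chrisMat (metricIn q) l y) (toChart q q w) := by
    filter_upwards [(𝕏 q).open_target.mem_nhds ((𝕏 q).map_source hq)] with y hy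
    have hy' := (𝕏 q).map_target hy
    have hc : fieldIn q (FiberBundle.extend 𝔼 w) =ᶠ[nhds y] fun _ ↦ toChart q q w := by
      filter_upwards [(𝕏 q).open_target.mem_nhds hy] with z hz using fieldIn_extend w hz
    rw [fieldIn, toChart_leviCivita hy', (𝕏 q).right_inv hy, covVec, hc.fderiv_eq, chrisBil_eq_sum,
      fieldIn_extend w hy]
    · have : toChart q ((𝕏 q).symm y) (FiberBundle.extend 𝔼 v ((𝕏 q).symm y)) = toChart q q v :=
        fieldIn_extend v hy
      rw [this]
      simp
    · rw [(𝕏 q).right_inv hy]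
      exact hc.differentiableAt_iff.2 (by fun_prop)
  have hsm : ∀ l, ContDiffAt ℝ ∞ (fun y ↦ matAct (chrisMat (metricIn q) l y) (toChart q q w))
      (𝕏 q q) := fun l ↦
    ContDiffAt.matAct ((isMetricOn_metricIn q).smooth_chrisMat ((𝕏 q).map_source hq) l)
      contDiffAt_const
  have hd : ∀ l ∈ Finset.univ, DifferentiableAt ℝ (fun y ↦ toChart q q v l •
      matAct (chrisMat (metricIn q) l y) (toChart q q w)) (𝕏 q q) := fun l _ ↦
    ((hsm l).differentiableAt (by simp)).fun_const_smul _
  rw [toChart_leviCivita hq (hev.differentiableAt_iff.2 (DifferentiableAt.fun_sum hd)), covVec,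
    hev.fderiv_eq, hev.self_of_nhds, fderiv_fun_sum hd, chrisBil_eq_sum, _root_.sum_apply]
  have e1 : ∀ l, fderiv ℝ (fun y ↦ toChart q q v l •
      matAct (chrisMat (metricIn q) l y) (toChart q q w)) (𝕏 q q) (toChart q q u)
      = ∑ k, (toChart q q u k * toChart q q v l) •
        matAct (matDeriv k (chrisMat (metricIn q) l) (𝕏 q q)) (toChart q q w) := by
    intro l
    rw [fderiv_fun_const_smul ((hsm l).differentiableAt (by simp)), _root_.smul_apply,
      fderiv_matAct ((isMetricOn_metricIn q).smooth_chrisMat ((𝕏 q).map_source hq) l)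
        (by fun_prop)]
    have h0 : ∀ X : Matrix (Fin n) (Fin n) ℝ, matAct X 0 = 0 := fun X ↦ by simp [matAct]
    simp [h0, Finset.smul_sum, smul_smul, mul_comm]
  simp only [e1]
  rw [Finset.sum_comm, ← Finset.sum_add_distrib]
  refine Finset.sum_congr rfl fun k _ ↦ ?_
  rw [matAct_sum, Finset.smul_sum, ← Finset.sum_add_distrib]
  refine Finset.sum_congr rfl fun l _ ↦ ?_
  rw [matAct_add_left, smul_add, matAct_smul, matAct_matAct, smul_smul]

lemma toChart_curvature {q : M} (u v w : TangentSpace (𝓡 n) q) :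
    toChart q q (curvature q u v w) = ∑ k, ∑ l, (toChart q q u k * toChart q q v l) •
        matAct (curvMat (metricIn q) k l (𝕏 q q)) (toChart q q w) := by
  simp only [curvature]
  rw [mlieBracket_extend_extend, map_zero, sub_zero, map_sub,
    toChart_leviCivita_leviCivita_extend, toChart_leviCivita_leviCivita_extend]
  conv_lhs => enter [2]; rw [Finset.sum_comm]
  rw [← Finset.sum_sub_distrib]
  refine Finset.sum_congr rfl fun k _ ↦ ?_
  rw [← Finset.sum_sub_distrib]
  refine Finset.sum_congr rfl fun l _ ↦ ?_
  rw [mul_comm (toChart q q v l), ← smul_sub, ← matAct_sub_left, curvMat]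
  congr 2
  abel

variable {D N : Π x : M, Submodule ℝ (TangentSpace (𝓡 n) x)} {p : ℕ}

/-- The coordinate expression of the mixed scalar curvature. -/
theorem mixedScalarCurvature_eq (hDN : ∀ x, N x = (D x)ᗮ) (q : M) :
    mixedScalarCurvature D N q = diagSum fun k m ↦ projIn q D (𝕏 q q)
      * curvMat (metricIn q) k m (𝕏 q q) * (1 - projIn q D (𝕏 q q)) * (metricIn q (𝕏 q q))⁻¹ := by
  have hq := mem_chart_source 𝔼 q
  have h1 : ∀ i α, inner ℝ (curvature q (onb D q i) (onb N q α) (onb N q α)) (onb D q i)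
      = ∑ k, ∑ l, onbMat q D q k i * onbMat q N q l α *
        ((onbMat q D q)ᵀ * metricIn q (𝕏 q q) * curvMat (metricIn q) k l (𝕏 q q)
          * onbMat q N q) i α := by
    intro i α
    rw [real_inner_comm, inner_eq_gramForm hq, toChart_curvature, gramForm_eq_dotProduct,
      ← metricIn_chart hq]
    have e : (⇑(∑ k, ∑ l, (toChart q q (onb D q i) k * toChart q q (onb N q α) l) •
        matAct (curvMat (metricIn q) k l (𝕏 q q)) (toChart q q (onb N q α))) : Fin n → ℝ)
        = ∑ k, ∑ l, (onbMat q D q k i * onbMat q N q l α) •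
          (curvMat (metricIn q) k l (𝕏 q q) *ᵥ (onbMat q N q)ᵀ α) := by
      ext j
      simp only [WithLp.ofLp_sum, Finset.sum_apply, WithLp.ofLp_smul, Pi.smul_apply, ofLp_matAct]
      rfl
    rw [e]
    simp only [Matrix.mulVec_sum, dotProduct_sum]
    refine Finset.sum_congr rfl fun k _ ↦ Finset.sum_congr rfl fun l _ ↦ ?_
    rw [mulVec_smul, dotProduct_smul, smul_eq_mul, mulVec_mulVec, Matrix.mul_assoc,
      Matrix.mul_assoc, ← Matrix.mul_assoc (metricIn q _)]
    rfl
  -- Both bases are reinserted: the projections to `D` and to `N = Dᗮ` are products of basis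
  -- matrices, so the contraction unfolds into the sum over `i` and `α`.
  have h2 : ∀ k l, projIn q D (𝕏 q q) * curvMat (metricIn q) k l (𝕏 q q)
      * (1 - projIn q D (𝕏 q q)) * (metricIn q (𝕏 q q))⁻¹
      = onbMat q D q * ((onbMat q D q)ᵀ * metricIn q (𝕏 q q) * curvMat (metricIn q) k l (𝕏 q q)
          * onbMat q N q) * (onbMat q N q)ᵀ := by
    intro k l
    rw [← projIn_compl hDN ((𝕏 q).map_source hq), Matrix.mul_assoc _ (projIn q N _),
      ← onbMat_mul_transpose hq, ← onbMat_mul_transpose_mul_metric (D := D) hq]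
    simp only [Matrix.mul_assoc]
  rw [mixedScalarCurvature]
  simp only [h1, h2, diagSum]
  have h3 : ∀ k l, (onbMat q D q * ((onbMat q D q)ᵀ * metricIn q (𝕏 q q)
      * curvMat (metricIn q) k l (𝕏 q q) * onbMat q N q) * (onbMat q N q)ᵀ) k l
      = ∑ i, ∑ α, onbMat q D q k i * onbMat q N q l α *
        ((onbMat q D q)ᵀ * metricIn q (𝕏 q q) * curvMat (metricIn q) k l (𝕏 q q)
          * onbMat q N q) i α := by
    intro k l
    rw [Matrix.mul_apply, Finset.sum_comm]
    refine Finset.sum_congr rfl fun α _ ↦ ?_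
    rw [Matrix.mul_apply, Finset.sum_mul]
    refine Finset.sum_congr rfl fun i _ ↦ ?_
    rw [Matrix.transpose_apply]; ring
  simp only [h3]
  rw [Finset.sum_congr rfl fun i _ ↦ Finset.sum_comm, Finset.sum_comm]
  refine Finset.sum_congr rfl fun k _ ↦ ?_
  rw [Finset.sum_congr rfl fun i _ ↦ Finset.sum_comm, Finset.sum_comm]

end MixedCurvature

/-! ### The mean curvature field and its divergence. -/

noncomputable section MixedField

open Matrix

variable {n : ℕ} {M : Type*} [TopologicalSpace M] [ChartedSpace (EuclideanSpace ℝ (Fin n)) M]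
  [IsManifold (𝓡 n) ∞ M]

local notation "𝔼" => EuclideanSpace ℝ (Fin n)
local notation "𝕏" => chartAt (EuclideanSpace ℝ (Fin n))

/-- The components of a tangent vector in the chart at `c`, as a linear equivalence. -/
def toChartEquiv {c q : M} (hq : q ∈ (𝕏 c).source) : TangentSpace (𝓡 n) q ≃ₗ[ℝ] 𝔼 where
  toFun := toChart (n := n) c q
  map_add' := map_add _
  map_smul' := map_smul _
  invFun := ofChart c q
  left_inv v := ofChart_toChart hq v
  right_inv v := toChart_ofChart hq v

variable [RiemannianBundle (fun x : M ↦ TangentSpace (𝓡 n) x)]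

/-- The divergence of a vector field. -/
def fieldDiv (Y : Π q : M, TangentSpace (𝓡 n) q) (q : M) : ℝ :=
  LinearMap.trace ℝ (TangentSpace (𝓡 n) q) (leviCivita Y q).toLinearMap

/-- The sum of the mean curvature vectors of a distribution and of its orthogonal complement. -/
def mixedField (D N : Π x : M, Submodule ℝ (TangentSpace (𝓡 n) x)) (q : M) :
    TangentSpace (𝓡 n) q :=
  ∑ i, conullity N D q (onb D q i) (onb D q i) + ∑ α, conullity D N q (onb N q α) (onb N q α)

variable [IsContMDiffRiemannianBundle (𝓡 n) ∞ (EuclideanSpace ℝ (Fin n))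
  (fun x : M ↦ TangentSpace (𝓡 n) x)]

variable {c q : M} {D N : Π x : M, Submodule ℝ (TangentSpace (𝓡 n) x)} {p p' : ℕ}

/-- The trace is invariant under conjugation by the chart isomorphism, so any chart may be used. -/
lemma fieldDiv_eq {Y : Π q : M, TangentSpace (𝓡 n) q} (hq : q ∈ (𝕏 c).source)
    (hY : DifferentiableAt ℝ (fieldIn c Y) (𝕏 c q)) :
    fieldDiv Y q = ∑ k, covVec (metricIn c) (fieldIn c Y) (𝕏 c q) (EuclideanSpace.single k 1) k := by
  rw [fieldDiv, ← LinearMap.trace_conj' _ (toChartEquiv hq),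
    LinearMap.trace_eq_sum_inner _ (EuclideanSpace.basisFun (Fin n) ℝ)]
  refine Finset.sum_congr rfl fun k _ ↦ ?_
  have h : (toChartEquiv hq).conj (leviCivita Y q).toLinearMap (EuclideanSpace.single k 1)
      = covVec (metricIn c) (fieldIn c Y) (𝕏 c q) (EuclideanSpace.single k 1) := by
    rw [LinearEquiv.conj_apply_apply]
    have := toChart_leviCivita hq hY (ofChart c q (EuclideanSpace.single k 1))
    rw [toChart_ofChart hq] at this
    exact this
  rw [EuclideanSpace.basisFun_apply, h, EuclideanSpace.inner_single_left]
  simp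

lemma sum_toChart_conullity (hD : IsSmoothDistribution p D) (hDN : ∀ x, N x = (D x)ᗮ)
    (hq : q ∈ (𝕏 c).source) (j : Fin n) :
    toChart c q (∑ i, conullity N D q (onb D q i) (onb D q i)) j
      = ∑ m, (nablaProj c D m q * projIn c D (𝕏 c q) * (metricIn c (𝕏 c q))⁻¹) j m := by
  have h1 : ∀ i, toChart c q (conullity N D q (onb D q i) (onb D q i)) j
      = ∑ m, (nablaProj c D m q * onbMat c D q) j i * onbMat c D q m i := by
    intro i
    rw [toChart_conullity hD hDN hq (onb_mem i)]
    simp only [WithLp.ofLp_sum, Finset.sum_apply, WithLp.ofLp_smul, Pi.smul_apply, ofLp_matAct]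
    refine Finset.sum_congr rfl fun m _ ↦ ?_
    rw [smul_eq_mul, mul_comm]
    rfl
  rw [map_sum, WithLp.ofLp_sum, Finset.sum_apply, Finset.sum_congr rfl fun i _ ↦ h1 i,
    Finset.sum_comm]
  refine Finset.sum_congr rfl fun m _ ↦ ?_
  rw [Matrix.mul_assoc, ← onbMat_mul_transpose hq, ← Matrix.mul_assoc]
  rfl

lemma nablaProj_compl (hDN : ∀ x, N x = (D x)ᗮ) (hD : IsSmoothDistribution p D)
    (hq : q ∈ (𝕏 c).source) (k : Fin n) :
    nablaProj c N k q = -nablaProj c D k q := by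
  have hy := (𝕏 c).map_source hq
  have hs := (isProjOn_projIn hD c).smooth _ hy
  rw [nablaProj, (isMetricOn_metricIn c).covMat_congr hy k fun z hz ↦ projIn_compl hDN hz, covMat,
    matDeriv_sub k (.const 1) hs, matDeriv_const, nablaProj, covMat]
  noncomm_ring

/-- The two mean curvature vectors contribute `AP` and `-A(1 - P)`, and `A = AP + PA` rewrites the
sum as `(1 - 2P)A`. -/
lemma fieldIn_mixedField (hD : IsSmoothDistribution p D) (hN : IsSmoothDistribution p' N)
    (hDN : ∀ x, N x = (D x)ᗮ) {y : 𝔼} (hy : y ∈ (𝕏 c).target) (j : Fin n) :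
    fieldIn c (mixedField D N) y j = ∑ m, mixedMat (metricIn c) (projIn c D) m y j m := by
  have hq := (𝕏 c).map_target hy
  have hidem := (isProjOn_projIn hD c).covMat_idem (isMetricOn_metricIn c) hy
  rw [fieldIn, mixedField, map_add, PiLp.add_apply, sum_toChart_conullity hD hDN hq,
    sum_toChart_conullity hN (eq_orthogonal_of_eq_orthogonal hDN) hq, ← Finset.sum_add_distrib]
  refine Finset.sum_congr rfl fun m _ ↦ ?_
  rw [nablaProj_compl hDN hD hq, ← Matrix.add_apply, (𝕏 c).right_inv hy, projIn_compl hDN hy,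
    nablaProj, (𝕏 c).right_inv hy, mixedMat]
  have h : covMat (metricIn c) m (projIn c D) y * projIn c D y * (metricIn c y)⁻¹
      + -covMat (metricIn c) m (projIn c D) y * (1 - projIn c D y) * (metricIn c y)⁻¹
      = (1 - (projIn c D y + projIn c D y)) * covMat (metricIn c) m (projIn c D) y
        * (metricIn c y)⁻¹ := by
    linear_combination (norm := noncomm_ring) -hidem m * (metricIn c y)⁻¹
      - hidem m * (metricIn c y)⁻¹
  exact congr_fun₂ h j m

/-- The bases in the definition are chosen independently at each point; smoothness comes from the
coordinate expression, where they no longer appear. -/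
lemma fieldSmoothAt_mixedField (hD : IsSmoothDistribution p D) (hN : IsSmoothDistribution p' N)
    (hDN : ∀ x, N x = (D x)ᗮ) (q : M) : FieldSmoothAt (mixedField D N) q := by
  have hq := mem_chart_source 𝔼 q
  have hy := (𝕏 q).map_source hq
  rw [fieldSmoothAt_iff hq, contDiffAt_euclidean]
  intro j
  refine (ContDiffAt.sum (s := Finset.univ) (f := fun m y ↦
    mixedMat (metricIn q) (projIn q D) m y j m) fun m _ ↦
      (isProjOn_projIn hD q).smooth_mixedMat (isMetricOn_metricIn q) hy m j m).congr_of_eventuallyEq ?_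
  filter_upwards [(𝕏 q).open_target.mem_nhds hy] with z hz using fieldIn_mixedField hD hN hDN hz j

/-- The pointwise form of the integral formula for the mixed scalar curvature. -/
theorem fieldDiv_mixedField (hD : IsSmoothDistribution p D) (hN : IsSmoothDistribution p' N)
    (hDN : ∀ x, N x = (D x)ᗮ) (q : M) :
    fieldDiv (mixedField D N) q
      = mixedScalarCurvature D N q - 2 * sumSigmaTwo D N q - 2 * sumSigmaTwo N D q := by
  have hq := mem_chart_source 𝔼 q
  have hy := (𝕏 q).map_source hq
  have hG := isMetricOn_metricIn (n := n) q
  have hP := isProjOn_projIn hD q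
  have hZ := (fieldSmoothAt_iff hq).1 (fieldSmoothAt_mixedField hD hN hDN q)
  have e1 : fieldDiv (mixedField D N) q = diagSum fun k m ↦
      matDeriv k (mixedMat (metricIn q) (projIn q D) m) (𝕏 q q)
        + chrisMat (metricIn q) k (𝕏 q q) * mixedMat (metricIn q) (projIn q D) m (𝕏 q q) := by
    rw [fieldDiv_eq hq (hZ.differentiableAt (by simp)), diagSum]
    refine Finset.sum_congr rfl fun k _ ↦ ?_
    simp only [Matrix.add_apply, Finset.sum_add_distrib]
    rw [covVec, PiLp.add_apply]
    congr 1
    · have h1 : fderiv ℝ (fieldIn q (mixedField D N)) (𝕏 q q) (EuclideanSpace.single k 1) k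
          = fderiv ℝ (fun y ↦ fieldIn q (mixedField D N) y k) (𝕏 q q) (EuclideanSpace.single k 1) := by
        have := ((EuclideanSpace.proj (𝕜 := ℝ) k).hasFDerivAt.comp (𝕏 q q)
          (hZ.differentiableAt (by simp)).hasFDerivAt).fderiv
        exact (DFunLike.congr_fun this (EuclideanSpace.single k 1)).symm
      have h2 : (fun y ↦ fieldIn q (mixedField D N) y k) =ᶠ[nhds (𝕏 q q)]
          fun y ↦ ∑ m, mixedMat (metricIn q) (projIn q D) m y k m := by
        filter_upwards [(𝕏 q).open_target.mem_nhds hy] with z hz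
          using fieldIn_mixedField hD hN hDN hz k
      rw [h1, h2.fderiv_eq, fderiv_fun_sum fun m _ ↦ (hP.smooth_mixedMat hG hy m).diff k m,
        _root_.sum_apply]
      rfl
    · have h3 : (⇑(fieldIn q (mixedField D N) (𝕏 q q)) : Fin n → ℝ)
          = ∑ m, (mixedMat (metricIn q) (projIn q D) m (𝕏 q q)).col m := by
        ext j
        rw [fieldIn_mixedField hD hN hDN hy, Finset.sum_apply]
        rfl
      rw [chrisBil]
      simp only [h3, Matrix.mulVec_sum, Finset.sum_apply, PiLp.single_apply, ite_mul, one_mul,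
        zero_mul, Finset.sum_ite_eq', Finset.mem_univ, if_true]
      rfl
  rw [e1, hP.divergence_mixedMat hG hy, mixedScalarCurvature_eq hDN,
    sumSigmaTwo_eq hN (eq_orthogonal_of_eq_orthogonal hDN) hq, sumSigmaTwo_eq hD hDN hq]
  simp only [nablaProj_compl hDN hD hq, projIn_compl hDN hy]
  have h : ∀ F F' : Fin n → Fin n → Matrix (Fin n) (Fin n) ℝ,
      (∀ k m, F k m = F' k m) → diagSum F = diagSum F' := fun F F' h ↦ by
    simp only [diagSum, h]
  -- Inserting `1 = P + (1 - P)` separates the quadratic terms in `A` into the part belonging to the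
  -- co-nullity operators of `D` and the part belonging to those of `N`.
  have h4 : ∀ X : Fin n → Fin n → Matrix (Fin n) (Fin n) ℝ, (diagSum fun k m ↦
      X k m * (metricIn q (𝕏 q q))⁻¹) = (diagSum fun k m ↦
      projIn q D (𝕏 q q) * X k m * (metricIn q (𝕏 q q))⁻¹) + diagSum fun k m ↦
      (1 - projIn q D (𝕏 q q)) * X k m * (metricIn q (𝕏 q q))⁻¹ := by
    intro X
    rw [← diagSum_add]
    exact h _ _ fun k m ↦ by noncomm_ring
  change _ - (diagSum fun k m ↦ nablaProj q D k q * nablaProj q D m q * _)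
    + (diagSum fun k m ↦ nablaProj q D m q * nablaProj q D k q * _) = _
  rw [h4 fun k m ↦ nablaProj q D k q * nablaProj q D m q,
    h4 fun k m ↦ nablaProj q D m q * nablaProj q D k q]
  simp only [Matrix.mul_neg, Matrix.neg_mul, neg_neg, Matrix.mul_assoc]
  ring

end MixedField

/-! ### Inner products of multivectors with one entry replaced. -/

noncomputable section Wedge

variable {V : Type*} [NormedAddCommGroup V] [InnerProductSpace ℝ V] {k : ℕ}

lemma wedgeInner_ιMulti (v w : Fin k → V) :
    wedgeInner (exteriorPower.ιMulti ℝ k v) (exteriorPower.ιMulti ℝ k w)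
      = (Matrix.of fun i j ↦ inner ℝ (v j) (w i)).det := by
  rw [wedgeInner, exteriorPower.map_apply_ιMulti, exteriorPower.pairingDual_ιMulti_ιMulti]
  rfl

lemma wedgeInner_sum {ι κ : Type*} (s : Finset ι) (t : Finset κ) (a : ι → ⋀[ℝ]^k V)
    (b : κ → ⋀[ℝ]^k V) :
    wedgeInner (∑ i ∈ s, a i) (∑ j ∈ t, b j) = ∑ i ∈ s, ∑ j ∈ t, wedgeInner (a i) (b j) := by
  simp only [wedgeInner, map_sum, LinearMap.sum_apply]
  exact Finset.sum_comm

/-- The difference `z - w` is a combination of the `e j` with `j ≠ i`, and each of these produces a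
wedge with a repeated factor. -/
lemma ιMulti_update_eq {e : Fin k → V} (he : Orthonormal ℝ e) (i : Fin k) {z w : V}
    (hzw : z - w ∈ Submodule.span ℝ (Set.range e)) (hi : inner ℝ (e i) (z - w) = 0) :
    exteriorPower.ιMulti ℝ k (Function.update e i z)
      = exteriorPower.ιMulti ℝ k (Function.update e i w) := by
  rw [← sub_eq_zero, ← AlternatingMap.map_update_sub]
  obtain ⟨a, ha⟩ := (Submodule.mem_span_range_iff_exists_fun ℝ).1 hzw
  rw [← ha, he.inner_right_fintype] at hi
  rw [← ha, AlternatingMap.map_update_sum]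
  refine Finset.sum_eq_zero fun j _ ↦ ?_
  rw [AlternatingMap.map_update_smul]
  rcases eq_or_ne j i with rfl | hj
  · rw [hi, zero_smul]
  · rw [AlternatingMap.map_update_self _ _ hj.symm, smul_zero]

/-- For different positions the Gram matrix has a zero column. For equal positions it is diagonal,
with `‖w i‖²` as its only entry possibly different from one. -/
lemma wedgeInner_sum_update {e w : Fin k → V} (he : Orthonormal ℝ e)
    (hw : ∀ i j, inner ℝ (e i) (w j) = 0) :
    wedgeInner (∑ i, exteriorPower.ιMulti ℝ k (Function.update e i (w i)))
      (∑ i, exteriorPower.ιMulti ℝ k (Function.update e i (w i))) = ∑ i, ‖w i‖ ^ 2 := by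
  have he' := orthonormal_iff_ite.1 he
  rw [wedgeInner_sum]
  refine Finset.sum_congr rfl fun i _ ↦ ?_
  rw [Finset.sum_eq_single i]
  · rw [wedgeInner_ιMulti, show (Matrix.of fun a b ↦ inner ℝ (Function.update e i (w i) b)
      (Function.update e i (w i) a)) = Matrix.diagonal (Function.update 1 i (‖w i‖ ^ 2)) from ?_,
      Matrix.det_diagonal, Finset.prod_update_of_mem (Finset.mem_univ i)]
    · simp
    · ext a b
      rw [Matrix.of_apply, Matrix.diagonal_apply]
      by_cases ha : a = i <;> by_cases hb : b = i
      · subst ha hb; simp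
      · subst ha; simp [hb, hw, Ne.symm hb]
      · subst hb; simp [ha, hw, real_inner_comm]
      · simp [ha, hb, he', eq_comm]
  · intro j _ hj
    rw [wedgeInner_ιMulti]
    refine Matrix.det_eq_zero_of_column_eq_zero j fun a ↦ ?_
    rw [Matrix.of_apply, Function.update_of_ne hj]
    rcases eq_or_ne a j with rfl | ha
    · rw [Function.update_self, hw]
    · rw [Function.update_of_ne ha, he', if_neg ha.symm]
  · simp

end Wedge

/-! ### Gram-Schmidt frames and the bending density. -/

noncomputable section Frame

open Matrix

variable {n : ℕ} {M : Type*} [TopologicalSpace M] [ChartedSpace (EuclideanSpace ℝ (Fin n)) M]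
  [RiemannianBundle (fun x : M ↦ TangentSpace (𝓡 n) x)]

local notation "𝔼" => EuclideanSpace ℝ (Fin n)
local notation "𝕏" => chartAt (EuclideanSpace ℝ (Fin n))

variable {c q : M} {D N : Π x : M, Submodule ℝ (TangentSpace (𝓡 n) x)} {p p' : ℕ}

lemma onb_orthonormal (D : Π x : M, Submodule ℝ (TangentSpace (𝓡 n) x)) (x : M) :
    Orthonormal ℝ (onb D x) :=
  (stdOrthonormalBasis ℝ (D x)).orthonormal.comp_linearIsometry (D x).subtypeₗᵢ

lemma span_range_onb (D : Π x : M, Submodule ℝ (TangentSpace (𝓡 n) x)) (x : M) :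
    Submodule.span ℝ (Set.range (onb D x)) = D x := by
  have h : Set.range (onb D x) = (D x).subtype '' Set.range (stdOrthonormalBasis ℝ (D x)) := by
    rw [← Set.range_comp]; rfl
  have h2 := (stdOrthonormalBasis ℝ (D x)).toBasis.span_eq
  rw [OrthonormalBasis.coe_toBasis] at h2
  rw [h, Submodule.span_image, h2, Submodule.map_top, Submodule.range_subtype]

lemma gramSchmidt_mem {r : ℕ} {W : Submodule ℝ (TangentSpace (𝓡 n) q)}
    {f : Fin r → TangentSpace (𝓡 n) q} (hf : ∀ i, f i ∈ W) (i : Fin r) :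
    InnerProductSpace.gramSchmidt ℝ f i ∈ W := by
  refine Submodule.span_le.2 ?_ (InnerProductSpace.gramSchmidt_mem_span ℝ f le_rfl)
  rintro _ ⟨j, -, rfl⟩
  exact hf j

variable [IsManifold (𝓡 n) ∞ M]

lemma sectionThrough_mem (v : TangentSpace (𝓡 n) q) (r : M) : sectionThrough D v r ∈ D r :=
  Submodule.starProjection_apply_mem _ _

lemma orthonormalFrame_mem (i : Fin (Module.finrank ℝ (D q))) (r : M) :
    orthonormalFrame D q i r ∈ D r :=
  Submodule.smul_mem _ _ (gramSchmidt_mem (fun _ ↦ sectionThrough_mem _ r) i)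

lemma gramSchmidt_sectionThrough_self :
    InnerProductSpace.gramSchmidt ℝ (fun j ↦ sectionThrough D (onb D q j) q) = onb D q := by
  simp only [sectionThrough_self (onb_mem _)]
  exact InnerProductSpace.gramSchmidt_of_orthogonal ℝ fun a b hab ↦ (onb_orthonormal D q).2 hab

lemma orthonormalFrame_self (i : Fin (Module.finrank ℝ (D q))) :
    orthonormalFrame D q i q = onb D q i := by
  rw [orthonormalFrame, InnerProductSpace.gramSchmidtNormed, gramSchmidt_sectionThrough_self,
    (onb_orthonormal D q).1]
  simp

/-- Normalised Gram-Schmidt vectors have length one or zero, and length one at the centre.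
Maximality there suffices to differentiate `|e|²`, with no need to know where the frame stays
linearly independent. -/
lemma norm_orthonormalFrame_le (i : Fin (Module.finrank ℝ (D q))) (r : M) :
    ‖orthonormalFrame D q i r‖ ≤ ‖orthonormalFrame D q i q‖ := by
  rw [orthonormalFrame_self, (onb_orthonormal D q).1]
  by_cases h : orthonormalFrame D q i r = 0
  · rw [h, norm_zero]; exact zero_le_one
  · exact (InnerProductSpace.gramSchmidtNormed_unit_length' h).le

variable [IsContMDiffRiemannianBundle (𝓡 n) ∞ (EuclideanSpace ℝ (Fin n))
  (fun x : M ↦ TangentSpace (𝓡 n) x)]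

lemma mdifferentiableAt_inner {Y Z : Π q : M, TangentSpace (𝓡 n) q}
    (hY : MDifferentiableAt (𝓡 n) ((𝓡 n).prod 𝓘(ℝ, 𝔼))
      (fun r ↦ (⟨r, Y r⟩ : TangentBundle (𝓡 n) M)) q)
    (hZ : MDifferentiableAt (𝓡 n) ((𝓡 n).prod 𝓘(ℝ, 𝔼))
      (fun r ↦ (⟨r, Z r⟩ : TangentBundle (𝓡 n) M)) q) :
    MDifferentiableAt (𝓡 n) 𝓘(ℝ, ℝ) (fun r ↦ inner ℝ (Y r) (Z r)) q := by
  have : IsContMDiffRiemannianBundle (𝓡 n) 1 𝔼 (fun x : M ↦ TangentSpace (𝓡 n) x) :=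
    .of_le (n := ∞) (by simp)
  exact MDifferentiableAt.inner_bundle hY hZ

/-- The Gram-Schmidt process applied to fields that are orthonormal at a point. -/
lemma mdifferentiableAt_gramSchmidt {r : ℕ} {f : Fin r → Π q : M, TangentSpace (𝓡 n) q}
    (hf : ∀ i, MDifferentiableAt (𝓡 n) ((𝓡 n).prod 𝓘(ℝ, 𝔼))
      (fun q ↦ (⟨q, f i q⟩ : TangentBundle (𝓡 n) M)) q)
    (h : Orthonormal ℝ fun i ↦ f i q) (i : Fin r) :
    MDifferentiableAt (𝓡 n) ((𝓡 n).prod 𝓘(ℝ, 𝔼))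
      (fun q ↦ (⟨q, InnerProductSpace.gramSchmidt ℝ (fun j ↦ f j q) i⟩ : TangentBundle (𝓡 n) M)) q := by
  have hat : InnerProductSpace.gramSchmidt ℝ (fun j ↦ f j q) = fun j ↦ f j q :=
    InnerProductSpace.gramSchmidt_of_orthogonal ℝ fun a b hab ↦ h.2 hab
  induction i using WellFoundedLT.induction with
  | ind i ih =>
    have hsum : MDifferentiableAt (𝓡 n) ((𝓡 n).prod 𝓘(ℝ, 𝔼)) (fun r ↦ (⟨r,
        ∑ j ∈ Finset.Iio i, (inner ℝ (InnerProductSpace.gramSchmidt ℝ (fun l ↦ f l r) j) (f i r)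
          / (‖InnerProductSpace.gramSchmidt ℝ (fun l ↦ f l r) j‖ ^ 2)) •
            InnerProductSpace.gramSchmidt ℝ (fun l ↦ f l r) j⟩ : TangentBundle (𝓡 n) M)) q := by
      refine MDifferentiableAt.sum_section fun j hj ↦ ?_
      have hj' := ih j (Finset.mem_Iio.1 hj)
      refine MDifferentiableAt.smul_section (f := fun r ↦
        inner ℝ (InnerProductSpace.gramSchmidt ℝ (fun l ↦ f l r) j) (f i r)
          / (‖InnerProductSpace.gramSchmidt ℝ (fun l ↦ f l r) j‖ ^ 2)) ?_ hj'
      simp only [← real_inner_self_eq_norm_sq, div_eq_mul_inv]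
      refine (mdifferentiableAt_inner hj' (hf i)).mul ?_
      refine DifferentiableAt.comp_mdifferentiableAt (g := fun t : ℝ ↦ t⁻¹)
        (differentiableAt_inv ?_) (mdifferentiableAt_inner hj' hj')
      -- At `q` the Gram-Schmidt vectors are the given orthonormal ones, so the denominators equal
      -- one there.
      rw [hat, real_inner_self_eq_norm_sq, h.1, one_pow]
      exact one_ne_zero
    have := mdifferentiableAt_sub_section (hf i) hsum
    refine this.congr_of_eventuallyEq (Filter.Eventually.of_forall fun r ↦ ?_)
    simp only [Pi.sub_apply]
    rw [InnerProductSpace.gramSchmidt_def]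
    simp only [Submodule.starProjection_singleton]
    rfl

lemma mdifferentiableAt_orthonormalFrame (hD : IsSmoothDistribution p D)
    (i : Fin (Module.finrank ℝ (D q))) :
    MDifferentiableAt (𝓡 n) ((𝓡 n).prod 𝓘(ℝ, 𝔼))
      (fun r ↦ (⟨r, orthonormalFrame D q i r⟩ : TangentBundle (𝓡 n) M)) q := by
  have h := mdifferentiableAt_gramSchmidt (q := q) (f := fun j ↦ sectionThrough D (onb D q j))
    (fun j ↦ (fieldSmoothAt_sectionThrough hD _).mdifferentiableAt (by simp))
    (by simpa only [sectionThrough_self (onb_mem _)] using onb_orthonormal D q) i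
  refine MDifferentiableAt.smul_section (f := fun r ↦
    ‖InnerProductSpace.gramSchmidt ℝ (fun j ↦ sectionThrough D (onb D q j) r) i‖⁻¹) ?_ h
  have h2 : (fun r ↦ ‖InnerProductSpace.gramSchmidt ℝ
      (fun j ↦ sectionThrough D (onb D q j) r) i‖⁻¹) = (fun t : ℝ ↦ (√t)⁻¹) ∘ fun r ↦
      inner ℝ (InnerProductSpace.gramSchmidt ℝ (fun j ↦ sectionThrough D (onb D q j) r) i)
        (InnerProductSpace.gramSchmidt ℝ (fun j ↦ sectionThrough D (onb D q j) r) i) := by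
    ext r
    simp only [Function.comp_apply, real_inner_self_eq_norm_sq, Real.sqrt_sq (norm_nonneg _)]
  rw [h2]
  refine DifferentiableAt.comp_mdifferentiableAt ?_ (mdifferentiableAt_inner h h)
  rw [gramSchmidt_sectionThrough_self, real_inner_self_eq_norm_sq, (onb_orthonormal D q).1]
  exact (DifferentiableAt.sqrt differentiableAt_id (by simp)).inv (by simp)

/-- A field of maximal length at a point is orthogonal to its derivatives there. -/
lemma inner_leviCivita_self_eq_zero {Y : Π q : M, TangentSpace (𝓡 n) q}
    (hY : MDifferentiableAt (𝓡 n) ((𝓡 n).prod 𝓘(ℝ, 𝔼))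
      (fun r ↦ (⟨r, Y r⟩ : TangentBundle (𝓡 n) M)) q)
    (h : ∀ r, ‖Y r‖ ≤ ‖Y q‖) (u : TangentSpace (𝓡 n) q) :
    inner ℝ (leviCivita Y q u) (Y q) = 0 := by
  have hq := mem_chart_source 𝔼 q
  have hy : 𝕏 q q ∈ (𝕏 q).target := (𝕏 q).map_source hq
  have hG := isMetricOn_metricIn (n := n) q
  have hW := (mdifferentiableAt_field_iff hq).1 hY
  have e : ∀ z ∈ (𝕏 q).target, gramForm (metricIn q z) (fieldIn q Y z) (fieldIn q Y z)
      = ‖Y ((𝕏 q).symm z)‖ ^ 2 := fun z hz ↦ by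
    rw [← real_inner_self_eq_norm_sq, inner_eq_gramForm ((𝕏 q).map_target hz)]; rfl
  -- The derivative of `‖Y‖²` vanishes at a maximum; by the Koszul formula that derivative is `2⟨∇_u
  -- Y, Y⟩`.
  have hmax : IsLocalMax (fun z ↦ gramForm (metricIn q z) (fieldIn q Y z) (fieldIn q Y z))
      (𝕏 q q) := by
    filter_upwards [(𝕏 q).open_target.mem_nhds hy] with z hz
    rw [e z hz, e _ hy, (𝕏 q).left_inv hq]
    gcongr
    exact h _
  have h0 := fderiv_gramForm_comp (ψ := id) (y := 𝕏 q q) (hG.smooth _ hy) differentiableAt_id hW hW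
    (toChart q q u)
  simp only [id_eq] at h0
  rw [hmax.fderiv_eq_zero] at h0
  have h1 := hG.gramForm_chrisBil hy (toChart q q u) (fieldIn q Y (𝕏 q q)) (fieldIn q Y (𝕏 q q))
  have hs : (metricIn (n := n) q (𝕏 q q))ᵀ = metricIn q (𝕏 q q) := gramMatrix_symm _ _
  rw [inner_eq_gramForm hq, toChart_leviCivita hq hW, ← metricIn_chart hq, covVec,
    gramForm_add_left, ← fieldIn_chart Y hq]
  rw [gramForm_comm hs (fieldIn q Y (𝕏 q q)) (fderiv ℝ (fieldIn q Y) (𝕏 q q) (toChart q q u))] at h0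
  simp only [_root_.zero_apply, fderiv_id, ContinuousLinearMap.id_apply] at h0
  linarith

/-- The bending density in terms of the conullity tensor of the orthogonal complement. -/
theorem bendingDensity_eq_sum (hD : IsSmoothDistribution p D) (hDN : ∀ x, N x = (D x)ᗮ) (q : M) :
    bendingDensity D q = ∑ a, ∑ i, ‖conullity N D q (onb D q i)
      (stdOrthonormalBasis ℝ (TangentSpace (𝓡 n) q) a)‖ ^ 2 := by
  have hq := mem_chart_source 𝔼 q
  refine Finset.sum_congr rfl fun a _ ↦ ?_
  set u : TangentSpace (𝓡 n) q := stdOrthonormalBasis ℝ (TangentSpace (𝓡 n) q) a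
  have hC : ∀ i, conullity N D q (onb D q i) u
      = (N q).starProjection (leviCivita (orthonormalFrame D q i) q u) := fun i ↦ by
    refine toChart_injective hq ?_
    rw [toChart_conullity hD hDN hq (onb_mem i), toChart_normal_leviCivita hD hDN hq
      ((mdifferentiableAt_field_iff hq).1 (mdifferentiableAt_orthonormalFrame hD i))
      (orthonormalFrame_mem i), orthonormalFrame_self]
  have hW : nablaWedge (orthonormalFrame D q) q u = ∑ i, exteriorPower.ιMulti ℝ _
      (Function.update (onb D q) i (conullity N D q (onb D q i) u)) := by
    refine Finset.sum_congr rfl fun i _ ↦ ?_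
    rw [show (fun j ↦ orthonormalFrame D q j q) = onb D q from funext orthonormalFrame_self, hC]
    have hmem : leviCivita (orthonormalFrame D q i) q u
        - (N q).starProjection (leviCivita (orthonormalFrame D q i) q u) ∈ D q := by
      rw [eq_orthogonal_of_eq_orthogonal hDN q]
      exact Submodule.sub_starProjection_mem_orthogonal _
    -- The part of `∇_u eᵢ` tangent to `D` may be discarded: it has no component along `eᵢ`, and its
    -- components along the other frame vectors do not affect the wedge.
    refine ιMulti_update_eq (onb_orthonormal D q) i (by rwa [span_range_onb]) ?_
    have h1 := inner_leviCivita_self_eq_zero (mdifferentiableAt_orthonormalFrame hD i)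
      (norm_orthonormalFrame_le i) u
    rw [orthonormalFrame_self, real_inner_comm] at h1
    have h2 : (N q).starProjection (leviCivita (orthonormalFrame D q i) q u) ∈ (D q)ᗮ := by
      rw [← hDN]; exact Submodule.starProjection_apply_mem _ _
    rw [inner_sub_right, h1, h2 _ (onb_mem i), sub_zero]
  rw [hW]
  refine wedgeInner_sum_update (onb_orthonormal D q) fun i j ↦ ?_
  have h2 : conullity N D q (onb D q j) u ∈ (D q)ᗮ := by
    rw [← hDN]; exact Submodule.starProjection_apply_mem _ _
  exact h2 _ (onb_mem i)

end Frame

/-! ### The pointwise lower bound of the bending density. -/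

noncomputable section BendingBound

open Matrix

/-- With `d = ∑ Cᵢᵢ²`, Cauchy-Schwarz gives `(tr C)² ≤ k d`, and `2CᵢⱼCⱼᵢ ≥ -Cᵢⱼ² - Cⱼᵢ²` off the
diagonal gives `tr C² ≥ 2d - |C|²`. Hence `2σ₂ ≤ (k - 2)d + |C|² ≤ (k - 1)|C|²`, where the last step
needs `k ≥ 2`. -/
lemma two_div_mul_sigmaTwo_le {k p : ℕ} (hkp : k = p) (hp : 2 ≤ p)
    (C : Matrix (Fin k) (Fin k) ℝ) :
    2 / ((p : ℝ) - 1) * sigmaTwo C ≤ ∑ i, ∑ j, C i j ^ 2 := by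
  subst hkp
  have hk' : (0 : ℝ) < (k : ℝ) - 1 := by
    have : (2 : ℝ) ≤ k := by exact_mod_cast hp
    linarith
  rw [div_mul_eq_mul_div, div_le_iff₀ hk', two_mul_sigmaTwo]
  have htr : C.trace ^ 2 ≤ (k : ℝ) * ∑ i, C i i ^ 2 := by
    have := sq_sum_le_card_mul_sum_sq (s := Finset.univ) (f := fun i ↦ C i i)
    simpa [Matrix.trace] using this
  -- The antisymmetric term on the right sums to zero; it allows an entrywise comparison with `|C|²`
  -- instead of one over unordered pairs.
  have h2 : ∀ i j, C i i ^ 2 * (if i = j then 2 else 0) - C i j ^ 2 ≤ C i j * C j i + (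
      C j i ^ 2 - C i j ^ 2) / 2 := fun i j ↦ by
    split_ifs with h
    · subst h; nlinarith
    · nlinarith [sq_nonneg (C i j + C j i)]
  have h3 : ∑ i, 2 * C i i ^ 2 - ∑ i, ∑ j, C i j ^ 2 ≤ (C * C).trace := by
    have := Finset.sum_le_sum fun i (_ : i ∈ Finset.univ) ↦
      Finset.sum_le_sum fun j (_ : j ∈ Finset.univ) ↦ h2 i j
    simp only [Finset.sum_sub_distrib, Finset.sum_add_distrib, mul_ite, mul_zero,
      Finset.sum_ite_eq, Finset.mem_univ, if_true, ← Finset.sum_div] at this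
    rw [Finset.sum_comm (f := fun i j ↦ C j i ^ 2)] at this
    simp only [Matrix.trace, Matrix.diag, Matrix.mul_apply]
    simp only [mul_comm (2 : ℝ)]
    linarith
  have h4 : ∑ i, C i i ^ 2 ≤ ∑ i, ∑ j, C i j ^ 2 := Finset.sum_le_sum fun i _ ↦
    Finset.single_le_sum (f := fun j ↦ C i j ^ 2) (fun j _ ↦ sq_nonneg _) (Finset.mem_univ i)
  have h5 : (0 : ℝ) ≤ (k : ℝ) - 2 := by
    have : (2 : ℝ) ≤ k := by exact_mod_cast hp
    linarith
  rw [← Finset.mul_sum] at h3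
  nlinarith [mul_le_mul_of_nonneg_left h4 h5]

variable {n : ℕ} {M : Type*} [TopologicalSpace M] [ChartedSpace (EuclideanSpace ℝ (Fin n)) M]

local notation "𝔼" => EuclideanSpace ℝ (Fin n)
local notation "𝕏" => chartAt (EuclideanSpace ℝ (Fin n))

lemma gramForm_sum_smul (A : Matrix (Fin n) (Fin n) ℝ) {ι κ : Type*} (s : Finset ι) (t : Finset κ)
    (a : ι → ℝ) (b : κ → ℝ) (x : ι → EuclideanSpace ℝ (Fin n))
    (y : κ → EuclideanSpace ℝ (Fin n)) :
    gramForm A (∑ k ∈ s, a k • x k) (∑ m ∈ t, b m • y m)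
      = ∑ k ∈ s, ∑ m ∈ t, a k * b m * gramForm A (x k) (y m) := by
  simp only [gramForm_eq_dotProduct, WithLp.ofLp_sum, WithLp.ofLp_smul, sum_dotProduct,
    Matrix.mulVec_sum, dotProduct_sum, smul_dotProduct, Matrix.mulVec_smul, dotProduct_smul,
    smul_eq_mul, mul_assoc, Finset.mul_sum]
  rw [Finset.sum_comm]
  exact Finset.sum_congr rfl fun i _ ↦ Finset.sum_congr rfl fun j _ ↦ by ring

variable {c q : M} {D N : Π x : M, Submodule ℝ (TangentSpace (𝓡 n) x)} {p p' : ℕ}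

lemma IsSmoothDistribution.finrank_eq [IsManifold (𝓡 n) ∞ M] (hD : IsSmoothDistribution p D) (q : M) :
    Module.finrank ℝ (D q) = p := by
  obtain ⟨U, -, hqU, X, -, hX⟩ := hD q
  obtain ⟨hli, hspan⟩ := hX q hqU
  rw [← hspan, finrank_span_eq_card hli, Fintype.card_fin]

variable [RiemannianBundle (fun x : M ↦ TangentSpace (𝓡 n) x)]

lemma sum_sq_inner_onb {w : TangentSpace (𝓡 n) q} (hw : w ∈ D q) :
    ‖w‖ ^ 2 = ∑ i, inner ℝ w (onb D q i) ^ 2 := by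
  have h := (stdOrthonormalBasis ℝ (D q)).sum_sq_norm_inner_left ⟨w, hw⟩
  simp only [Real.norm_eq_abs, sq_abs] at h
  exact h.symm

variable [IsManifold (𝓡 n) ∞ M]

/-- The components of an orthonormal basis of the tangent space. -/
lemma stdOrthonormalBasis_mul_transpose (hq : q ∈ (𝕏 c).source) :
    (Matrix.of fun k a ↦ toChart c q (stdOrthonormalBasis ℝ (TangentSpace (𝓡 n) q) a) k)
      * (Matrix.of fun k a ↦ toChart c q (stdOrthonormalBasis ℝ (TangentSpace (𝓡 n) q) a) k)ᵀ
      = (metricIn c (𝕏 c q))⁻¹ := by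
  set F := Matrix.of fun k a ↦ toChart c q (stdOrthonormalBasis ℝ (TangentSpace (𝓡 n) q) a) k
  have h1 : Fᵀ * metricIn c (𝕏 c q) * F = 1 := by
    ext a b
    have h := orthonormal_iff_ite.1
      (stdOrthonormalBasis ℝ (TangentSpace (𝓡 n) q)).orthonormal a b
    rw [inner_eq_gramForm hq, gramForm_eq_dotProduct, ← metricIn_chart hq] at h
    rw [Matrix.one_apply, ← h, Matrix.mul_assoc]
    rfl
  have hcard : Fintype.card (Fin (Module.finrank ℝ (TangentSpace (𝓡 n) q)))
      = Fintype.card (Fin n) := by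
    simp only [Fintype.card_fin]
    exact finrank_euclideanSpace_fin
  -- A one-sided inverse is two-sided because the dimension of the tangent space is `n`, although
  -- the index types differ.
  have h2 : F * (Fᵀ * metricIn c (𝕏 c q)) = 1 :=
    (Matrix.mul_eq_one_comm_of_card_eq _ _ _ hcard).1 h1
  rw [← Matrix.mul_assoc] at h2
  exact (Matrix.inv_eq_left_inv h2).symm

lemma conullity_mem (ξ u : TangentSpace (𝓡 n) q) : conullity D N q ξ u ∈ D q :=
  Submodule.starProjection_apply_mem _ _

variable [IsContMDiffRiemannianBundle (𝓡 n) ∞ (EuclideanSpace ℝ (Fin n))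
  (fun x : M ↦ TangentSpace (𝓡 n) x)]

/-- The sum depends on the vectors `v a` only through `∑ v_a ⊗ v_a`, which allows one basis of the
tangent space to be exchanged for another. -/
lemma sum_norm_sq_conullity (hD : IsSmoothDistribution p D) (hDN : ∀ x, N x = (D x)ᗮ)
    (hq : q ∈ (𝕏 c).source) {ξ : TangentSpace (𝓡 n) q} (hξ : ξ ∈ D q) {ι : Type*} [Fintype ι]
    (v : ι → TangentSpace (𝓡 n) q) :
    ∑ a, ‖conullity N D q ξ (v a)‖ ^ 2 = ∑ k, ∑ m,
      ((Matrix.of fun k a ↦ toChart c q (v a) k) * (Matrix.of fun k a ↦ toChart c q (v a) k)ᵀ) k m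
        * gramForm (metricIn c (𝕏 c q)) (matAct (nablaProj c D k q) (toChart c q ξ))
          (matAct (nablaProj c D m q) (toChart c q ξ)) := by
  have h : ∀ a, ‖conullity N D q ξ (v a)‖ ^ 2 = ∑ k, ∑ m, toChart c q (v a) k * toChart c q (v a) m
      * gramForm (metricIn c (𝕏 c q)) (matAct (nablaProj c D k q) (toChart c q ξ))
          (matAct (nablaProj c D m q) (toChart c q ξ)) := fun a ↦ by
    rw [← real_inner_self_eq_norm_sq, inner_eq_gramForm hq, toChart_conullity hD hDN hq hξ,
      gramForm_sum_smul, metricIn_chart hq]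
  rw [Finset.sum_congr rfl fun a _ ↦ h a, Finset.sum_comm]
  refine Finset.sum_congr rfl fun k _ ↦ ?_
  rw [Finset.sum_comm]
  refine Finset.sum_congr rfl fun m _ ↦ ?_
  rw [Matrix.mul_apply, Finset.sum_mul]
  rfl

/-- The differentiated form of `g(e, ξ) = 0`. In terms of projections, it is the self-adjointness of
`∇P` combined with `∇(1 - P) = -∇P`. -/
lemma inner_conullity (hD : IsSmoothDistribution p D) (hN : IsSmoothDistribution p' N)
    (hDN : ∀ x, N x = (D x)ᗮ) {e ξ : TangentSpace (𝓡 n) q} (he : e ∈ D q) (hξ : ξ ∈ N q)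
    (u : TangentSpace (𝓡 n) q) :
    inner ℝ (conullity N D q e u) ξ = -inner ℝ (conullity D N q ξ u) e := by
  have hq := mem_chart_source 𝔼 q
  have hy := (𝕏 q).map_source hq
  have hadj := (isProjOn_projIn hD q).covMat_adj (isMetricOn_metricIn q) hy
  have hs : (metricIn (n := n) q (𝕏 q q))ᵀ = metricIn q (𝕏 q q) := gramMatrix_symm _ _
  have h1 : ∀ (a b : 𝔼) k, gramForm (metricIn q (𝕏 q q)) (matAct (nablaProj q D k q) a) b
      = gramForm (metricIn q (𝕏 q q)) (matAct (nablaProj q D k q) b) a := fun a b k ↦ by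
    have h := congr_arg (fun X ↦ metricIn q (𝕏 q q) * X * metricIn q (𝕏 q q)) (hadj k)
    simp only [← Matrix.mul_assoc, Matrix.mul_nonsing_inv _ (isUnit_det_metricIn hq),
      Matrix.one_mul] at h
    rw [Matrix.nonsing_inv_mul_cancel_right _ _ (isUnit_det_metricIn hq)] at h
    rw [gramForm_comm hs _ a, gramForm_eq_dotProduct, gramForm_eq_dotProduct, ofLp_matAct,
      ofLp_matAct, ← Matrix.vecMul_transpose, ← Matrix.dotProduct_mulVec, Matrix.mulVec_mulVec,
      Matrix.mulVec_mulVec]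
    exact congr_arg (fun X ↦ ⇑a ⬝ᵥ X *ᵥ ⇑b) h
  have h2 : ∀ (w : Fin n → 𝔼) (b : 𝔼), gramForm (metricIn q (𝕏 q q))
      (∑ k, toChart q q u k • w k) b
      = ∑ k, toChart q q u k * gramForm (metricIn q (𝕏 q q)) (w k) b := fun w b ↦ by
    have := gramForm_sum_smul (metricIn q (𝕏 q q)) Finset.univ Finset.univ (toChart q q u)
      (fun _ : Unit ↦ 1) w fun _ ↦ b
    simpa using this
  rw [inner_eq_gramForm hq, inner_eq_gramForm hq, toChart_conullity hD hDN hq he,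
    toChart_conullity hN (eq_orthogonal_of_eq_orthogonal hDN) hq hξ, ← metricIn_chart hq, h2, h2,
    ← Finset.sum_neg_distrib]
  refine Finset.sum_congr rfl fun k _ ↦ ?_
  rw [nablaProj_compl hDN hD hq, h1]
  simp [gramForm_eq_dotProduct, ofLp_matAct, Matrix.neg_mulVec]

/-- The basis of the tangent space is replaced by bases of `D` and `N`. Derivatives along `N` are
the entries of `C₂`; those along `D` are, up to sign, the entries of `C₁` by `inner_conullity`. -/
theorem bendingDensity_eq_sum_sq (hD : IsSmoothDistribution p D) (hN : IsSmoothDistribution p' N)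
    (hDN : ∀ x, N x = (D x)ᗮ) (q : M) :
    bendingDensity D q = ∑ α, ∑ i, ∑ j, conullityMatrix D N q (onb N q α) i j ^ 2
      + ∑ i, ∑ α, ∑ β, conullityMatrix N D q (onb D q i) α β ^ 2 := by
  have hq := mem_chart_source 𝔼 q
  have hy := (𝕏 q).map_source hq
  have hsplit : ∀ i, ∑ a, ‖conullity N D q (onb D q i)
      (stdOrthonormalBasis ℝ (TangentSpace (𝓡 n) q) a)‖ ^ 2
      = ∑ j, ‖conullity N D q (onb D q i) (onb D q j)‖ ^ 2
        + ∑ α, ‖conullity N D q (onb D q i) (onb N q α)‖ ^ 2 := fun i ↦ by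
    have h1 := onbMat_mul_transpose (D := D) hq
    have h2 := onbMat_mul_transpose (D := N) hq
    have h3 := stdOrthonormalBasis_mul_transpose hq
    rw [sum_norm_sq_conullity hD hDN hq (onb_mem i), sum_norm_sq_conullity hD hDN hq (onb_mem i),
      sum_norm_sq_conullity hD hDN hq (onb_mem i), h3]
    change _ = (∑ k, ∑ m, (onbMat q D q * (onbMat q D q)ᵀ) k m * _)
      + ∑ k, ∑ m, (onbMat q N q * (onbMat q N q)ᵀ) k m * _
    rw [h1, h2, projIn_compl hDN hy]
    -- The contractions for the two bases add up to `P g⁻¹ + (1 - P) g⁻¹ = g⁻¹`, the contraction for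
    -- the whole tangent space.
    simp only [← Finset.sum_add_distrib, ← add_mul, ← Matrix.add_apply]
    rw [add_sub_cancel, one_mul]
  rw [bendingDensity_eq_sum hD hDN, Finset.sum_comm, Finset.sum_congr rfl fun i _ ↦ hsplit i,
    Finset.sum_add_distrib]
  congr 1
  · simp only [sum_sq_inner_onb (conullity_mem _ _),
      inner_conullity hD hN hDN (onb_mem _) (onb_mem _), neg_sq]
    rw [Finset.sum_comm, Finset.sum_congr rfl fun j _ ↦ Finset.sum_comm, Finset.sum_comm]
    rfl
  · simp only [sum_sq_inner_onb (conullity_mem _ _)]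
    rfl

theorem sumSigmaTwo_le_bendingDensity (hp : 2 ≤ p) (hp' : 2 ≤ p') (hD : IsSmoothDistribution p D)
    (hN : IsSmoothDistribution p' N) (hDN : ∀ x, N x = (D x)ᗮ) (q : M) :
    2 / ((p : ℝ) - 1) * sumSigmaTwo D N q + 2 / ((p' : ℝ) - 1) * sumSigmaTwo N D q
      ≤ bendingDensity D q := by
  rw [bendingDensity_eq_sum_sq hD hN hDN, sumSigmaTwo, sumSigmaTwo, Finset.mul_sum, Finset.mul_sum]
  refine add_le_add (Finset.sum_le_sum fun α _ ↦ ?_) (Finset.sum_le_sum fun i _ ↦ ?_)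
  · exact two_div_mul_sigmaTwo_le (hD.finrank_eq q) hp _
  · exact two_div_mul_sigmaTwo_le (hN.finrank_eq q) hp' _

/-- The coordinate expression of the bending density. -/
theorem bendingDensity_eq_trace (hD : IsSmoothDistribution p D) (hDN : ∀ x, N x = (D x)ᗮ)
    (hq : q ∈ (𝕏 c).source) :
    bendingDensity D q = ∑ k, ∑ m, (metricIn c (𝕏 c q))⁻¹ k m *
      ((nablaProj c D k q)ᵀ * metricIn c (𝕏 c q) * nablaProj c D m q *
        (projIn c D (𝕏 c q) * (metricIn c (𝕏 c q))⁻¹)).trace := by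
  rw [bendingDensity_eq_sum hD hDN, Finset.sum_comm]
  simp only [sum_norm_sq_conullity hD hDN hq (onb_mem _), stdOrthonormalBasis_mul_transpose hq]
  rw [Finset.sum_comm]
  refine Finset.sum_congr rfl fun k _ ↦ ?_
  rw [Finset.sum_comm]
  refine Finset.sum_congr rfl fun m _ ↦ ?_
  rw [← Finset.mul_sum, ← onbMat_mul_transpose hq, ← Matrix.mul_assoc, Matrix.trace_mul_comm]
  congr 1
  refine Finset.sum_congr rfl fun i _ ↦ ?_
  rw [gramForm_eq_dotProduct, ofLp_matAct, ofLp_matAct, ← Matrix.vecMul_transpose,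
    ← Matrix.dotProduct_mulVec, Matrix.mulVec_mulVec, Matrix.mulVec_mulVec]
  rfl

end BendingBound

/-! ### The derivative of the Riemannian volume density. -/

noncomputable section MetricDensity

open Matrix

variable {n : ℕ}

/-- In the Leibniz expansion a nontrivial permutation moves at least two indices, so after one
factor is differentiated an off-diagonal entry of the identity still remains. -/
lemma fderiv_det_of_eq_one {F : EuclideanSpace ℝ (Fin n) → Matrix (Fin n) (Fin n) ℝ}
    {y : EuclideanSpace ℝ (Fin n)} (hF : MatSmoothAt F y) (h1 : F y = 1) (k : Fin n) :
    fderiv ℝ (fun z ↦ (F z).det) y (EuclideanSpace.single k 1) = (matDeriv k F y).trace := by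
  have h : HasFDerivAt (fun z ↦ (F z).det) (∑ σ : Equiv.Perm (Fin n),
      ((Equiv.Perm.sign σ : ℤ) : ℝ) • ∑ i, (∏ j ∈ Finset.univ.erase i, F y (σ j) j) •
        fderiv ℝ (fun z ↦ F z (σ i) i) y) y := by
    simp only [Matrix.det_apply']
    exact HasFDerivAt.fun_sum fun σ _ ↦
      (HasFDerivAt.finsetProd fun i _ ↦ (hF.diff (σ i) i).hasFDerivAt).const_mul _
  rw [h.fderiv, _root_.sum_apply, Finset.sum_eq_single 1]
  · simp only [h1, Equiv.Perm.sign_one, Equiv.Perm.one_apply, Matrix.one_apply_eq,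
      Finset.prod_const_one, one_smul, Units.val_one, Int.cast_one, _root_.sum_apply]
    rfl
  · intro σ _ hσ
    simp only [_root_.smul_apply, _root_.sum_apply]
    refine smul_eq_zero_of_right _ (Finset.sum_eq_zero fun i _ ↦ smul_eq_zero_of_left ?_ _)
    obtain ⟨j, hj, hji⟩ : ∃ j, σ j ≠ j ∧ j ≠ i := by
      by_contra! hc
      obtain ⟨a, ha⟩ : ∃ a, σ a ≠ a := by
        by_contra! hc'
        exact hσ (Equiv.ext hc')
      have e1 := hc a ha
      have e2 := hc (σ a) fun h ↦ ha (σ.injective h)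
      exact ha (e2.trans e1.symm)
    refine Finset.prod_eq_zero (Finset.mem_erase.2 ⟨hji, Finset.mem_univ j⟩) ?_
    rw [h1, Matrix.one_apply_ne hj]
  · simp

/-- The derivative of the Riemannian volume density. -/
lemma IsMetricOn.fderiv_sqrt_det {G : EuclideanSpace ℝ (Fin n) → Matrix (Fin n) (Fin n) ℝ}
    {U : Set (EuclideanSpace ℝ (Fin n))} (hG : IsMetricOn G U) {y : EuclideanSpace ℝ (Fin n)}
    (hy : y ∈ U) (k : Fin n) :
    fderiv ℝ (fun z ↦ √(G z).det) y (EuclideanSpace.single k 1)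
      = √(G y).det * (chrisMat G k y).trace := by
  have hpos := hG.posDet y hy
  have hs := hG.smooth y hy
  have hdet : fderiv ℝ (fun z ↦ (G z).det) y (EuclideanSpace.single k 1)
      = (G y).det * (2 * (chrisMat G k y).trace) := by
    -- Factoring out the constant matrix `G y` reduces to the derivative of the determinant at the
    -- identity.
    have e : (fun z ↦ (G z).det) = fun z ↦ (G y).det * ((G y)⁻¹ * G z).det := by
      ext z
      rw [Matrix.det_mul, ← mul_assoc, ← Matrix.det_mul, Matrix.mul_nonsing_inv _ (hG.isUnit_det hy),
        Matrix.det_one, one_mul]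
    have hF : MatSmoothAt (fun z ↦ (G y)⁻¹ * G z) y := (MatSmoothAt.const _).mul hs
    rw [e, fderiv_const_mul (hF.det.differentiableAt (by simp)), _root_.smul_apply,
      fderiv_det_of_eq_one hF (Matrix.nonsing_inv_mul _ (hG.isUnit_det hy)),
      matDeriv_mul k (.const _) hs, matDeriv_const, Matrix.zero_mul, zero_add,
      hG.matDeriv_metric hy, Matrix.mul_add, Matrix.trace_add, ← Matrix.mul_assoc,
      Matrix.trace_mul_comm, ← Matrix.mul_assoc, Matrix.mul_nonsing_inv _ (hG.isUnit_det hy),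
      ← Matrix.mul_assoc, Matrix.nonsing_inv_mul _ (hG.isUnit_det hy), Matrix.one_mul,
      Matrix.one_mul, Matrix.trace_transpose, smul_eq_mul]
    ring
  rw [fderiv_sqrt (hs.det.differentiableAt (by simp)) hpos.ne', _root_.smul_apply, hdet, smul_eq_mul]
  have := Real.mul_self_sqrt hpos.le
  have h0 := Real.sqrt_ne_zero'.2 hpos
  field_simp
  rw [sq, this]

lemma continuousAt_diagSum {F : Fin n → Fin n → EuclideanSpace ℝ (Fin n) → Matrix (Fin n) (Fin n) ℝ}
    {y : EuclideanSpace ℝ (Fin n)} (hF : ∀ k m, MatSmoothAt (F k m) y) :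
    ContinuousAt (fun z ↦ diagSum fun k m ↦ F k m z) y :=
  tendsto_finsetSum _ fun k _ ↦ tendsto_finsetSum _ fun m _ ↦ (hF k m k m).continuousAt

end MetricDensity

/-! ### Continuity of the integrands. -/

noncomputable section Continuity

open Matrix

variable {n : ℕ} {M : Type*} [TopologicalSpace M] [ChartedSpace (EuclideanSpace ℝ (Fin n)) M]

local notation "𝔼" => EuclideanSpace ℝ (Fin n)
local notation "𝕏" => chartAt (EuclideanSpace ℝ (Fin n))

/-- The integrands are defined with pointwise choices of bases, so continuity is read off from
basis-free expressions valid on whole charts. -/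
lemma continuous_of_chart {f : M → ℝ} (φ : M → EuclideanSpace ℝ (Fin n) → ℝ)
    (hφ : ∀ c, ContinuousAt (φ c) (𝕏 c c))
    (h : ∀ c, ∀ q ∈ (𝕏 c).source, f q = φ c (𝕏 c q)) : Continuous f := by
  refine continuous_iff_continuousAt.2 fun c ↦ ?_
  have hc := mem_chart_source 𝔼 c
  refine ((hφ c).comp ((𝕏 c).continuousAt hc)).congr ?_
  filter_upwards [(𝕏 c).open_source.mem_nhds hc] with q hq using (h c q hq).symm

variable [IsManifold (𝓡 n) ∞ M] [RiemannianBundle (fun x : M ↦ TangentSpace (𝓡 n) x)]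

variable [IsContMDiffRiemannianBundle (𝓡 n) ∞ (EuclideanSpace ℝ (Fin n))
  (fun x : M ↦ TangentSpace (𝓡 n) x)]

variable {c q : M} {D N : Π x : M, Submodule ℝ (TangentSpace (𝓡 n) x)} {p p' : ℕ}

lemma continuous_sumSigmaTwo (hN : IsSmoothDistribution p N) (hD : IsSmoothDistribution p' D)
    (hDN : ∀ x, D x = (N x)ᗮ) : Continuous (sumSigmaTwo D N) := by
  have hG := fun c : M ↦ isMetricOn_metricIn (n := n) c
  have h2 : Continuous fun q ↦ 2 * sumSigmaTwo D N q := by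
    refine continuous_of_chart (fun c y ↦
      (diagSum fun k m ↦ projIn c D y * covMat (metricIn c) k (projIn c N) y
        * covMat (metricIn c) m (projIn c N) y * (metricIn c y)⁻¹)
      - diagSum fun k m ↦ projIn c D y * covMat (metricIn c) m (projIn c N) y
        * covMat (metricIn c) k (projIn c N) y * (metricIn c y)⁻¹) (fun c ↦ ?_)
      fun c q hq ↦ sumSigmaTwo_eq hN hDN hq
    have hy : 𝕏 c c ∈ (𝕏 c).target := mem_chart_target 𝔼 c
    have hA := fun k ↦ (hG c).smooth_covMat hy k (matSmoothAt_projIn hN hy)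
    have hP := matSmoothAt_projIn hD hy
    exact (continuousAt_diagSum fun k m ↦ ((hP.mul (hA k)).mul (hA m)).mul ((hG c).smooth_inv hy)).sub
      (continuousAt_diagSum fun k m ↦ ((hP.mul (hA m)).mul (hA k)).mul ((hG c).smooth_inv hy))
  exact (h2.const_mul (1 / 2 : ℝ)).congr fun q ↦ by ring

lemma continuous_bendingDensity (hD : IsSmoothDistribution p D) (hDN : ∀ x, N x = (D x)ᗮ) :
    Continuous (bendingDensity D) := by
  have hG := fun c : M ↦ isMetricOn_metricIn (n := n) c
  refine continuous_of_chart (fun c y ↦ ∑ k, ∑ m, (metricIn c y)⁻¹ k m *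
      ((covMat (metricIn c) k (projIn c D) y)ᵀ * metricIn c y * covMat (metricIn c) m (projIn c D) y *
        (projIn c D y * (metricIn c y)⁻¹)).trace) (fun c ↦ ?_)
      fun c q hq ↦ bendingDensity_eq_trace hD hDN hq
  have hy : 𝕏 c c ∈ (𝕏 c).target := mem_chart_target 𝔼 c
  have hA := fun k ↦ (hG c).smooth_covMat hy k (matSmoothAt_projIn hD hy)
  have hP := matSmoothAt_projIn hD hy
  exact tendsto_finsetSum _ fun k _ ↦ tendsto_finsetSum _ fun m _ ↦
    ((hG c).smooth_inv hy k m).continuousAt.mul (tendsto_finsetSum _ fun i _ ↦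
      (((((hA k).transpose.mul ((hG c).smooth _ hy)).mul (hA m)).mul
        (hP.mul ((hG c).smooth_inv hy))) i i).continuousAt)

/-- The coordinate expression of the divergence. -/
lemma fieldDiv_eq_sum_fderiv {Y : Π q : M, TangentSpace (𝓡 n) q} (hq : q ∈ (𝕏 c).source)
    (hY : DifferentiableAt ℝ (fieldIn c Y) (𝕏 c q)) :
    fieldDiv Y q = ∑ k, (fderiv ℝ (fun y ↦ fieldIn c Y y k) (𝕏 c q) (EuclideanSpace.single k 1)
      + (chrisMat (metricIn c) k (𝕏 c q)).trace * fieldIn c Y (𝕏 c q) k) := by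
  have hG := isMetricOn_metricIn (n := n) c
  have hy := (𝕏 c).map_source hq
  rw [fieldDiv_eq hq hY, Finset.sum_add_distrib]
  simp only [covVec, PiLp.add_apply, Finset.sum_add_distrib]
  congr 1
  · refine Finset.sum_congr rfl fun k _ ↦ ?_
    have := ((EuclideanSpace.proj (𝕜 := ℝ) k).hasFDerivAt.comp (𝕏 c q) hY.hasFDerivAt).fderiv
    exact (DFunLike.congr_fun this (EuclideanSpace.single k 1)).symm
  · simp only [chrisBil, PiLp.single_apply, ite_mul, one_mul, zero_mul, Finset.sum_ite_eq',
      Finset.mem_univ, if_true, Matrix.mulVec, dotProduct, Matrix.trace, Matrix.diag,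
      Finset.sum_mul]
    rw [Finset.sum_comm]
    exact Finset.sum_congr rfl fun k _ ↦ Finset.sum_congr rfl fun m _ ↦ by
      rw [hG.chrisMat_comm hy]

lemma continuous_fieldDiv {Y : Π q : M, TangentSpace (𝓡 n) q} (hY : ∀ q, FieldSmoothAt Y q) :
    Continuous (fieldDiv Y) := by
  have hG := fun c : M ↦ isMetricOn_metricIn (n := n) c
  refine continuous_of_chart (fun c y ↦
    ∑ k, (fderiv ℝ (fun z ↦ fieldIn c Y z k) y (EuclideanSpace.single k 1)
      + (chrisMat (metricIn c) k y).trace * fieldIn c Y y k)) (fun c ↦ ?_)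
      fun c q hq ↦ fieldDiv_eq_sum_fderiv hq
        (((fieldSmoothAt_iff hq).1 (hY q)).differentiableAt (by simp))
  have hy : 𝕏 c c ∈ (𝕏 c).target := mem_chart_target 𝔼 c
  have hW := contDiffAt_euclidean.1 ((fieldSmoothAt_iff (mem_chart_source 𝔼 c)).1 (hY c))
  refine tendsto_finsetSum _ fun k _ ↦ ContinuousAt.add ?_ (ContinuousAt.mul ?_ (hW k).continuousAt)
  · have := ((hW k).fderiv_right (m := 0) (by simp)).continuousAt
    exact this.clm_apply continuousAt_const
  · exact tendsto_finsetSum _ fun i _ ↦ ((hG c).smooth_chrisMat hy k i i).continuousAt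

/-- The coordinate formula for `K₁₂` holds only at the centre of a chart and says nothing about
nearby points. Continuity follows instead by solving the divergence formula for `K₁₂`. -/
lemma continuous_mixedScalarCurvature (hD : IsSmoothDistribution p D)
    (hN : IsSmoothDistribution p' N) (hDN : ∀ x, N x = (D x)ᗮ) :
    Continuous (mixedScalarCurvature D N) := by
  have hDN' := eq_orthogonal_of_eq_orthogonal hDN
  refine (((continuous_fieldDiv (fieldSmoothAt_mixedField hD hN hDN)).add
    ((continuous_sumSigmaTwo hN hD hDN').const_mul 2)).add
    ((continuous_sumSigmaTwo hD hN hDN).const_mul 2)).congr fun q ↦ ?_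
  simp only [Pi.add_apply, fieldDiv_mixedField hD hN hDN]
  ring

end Continuity

/-! ### Gluing compatible measures. -/

section MeasureGluing

open Set Measure

/-- Measures on the sets of a countable cover that agree on overlaps are the restrictions of
their supremum. -/
lemma iSup_measure_restrict {X ι : Type*} [MeasurableSpace X] {m : ι → Measure X} {S : ι → Set X}
    (hS : ∀ i, MeasurableSet (S i)) (h0 : ∀ i, m i (S i)ᶜ = 0)
    (h : ∀ i j s, MeasurableSet s → s ⊆ S i → s ⊆ S j → m i s = m j s)
    {T : Set ι} (hT : T.Countable) (hcov : ⋃ i ∈ T, S i = univ) (i : ι) :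
    (⨆ i, m i).restrict (S i) = m i := by
  obtain ⟨f, hf⟩ := (hT.insert i).exists_eq_range (insert_nonempty i T)
  have hcov' : ⋃ k, S (f k) = univ := by
    refine univ_subset_iff.1 (hcov ▸ iUnion₂_subset fun j hj ↦ ?_)
    obtain ⟨k, rfl⟩ : j ∈ range f := hf ▸ mem_insert_of_mem i hj
    exact subset_iUnion (fun k ↦ S (f k)) k
  set A := disjointed fun k ↦ S (f k)
  have hA : ∀ k, MeasurableSet (A k) := fun k ↦ .disjointed (fun k ↦ hS (f k)) k
  have hAS : ∀ k, A k ⊆ S (f k) := disjointed_subset _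
  have hsum : ∀ (μ : Measure X) s, MeasurableSet s → μ s = ∑' k, μ (s ∩ A k) := fun μ s hs ↦ by
    rw [← measure_iUnion (fun a b hab ↦ ((disjoint_disjointed _ hab).mono inter_subset_right
      inter_subset_right)) fun k ↦ hs.inter (hA k), ← inter_iUnion, iUnion_disjointed, hcov',
      inter_univ]
  have hm : ∀ j s, m j s = m j (s ∩ S j) := fun j s ↦
    (measure_inter_conull' (by
      refine measure_mono_null ?_ (h0 j)
      intro x hx
      exact hx.2)).symm
  -- The cover is cut into disjoint pieces. On each piece the measure of the corresponding set
  -- dominates all others by compatibility, so the supremum is the sum over the pieces.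
  have hν : (⨆ i, m i) = sum fun k ↦ (m (f k)).restrict (A k) := by
    refine le_antisymm (iSup_le fun j ↦ Measure.le_iff.2 fun s hs ↦ ?_)
      (Measure.le_iff.2 fun s hs ↦ ?_)
    · rw [hsum _ s hs, sum_apply _ hs]
      refine ENNReal.tsum_le_tsum fun k ↦ ?_
      rw [restrict_apply hs, hm j, h j (f k) _ ((hs.inter (hA k)).inter (hS j)) inter_subset_right
        (inter_subset_left.trans (inter_subset_right.trans (hAS k)))]
      exact measure_mono inter_subset_left
    · rw [sum_apply _ hs, hsum (⨆ i, m i) s hs]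
      refine ENNReal.tsum_le_tsum fun k ↦ ?_
      rw [restrict_apply hs]
      exact le_iSup m (f k) _
  ext s hs
  rw [restrict_apply hs, hν, sum_apply _ (hs.inter (hS i)), hm i s, hsum _ _ (hs.inter (hS i))]
  refine tsum_congr fun k ↦ ?_
  rw [restrict_apply (hs.inter (hS i))]
  exact h _ _ _ ((hs.inter (hS i)).inter (hA k)) (inter_subset_right.trans (hAS k))
    (inter_subset_left.trans inter_subset_right)

end MeasureGluing

/-! ### The Riemannian volume measure. -/

noncomputable section Volume

open Matrix

variable {n : ℕ} {M : Type*} [TopologicalSpace M] [ChartedSpace (EuclideanSpace ℝ (Fin n)) M]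

local notation "𝔼" => EuclideanSpace ℝ (Fin n)
local notation "𝕏" => chartAt (EuclideanSpace ℝ (Fin n))

variable (n M) in
lemma exists_finset_cover_chart_source [CompactSpace M] :
    ∃ T : Finset M, ⋃ c ∈ T, (chartAt (EuclideanSpace ℝ (Fin n)) c).source = Set.univ := by
  obtain ⟨T, hT⟩ := isCompact_univ.elim_finite_subcover
    (fun c : M ↦ (chartAt (EuclideanSpace ℝ (Fin n)) c).source)
    (fun c ↦ (chartAt (EuclideanSpace ℝ (Fin n)) c).open_source)
    fun q _ ↦ Set.mem_iUnion.2 ⟨q, mem_chart_source _ q⟩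
  exact ⟨T, Set.univ_subset_iff.1 hT⟩

lemma det_metricIn_chartChange [IsManifold (𝓡 n) ∞ M]
    [RiemannianBundle (fun x : M ↦ TangentSpace (𝓡 n) x)] {c c' q : M} (hq : q ∈ (𝕏 c).source) (hq' : q ∈ (𝕏 c').source) :
    (metricIn (n := n) c' (𝕏 c' q)).det
      = (fderiv ℝ (chartChange c c') (𝕏 c' q)).det ^ 2 * (metricIn (n := n) c (𝕏 c q)).det := by
  set L := fderiv ℝ (chartChange c c') (𝕏 c' q)
  set J := LinearMap.toMatrix (EuclideanSpace.basisFun (Fin n) ℝ).toBasis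
    (EuclideanSpace.basisFun (Fin n) ℝ).toBasis L.toLinearMap
  have hJ : L.det = J.det := (LinearMap.det_toMatrix _ _).symm
  have hG : metricIn (n := n) c' (𝕏 c' q) = Jᵀ * metricIn c (𝕏 c q) * J := by
    ext i j
    rw [metricIn_chart hq', metricIn_chart hq, gramMatrix, Matrix.of_apply, inner_eq_gramForm hq,
      toChart_eq_fderiv hq hq', toChart_eq_fderiv hq hq', toChart_coordVec hq',
      toChart_coordVec hq', gramForm_eq_dotProduct, Matrix.mul_assoc]
    have hcol : ∀ j, (⇑(L (EuclideanSpace.single j 1)) : Fin n → ℝ) = J.col j := fun j ↦ by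
      ext k
      simp [J, LinearMap.toMatrix_apply]
    rw [hcol, hcol]
    rfl
  rw [hG, Matrix.det_mul, Matrix.det_mul, Matrix.det_transpose, hJ]
  ring

variable [MeasurableSpace M] [BorelSpace M]

lemma measurableSet_symm_preimage (c : M) {s : Set M} (hs : MeasurableSet s) :
    MeasurableSet ((𝕏 c).symm ⁻¹' s ∩ (𝕏 c).target) := by
  have ht := (𝕏 c).open_target.measurableSet
  have h := ((continuousOn_iff_continuous_domRestrict.1 (𝕏 c).continuousOn_symm).measurable hs)
  have h2 := ht.subtype_image h
  convert h2 using 1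
  ext y
  simp [and_comm]

variable [IsManifold (𝓡 n) ∞ M] [RiemannianBundle (fun x : M ↦ TangentSpace (𝓡 n) x)]

lemma chartVolume_apply (c : M) {s : Set M} (hs : MeasurableSet s) :
    chartVolume n c s = ∫⁻ y in (𝕏 c).symm ⁻¹' s ∩ (𝕏 c).target,
      ENNReal.ofReal √(metricIn c y).det := by
  have ht := (𝕏 c).open_target.measurableSet
  have hm : AEMeasurable (𝕏 c).symm ((volume.restrict (𝕏 c).target).withDensity fun y ↦
      ENNReal.ofReal √(gramMatrix (n := n) c ((𝕏 c).symm y)).det) :=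
    ((𝕏 c).continuousOn_symm.aemeasurable ht).mono_ac (withDensity_absolutelyContinuous _ _)
  rw [chartVolume, Measure.map_apply_of_aemeasurable hm hs, withDensity_apply',
    Measure.restrict_restrict' ht]
  rfl

lemma chartVolume_compl_source (c : M) : chartVolume n c (𝕏 c).sourceᶜ = 0 := by
  rw [chartVolume_apply c (𝕏 c).open_source.measurableSet.compl]
  have : (𝕏 c).symm ⁻¹' (𝕏 c).sourceᶜ ∩ (𝕏 c).target = ∅ := by
    ext y
    simp only [Set.mem_inter_iff, Set.mem_preimage, Set.mem_compl_iff, Set.mem_empty_iff_false,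
      iff_false, not_and]
    intro h hy
    exact h ((𝕏 c).map_target hy)
  rw [this]
  simp

/-- The change of variables formula for the transition map: the factor `|det J|` is absorbed since
the Gram determinants differ by `(det J)²`. -/
lemma chartVolume_eq_of_subset (c c' : M) {s : Set M} (hs : MeasurableSet s)
    (hc : s ⊆ (𝕏 c).source) (hc' : s ⊆ (𝕏 c').source) :
    chartVolume n c s = chartVolume n c' s := by
  rw [chartVolume_apply c hs, chartVolume_apply c' hs]
  set B := (𝕏 c').symm ⁻¹' s ∩ (𝕏 c').target
  have him : (𝕏 c).symm ⁻¹' s ∩ (𝕏 c).target = chartChange c c' '' B := by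
    ext y
    constructor
    · rintro ⟨hy, hyt⟩
      refine ⟨𝕏 c' ((𝕏 c).symm y), ⟨?_, (𝕏 c').map_source (hc' hy)⟩, ?_⟩
      · rw [Set.mem_preimage, (𝕏 c').left_inv (hc' hy)]; exact hy
      · rw [chartChange, Function.comp_apply, (𝕏 c').left_inv (hc' hy), (𝕏 c).right_inv hyt]
    · rintro ⟨z, ⟨hz, -⟩, rfl⟩
      refine ⟨?_, (𝕏 c).map_source (hc hz)⟩
      rw [Set.mem_preimage, chartChange, Function.comp_apply, (𝕏 c).left_inv (hc hz)]
      exact hz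
  have hinj : Set.InjOn (chartChange c c') B := fun a ha b hb hab ↦
    (𝕏 c').symm.injOn ha.2 hb.2 ((𝕏 c).injOn (hc ha.1) (hc hb.1) hab)
  have hB : MeasurableSet B := measurableSet_symm_preimage c' hs
  rw [him, lintegral_image_eq_lintegral_abs_det_fderiv_mul volume hB (fun z hz ↦
    HasFDerivAt.hasFDerivWithinAt (f' := fderiv ℝ (chartChange c c') z) ?_) hinj]
  · refine setLIntegral_congr_fun hB fun z hz ↦ ?_
    have h := det_metricIn_chartChange (hc hz.1) (hc' hz.1)
    rw [(𝕏 c').right_inv hz.2] at h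
    simp only [chartChange, Function.comp_apply] at h ⊢
    rw [h, ← ENNReal.ofReal_mul (abs_nonneg _), Real.sqrt_mul (sq_nonneg _), Real.sqrt_sq_eq_abs]
  · have h := contDiffAt_chartChange (hc hz.1) (hc' hz.1)
    rw [(𝕏 c').right_inv hz.2] at h
    exact (h.differentiableAt (by simp)).hasFDerivAt

variable [CompactSpace M]

/-- The Riemannian volume is the volume of the chart on the domain of each chart. -/
theorem riemannianVolume_restrict (c : M) :
    (riemannianVolume n M).restrict (𝕏 c).source = chartVolume n c := by
  obtain ⟨T, hT⟩ := exists_finset_cover_chart_source n M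
  exact iSup_measure_restrict (fun c ↦ (𝕏 c).open_source.measurableSet) chartVolume_compl_source
    (fun c c' s hs hc hc' ↦ chartVolume_eq_of_subset c c' hs hc hc') T.countable_toSet hT c

variable [IsContMDiffRiemannianBundle (𝓡 n) ∞ (EuclideanSpace ℝ (Fin n))
  (fun x : M ↦ TangentSpace (𝓡 n) x)]

/-- The volume density is locally bounded, so the measure is locally finite, and `M` is compact. -/
instance isFiniteMeasure_riemannianVolume : IsFiniteMeasure (riemannianVolume n M) := by
  have : IsLocallyFiniteMeasure (riemannianVolume n M) := ⟨fun q ↦ by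
    have hq := mem_chart_source 𝔼 q
    have hy : 𝕏 q q ∈ (𝕏 q).target := mem_chart_target 𝔼 q
    have hcont : ContinuousAt (fun y ↦ √(metricIn (n := n) q y).det) (𝕏 q q) :=
      (((isMetricOn_metricIn q).smooth _ hy).det.continuousAt).sqrt
    have hev := ((hcont.eventually_lt_const (lt_add_one _)).and
      ((𝕏 q).open_target.mem_nhds hy)).and (Metric.ball_mem_nhds (𝕏 q q) one_pos)
    obtain ⟨W, hW, hWo, hqW⟩ := eventually_nhds_iff.1 hev
    have hU : IsOpen ((𝕏 q).source ∩ 𝕏 q ⁻¹' W) := (𝕏 q).isOpen_inter_preimage hWo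
    refine ⟨_, hU.mem_nhds ⟨hq, hqW⟩, ?_⟩
    have e : riemannianVolume n M ((𝕏 q).source ∩ 𝕏 q ⁻¹' W)
        = chartVolume n q ((𝕏 q).source ∩ 𝕏 q ⁻¹' W) := by
      rw [← riemannianVolume_restrict q, Measure.restrict_apply hU.measurableSet,
        Set.inter_eq_left.2 Set.inter_subset_left]
    rw [e, chartVolume_apply q hU.measurableSet]
    have hsub : (𝕏 q).symm ⁻¹' ((𝕏 q).source ∩ 𝕏 q ⁻¹' W) ∩ (𝕏 q).target ⊆ W := by
      rintro y ⟨⟨-, hy⟩, hyt⟩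
      rwa [Set.mem_preimage, (𝕏 q).right_inv hyt] at hy
    calc _ ≤ ∫⁻ y in W, ENNReal.ofReal √(metricIn (n := n) q y).det :=
          lintegral_mono_set hsub
      _ ≤ ∫⁻ y in W, ENNReal.ofReal (√(metricIn (n := n) q (𝕏 q q)).det + 1) :=
          setLIntegral_mono measurable_const fun y hy ↦
            ENNReal.ofReal_le_ofReal (hW y hy).1.1.le
      _ = ENNReal.ofReal (√(metricIn (n := n) q (𝕏 q q)).det + 1) * volume W :=
          setLIntegral_const _ _
      _ < ⊤ := ENNReal.mul_lt_top ENNReal.ofReal_lt_top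
          ((measure_mono fun y hy ↦ (hW y hy).2).trans_lt measure_ball_lt_top)⟩
  exact ⟨isCompact_univ.measure_lt_top⟩

lemma integrable_of_continuous {f : M → ℝ} (hf : Continuous f) :
    Integrable f (riemannianVolume n M) := by
  have := (hf.continuousOn (s := Set.univ)).integrableOn_compact'
    (μ := riemannianVolume n M) isCompact_univ .univ
  rwa [integrableOn_univ] at this

/-- The integral of a function supported in the domain of a chart. -/
lemma integral_riemannianVolume_eq {f : M → ℝ} (hf : Continuous f) (c : M)
    (hfc : ∀ q ∉ (𝕏 c).source, f q = 0) :
    ∫ q, f q ∂(riemannianVolume n M)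
      = ∫ y in (𝕏 c).target, √(metricIn (n := n) c y).det * f ((𝕏 c).symm y) := by
  have ht := (𝕏 c).open_target.measurableSet
  have hm : AEMeasurable (𝕏 c).symm ((volume.restrict (𝕏 c).target).withDensity fun y ↦
      ENNReal.ofReal √(gramMatrix (n := n) c ((𝕏 c).symm y)).det) :=
    ((𝕏 c).continuousOn_symm.aemeasurable ht).mono_ac (withDensity_absolutelyContinuous _ _)
  have hd : ContinuousOn (fun y ↦ ENNReal.ofReal √(gramMatrix (n := n) c ((𝕏 c).symm y)).det)
      (𝕏 c).target := fun y hy ↦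
    (ENNReal.continuous_ofReal.continuousAt.comp
      (((isMetricOn_metricIn c).smooth y hy).det.continuousAt).sqrt).continuousWithinAt
  rw [← setIntegral_eq_integral_of_forall_compl_eq_zero hfc, riemannianVolume_restrict, chartVolume,
    integral_map hm hf.aestronglyMeasurable,
    integral_withDensity_eq_integral_toReal_smul₀ (hd.aemeasurable ht)
      (Filter.Eventually.of_forall fun _ ↦ ENNReal.ofReal_lt_top)]
  refine setIntegral_congr_fun ht fun y _ ↦ ?_
  simp only [ENNReal.toReal_ofReal (Real.sqrt_nonneg _)]
  rfl

end Volume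

/-! ### Integrals of derivatives on `ℝⁿ`. -/

noncomputable section EuclideanDivergence

variable {n : ℕ}

/-- The integral of a derivative of a compactly supported function vanishes. -/
lemma integral_fderiv_eq_zero {f : EuclideanSpace ℝ (Fin n) → ℝ} (hf : ContDiff ℝ 1 f)
    (hc : HasCompactSupport f) (v : EuclideanSpace ℝ (Fin n)) : ∫ y, fderiv ℝ f y v = 0 := by
  have h1 : Integrable fun y ↦ fderiv ℝ f y v :=
    ((hf.continuous_fderiv one_ne_zero).clm_apply continuous_const).integrable_of_hasCompactSupport
      (hc.fderiv_apply ℝ v)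
  -- Integration by parts against the constant function one.
  have h := integral_mul_fderiv_eq_neg_fderiv_mul_of_integrable (μ := volume) (𝕜 := ℝ)
    (f := fun _ ↦ (1 : ℝ)) (g := f) (v := v) (by simp) (by simpa using h1)
    (by simpa using hf.continuous.integrable_of_hasCompactSupport hc)
    (fun _ _ ↦ differentiableAt_const _) fun y _ ↦ (hf.differentiable one_ne_zero) y
  simpa using h

end EuclideanDivergence

/-! ### The divergence theorem on the manifold. -/

noncomputable section Divergence

open Matrix

variable {n : ℕ} {M : Type*} [TopologicalSpace M] [ChartedSpace (EuclideanSpace ℝ (Fin n)) M]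

local notation "𝔼" => EuclideanSpace ℝ (Fin n)
local notation "𝕏" => chartAt (EuclideanSpace ℝ (Fin n))

variable [IsManifold (𝓡 n) ∞ M] [RiemannianBundle (fun x : M ↦ TangentSpace (𝓡 n) x)]
  [IsContMDiffRiemannianBundle (𝓡 n) ∞ (EuclideanSpace ℝ (Fin n))
    (fun x : M ↦ TangentSpace (𝓡 n) x)]

lemma fieldDiv_eq_zero_of_eventually {Y : Π q : M, TangentSpace (𝓡 n) q} {q : M}
    (h : ∀ᶠ r in nhds q, Y r = 0) : fieldDiv Y q = 0 := by
  have hq := mem_chart_source 𝔼 q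
  have hy : 𝕏 q q ∈ (𝕏 q).target := mem_chart_target 𝔼 q
  have h0 : fieldIn q Y =ᶠ[nhds (𝕏 q q)] fun _ ↦ 0 := by
    have h1 := (𝕏 q).continuousAt_symm hy
    rw [ContinuousAt, (𝕏 q).left_inv hq] at h1
    filter_upwards [h1.eventually h] with z hz
    rw [fieldIn, hz, map_zero]
  rw [fieldDiv_eq_sum_fderiv hq (h0.differentiableAt_iff.2 (differentiableAt_const _))]
  refine Finset.sum_eq_zero fun k _ ↦ ?_
  have h1 : (fun y ↦ fieldIn q Y y k) =ᶠ[nhds (𝕏 q q)] fun _ ↦ 0 := by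
    filter_upwards [h0] with z hz
    rw [hz]; rfl
  rw [h1.fderiv_eq, h0.eq_of_nhds]
  simp

variable [MeasurableSpace M] [BorelSpace M] [CompactSpace M]

/-- The divergence theorem for a field supported in the domain of a chart. -/
lemma integral_fieldDiv_of_support {Y : Π q : M, TangentSpace (𝓡 n) q}
    (hY : ∀ q, FieldSmoothAt Y q) (c : M) {K : Set M} (hK : IsClosed K) (hKc : K ⊆ (𝕏 c).source)
    (hYK : ∀ q ∉ K, Y q = 0) :
    ∫ q, fieldDiv Y q ∂(riemannianVolume n M) = 0 := by
  have hG := isMetricOn_metricIn (n := n) c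
  have hdiv : ∀ q ∉ K, fieldDiv Y q = 0 := fun q hq ↦ by
    refine fieldDiv_eq_zero_of_eventually ?_
    filter_upwards [hK.isOpen_compl.mem_nhds hq] with r hr using hYK r hr
  rw [integral_riemannianVolume_eq (continuous_fieldDiv hY) c fun q hq ↦ hdiv q fun h ↦ hq (hKc h)]
  have ht := (𝕏 c).open_target.measurableSet
  set L : Set 𝔼 := 𝕏 c '' K
  have hL : IsCompact L := hK.isCompact.image_of_continuousOn ((𝕏 c).continuousOn.mono hKc)
  have hLt : L ⊆ (𝕏 c).target := by
    rintro _ ⟨q, hq, rfl⟩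
    exact (𝕏 c).map_source (hKc hq)
  set F : Fin n → 𝔼 → ℝ := fun k y ↦ √(metricIn (n := n) c y).det * fieldIn c Y y k
  -- Extension by zero of `√(det g) Yᵏ`. It is differentiable on all of `ℝⁿ` because its support
  -- lies in the compact set `L` inside the chart.
  set V : Fin n → 𝔼 → ℝ := fun k ↦ (𝕏 c).target.indicator (F k)
  have hW : ∀ y ∈ (𝕏 c).target, ContDiffAt ℝ ∞ (fieldIn c Y) y := fun y hy ↦ by
    have := (fieldSmoothAt_iff ((𝕏 c).map_target hy)).1 (hY ((𝕏 c).symm y))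
    rwa [(𝕏 c).right_inv hy] at this
  have hs : ∀ y ∈ (𝕏 c).target, ContDiffAt ℝ ∞ (fun y ↦ √(metricIn (n := n) c y).det) y :=
    fun y hy ↦ ((hG.smooth y hy).det).sqrt (hG.posDet y hy).ne'
  have hVF : ∀ k, ∀ y ∈ (𝕏 c).target, V k =ᶠ[nhds y] F k := fun k y hy ↦ by
    filter_upwards [(𝕏 c).open_target.mem_nhds hy] with z hz using Set.indicator_of_mem hz _
  have hV0 : ∀ k, ∀ y ∉ L, V k y = 0 := fun k y hy ↦ by
    by_cases hyt : y ∈ (𝕏 c).target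
    · have : (𝕏 c).symm y ∉ K := fun h ↦ hy ⟨_, h, (𝕏 c).right_inv hyt⟩
      simp only [V, F, Set.indicator_of_mem hyt, fieldIn, hYK _ this, map_zero]
      exact mul_zero _
    · exact Set.indicator_of_notMem hyt _
  have hVs : ∀ k, ContDiff ℝ 1 (V k) := fun k ↦ contDiff_iff_contDiffAt.2 fun y ↦ by
    by_cases hy : y ∈ L
    · have := ((hs y (hLt hy)).mul (contDiffAt_euclidean.1 (hW y (hLt hy)) k)).congr_of_eventuallyEq
        (hVF k y (hLt hy))
      exact this.of_le (by simp)
    · refine (contDiffAt_const (c := (0 : ℝ))).congr_of_eventuallyEq ?_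
      filter_upwards [hL.isClosed.isOpen_compl.mem_nhds hy] with z hz using hV0 k z hz
  have hVc : ∀ k, HasCompactSupport (V k) := fun k ↦ HasCompactSupport.intro hL fun y hy ↦ hV0 k y hy
  -- The classical formula `√(det g) div Y = ∑ ∂ₖ(√(det g) Yᵏ)`, from `∂ₖ√(det g) = √(det g) tr Γₖ`.
  have key : ∀ y ∈ (𝕏 c).target, √(metricIn (n := n) c y).det * fieldDiv Y ((𝕏 c).symm y)
      = ∑ k, fderiv ℝ (V k) y (EuclideanSpace.single k 1) := fun y hy ↦ by
    have hd : DifferentiableAt ℝ (fieldIn c Y) (𝕏 c ((𝕏 c).symm y)) := by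
      rw [(𝕏 c).right_inv hy]; exact (hW y hy).differentiableAt (by simp)
    rw [fieldDiv_eq_sum_fderiv ((𝕏 c).map_target hy) hd, (𝕏 c).right_inv hy, Finset.mul_sum]
    refine Finset.sum_congr rfl fun k _ ↦ ?_
    rw [(hVF k y hy).fderiv_eq, fderiv_fun_mul ((hs y hy).differentiableAt (by simp))
      ((contDiffAt_euclidean.1 (hW y hy) k).differentiableAt (by simp)), _root_.add_apply,
      _root_.smul_apply, _root_.smul_apply, hG.fderiv_sqrt_det hy, smul_eq_mul, smul_eq_mul]
    ring
  rw [setIntegral_congr_fun ht key, setIntegral_eq_integral_of_forall_compl_eq_zero,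
    integral_finsetSum]
  · exact Finset.sum_eq_zero fun k _ ↦ integral_fderiv_eq_zero (hVs k) (hVc k) _
  · intro k _
    exact (((hVs k).continuous_fderiv one_ne_zero).clm_apply
      continuous_const).integrable_of_hasCompactSupport ((hVc k).fderiv_apply ℝ _)
  · intro y hy
    refine Finset.sum_eq_zero fun k _ ↦ ?_
    have : V k =ᶠ[nhds y] fun _ ↦ 0 := by
      filter_upwards [hL.isClosed.isOpen_compl.mem_nhds fun h ↦ hy (hLt h)] with z hz
        using hV0 k z hz
    rw [this.fderiv_eq]
    simp

/-- The divergence theorem on a closed manifold. -/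
theorem integral_fieldDiv [T2Space M] {Y : Π q : M, TangentSpace (𝓡 n) q} (hY : ∀ q, FieldSmoothAt Y q) :
    ∫ q, fieldDiv Y q ∂(riemannianVolume n M) = 0 := by
  obtain ⟨T, hT⟩ := exists_finset_cover_chart_source n M
  obtain ⟨ρ, hρ⟩ := SmoothPartitionOfUnity.exists_isSubordinate (𝓡 n) isClosed_univ
    (fun c : T ↦ (𝕏 (c : M)).source) (fun c ↦ (𝕏 (c : M)).open_source) (by
      rw [← hT, Set.iUnion_subtype])
  have hsm : ∀ i q, FieldSmoothAt (fun r ↦ ρ i r • Y r) q := fun i q ↦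
    ContMDiffAt.smul_section ((ρ i).contMDiff.contMDiffAt) (hY q)
  -- Only additivity of the divergence is used: `Y` is the finite sum of the fields `ρ i • Y`, each
  -- supported in one chart.
  have hsum : ∀ q, fieldDiv Y q = ∑ i, fieldDiv (fun r ↦ ρ i r • Y r) q := fun q ↦ by
    have hq := mem_chart_source 𝔼 q
    have hd := fun i ↦ ((fieldSmoothAt_iff hq).1 (hsm i q)).differentiableAt (by simp)
    have hd' := ((fieldSmoothAt_iff hq).1 (hY q)).differentiableAt (by simp)
    have hW : fieldIn q Y = fun y ↦ ∑ i, fieldIn q (fun r ↦ ρ i r • Y r) y := by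
      ext1 y
      simp only [fieldIn, map_smul, ← Finset.sum_smul]
      have h1 := ρ.sum_eq_one (Set.mem_univ ((𝕏 q).symm y))
      rw [finsum_eq_sum_of_fintype] at h1
      rw [h1, one_smul]
    rw [fieldDiv_eq_sum_fderiv hq hd', Finset.sum_congr rfl fun i _ ↦
      fieldDiv_eq_sum_fderiv hq (hd i), Finset.sum_comm]
    refine Finset.sum_congr rfl fun k _ ↦ ?_
    have hWk : (fun y ↦ fieldIn q Y y k)
        = fun y ↦ ∑ i, fieldIn q (fun r ↦ ρ i r • Y r) y k := by
      ext1 y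
      rw [hW, WithLp.ofLp_sum, Finset.sum_apply]
    rw [Finset.sum_add_distrib, ← Finset.mul_sum, ← congr_fun hWk (𝕏 q q), hWk,
      fderiv_fun_sum fun i _ ↦ (contDiffAt_euclidean.1 ((fieldSmoothAt_iff hq).1 (hsm i q))
        k).differentiableAt (by simp), _root_.sum_apply]
  simp only [hsum]
  rw [integral_finsetSum _ fun i _ ↦ integrable_of_continuous (continuous_fieldDiv (hsm i))]
  refine Finset.sum_eq_zero fun i _ ↦ integral_fieldDiv_of_support (hsm i) i
    (isClosed_tsupport (ρ i)) (hρ i) fun q hq ↦ ?_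
  rw [image_eq_zero_of_notMem_tsupport hq, zero_smul]

end Divergence

/-! ### The main theorem. -/

theorem proposition4 {n p₁ p₂ : ℕ} (hp₁ : 2 ≤ p₁) (hp₂ : 2 ≤ p₂) (hn : p₁ + p₂ = n)
    {M : Type*} [TopologicalSpace M] [ChartedSpace (EuclideanSpace ℝ (Fin n)) M]
    [IsManifold (𝓡 n) ∞ M] [T2Space M] [CompactSpace M] [MeasurableSpace M] [BorelSpace M]
    [RiemannianBundle (fun x : M ↦ TangentSpace (𝓡 n) x)]
    [IsContMDiffRiemannianBundle (𝓡 n) ∞ (EuclideanSpace ℝ (Fin n))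
      (fun x : M ↦ TangentSpace (𝓡 n) x)]
    (D₁ D₂ : Π x : M, Submodule ℝ (TangentSpace (𝓡 n) x))
    (hD₁ : IsSmoothDistribution p₁ D₁) (hD₂ : IsSmoothDistribution p₂ D₂)
    (hD : ∀ x, D₂ x = (D₁ x)ᗮ) (c : ℝ) (hc : 0 ≤ c) :
    (Integrable (bendingDensity D₁) (riemannianVolume n M) ∧
      Integrable (sumSigmaTwo D₁ D₂) (riemannianVolume n M) ∧
      Integrable (sumSigmaTwo D₂ D₁) (riemannianVolume n M) ∧
      Integrable (mixedScalarCurvature D₁ D₂) (riemannianVolume n M)) ∧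
    c * ∫ x, (2 / ((p₁ : ℝ) - 1) * sumSigmaTwo D₁ D₂ x + 2 / ((p₂ : ℝ) - 1) * sumSigmaTwo D₂ D₁ x)
        ∂(riemannianVolume n M) ≤ totalBending c D₁ ∧
    ∀ p : ℕ, p₁ = p → p₂ = p →
      c * ∫ x, (2 / ((p₁ : ℝ) - 1) * sumSigmaTwo D₁ D₂ x +
          2 / ((p₂ : ℝ) - 1) * sumSigmaTwo D₂ D₁ x) ∂(riemannianVolume n M) =
        c / ((p : ℝ) - 1) * totalMixedScalarCurvature D₁ D₂ ∧
      c / ((p : ℝ) - 1) * totalMixedScalarCurvature D₁ D₂ ≤ totalBending c D₁ := by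
  have hD' := eq_orthogonal_of_eq_orthogonal hD
  have hB : Integrable (bendingDensity D₁) (riemannianVolume n M) :=
    integrable_of_continuous (continuous_bendingDensity hD₁ hD)
  have hS₁ : Integrable (sumSigmaTwo D₁ D₂) (riemannianVolume n M) :=
    integrable_of_continuous (continuous_sumSigmaTwo hD₂ hD₁ hD')
  have hS₂ : Integrable (sumSigmaTwo D₂ D₁) (riemannianVolume n M) :=
    integrable_of_continuous (continuous_sumSigmaTwo hD₁ hD₂ hD)
  have hK : Integrable (mixedScalarCurvature D₁ D₂) (riemannianVolume n M) :=
    integrable_of_continuous (continuous_mixedScalarCurvature hD₁ hD₂ hD)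
  have hle : c * ∫ x, (2 / ((p₁ : ℝ) - 1) * sumSigmaTwo D₁ D₂ x
      + 2 / ((p₂ : ℝ) - 1) * sumSigmaTwo D₂ D₁ x) ∂(riemannianVolume n M) ≤ totalBending c D₁ :=
    mul_le_mul_of_nonneg_left (integral_mono ((hS₁.const_mul _).add (hS₂.const_mul _)) hB
      fun x ↦ sumSigmaTwo_le_bendingDensity hp₁ hp₂ hD₁ hD₂ hD x) hc
  refine ⟨⟨hB, hS₁, hS₂, hK⟩, hle, fun p h₁ h₂ ↦ ?_⟩
  have heq : c * ∫ x, (2 / ((p₁ : ℝ) - 1) * sumSigmaTwo D₁ D₂ x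
      + 2 / ((p₂ : ℝ) - 1) * sumSigmaTwo D₂ D₁ x) ∂(riemannianVolume n M)
      = c / ((p : ℝ) - 1) * totalMixedScalarCurvature D₁ D₂ := by
    -- Integrating the divergence formula over `M` gives `I_K = 2 ∫ ∑ σ₂(C₁^α) + 2 ∫ ∑ σ₂(C₂^i)`.
    -- For equal ranks both sums carry the same coefficient `2 / (p - 1)`, so the right-hand side of
    -- the bound is a multiple of `I_K`.
    have hdiv := integral_fieldDiv (fieldSmoothAt_mixedField hD₁ hD₂ hD)
    simp only [fieldDiv_mixedField hD₁ hD₂ hD] at hdiv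
    rw [integral_sub (f := fun q ↦ mixedScalarCurvature D₁ D₂ q - 2 * sumSigmaTwo D₁ D₂ q)
      (hK.sub (hS₁.const_mul 2)) (hS₂.const_mul 2), integral_sub hK
      (hS₁.const_mul 2), integral_const_mul, integral_const_mul] at hdiv
    rw [integral_add (hS₁.const_mul _) (hS₂.const_mul _), integral_const_mul, integral_const_mul,
      totalMixedScalarCurvature, h₁, h₂]
    linear_combination -(c / ((p : ℝ) - 1)) * hdiv
  exact ⟨heq, heq ▸ hle⟩
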